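/- A *randomness recycler* (RR) for target weights $w_{\mathrm{tar}}\ge 0$ on a finite set $X$ keeps a state $x\in X$ and an index $i$ that stands for weights $w_i\ge 0$ on $X$. It starts with a state drawn from the weights $w_{i_0}$ of an initial index $i_0$. A step from index $i$ splits the weights, moving to index $j$ with probability $p_j(x)$ (where $\sum_j p_j(x)=1$), and then moves the state by a transition function $q_{ij}(x,y)$; the resulting weights $y\mapsto\sum_x w_i(x)p_j(x)q_{ij}(x,y)$ must be a multiple of $w_j$. It stops only at an index whose weights are a positive multiple of $w_{\mathrm{tar}}$, and outputs its state. **Theorem.** There are a randomized word-RAM program, consisting of an initialization and of a step that is repeated until a stop flag is set, and absolute constants $c, C$ with the following properties. The program takes as input $k\ge 1$ and the neighbor lists of a simple graph $G$ with $n$ nodes and maximum degree $\Delta$, and runs on a machine with fair random bits and words of any length $w\ge c(\lfloor\log_2(n+k)\rfloor+1)$. 1. On every input the program carries out an RR on $\{1,\dots,k\}^V$ whose target weights are the indicator of the proper $k$-colorings of $G$, each execution of the step being one RR step. Its output, if it stops, is an exactly uniform proper $k$-coloring: the probability of stopping with output $x$ is the same for all proper $k$-colorings $x$, and is $0$ for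 all other $x$. 2. The initialization takes time at most $C(n+1)(\Delta+1)$ and uses at most $Cn\log k$ random bits. Every step takes time at most $C(\Delta+1)$ and uses at most $C(\Delta+1)\log k$ uniform random bits. 3. If $k > 3.637\Delta + 1$ (in particular, if $\Delta\ge 1$ and $(k-1)/\Delta > (7+\sqrt{57})/4$), then the expected number of steps is $\Theta(n)$: there are constants $0<a\le b$ depending only on $\Delta$ and $k$ such that it lies between $an$ and $bn$ for every graph with $n$ nodes and maximum degree $\Delta$. In this case the program stops with probability one, and its output is exactly uniformly distributed on the proper $k$-colorings of $G$. -/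

import Mathlib

open scoped NNReal ENNReal

/-! ### A probabilistic word RAM

Programs are finite pieces of syntax over finitely many variables and finitely many arrays.  Every
cell holds a word of `w` bits: constants and the results of arithmetic are reduced modulo `2 ^ w`.
The only source of randomness is the command `rand`, which reads fair coin flips.  Loops are
bounded (`loop e c` runs `c` as often as the value of `e` on entry), so that a command always
terminates; the unbounded repetition of a sampling algorithm is in `Sampler.runFor`. -/

/-- The contents of the memory. -/
structure Store where
  /-- the variables -/
  var : ℕ → ℕ
  /-- the arrays: `arr a j` is cell `j` of array `a` -/
  arr : ℕ → ℕ → ℕ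

/-- Binary word operations. -/
inductive BinOp
  | add | sub | mul | div | mod | lt | eq

/-- `sub` is truncated at zero, `div` and `mod` are those of the natural numbers, and comparisons
return `1` for true and `0` for false. -/
def BinOp.run : BinOp → ℕ → ℕ → ℕ
  | .add, x, y => x + y
  | .sub, x, y => x - y
  | .mul, x, y => x * y
  | .div, x, y => x / y
  | .mod, x, y => x % y
  | .lt, x, y => if x < y then 1 else 0
  | .eq, x, y => if x = y then 1 else 0

/-- Expressions; `msb e` is the position of the most significant bit of the word `e`. -/
inductive Expr
  | const (c : ℕ)
  | var (i : ℕ)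
  | get (a : ℕ) (e : Expr)
  | op (o : BinOp) (e f : Expr)
  | msb (e : Expr)

/-- The value of an expression on a machine with `w`-bit words. -/
def Expr.eval (w : ℕ) : Expr → Store → ℕ
  | .const c, _ => c % 2 ^ w
  | .var i, s => s.var i
  | .get a e, s => s.arr a (e.eval w s)
  | .op o e f, s => o.run (e.eval w s) (f.eval w s) % 2 ^ w
  | .msb e, s => Nat.log 2 (e.eval w s) % 2 ^ w

/-- The time for evaluating an expression: one unit for each constant, access and operation. -/
def Expr.cost : Expr → ℕ
  | .const _ => 1
  | .var _ => 1
  | .get _ e => e.cost + 1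
  | .op _ e f => e.cost + f.cost + 1
  | .msb e => e.cost + 1

/-- Commands. -/
inductive Cmd
  /-- do nothing -/
  | skip
  /-- set variable `x` to the value of `e` -/
  | set (x : ℕ) (e : Expr)
  /-- set cell `e` of array `a` to the value of `f` -/
  | put (a : ℕ) (e f : Expr)
  /-- read `e` fair random bits into variable `x` -/
  | rand (x : ℕ) (e : Expr)
  /-- sequential composition -/
  | seq (c d : Cmd)
  /-- run `c` if the value of `e` is not zero, and `d` otherwise -/
  | ite (e : Expr) (c d : Cmd)
  /-- evaluate `e` once, and run `c` that many times -/
  | loop (e : Expr) (c : Cmd)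

/-- A store together with the time and the number of random bits used so far.  The counters cannot
be read by a program. -/
structure Config where
  store : Store
  time : ℕ
  bits : ℕ

/-- Let `t` units of time pass. -/
def Config.tick (t : ℕ) (z : Config) : Config := { z with time := z.time + t }

def Config.setVar (z : Config) (x v : ℕ) : Config :=
  { z with store := { z.store with var := Function.update z.store.var x v } }

def Config.setArr (z : Config) (a j v : ℕ) : Config :=
  { z with store :=
    { z.store with arr := Function.update z.store.arr a (Function.update (z.store.arr a) j v) } }

def Config.useBits (b : ℕ) (z : Config) : Config := { z with bits := z.bits + b }

/-- `m`-fold repetition of a random transformation, with one unit of overhead per round. -/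
noncomputable def repeatCmd (f : Config → PMF Config) : ℕ → Config → PMF Config
  | 0, z => PMF.pure z
  | m + 1, z => (f (z.tick 1)).bind (repeatCmd f m)

/-- The law of the configuration after running a command on a machine with `w`-bit words.
A `rand` of `b` bits is one instruction and uses `b` bits; only a word of `w` bits is stored. -/
noncomputable def Cmd.exec (w : ℕ) : Cmd → Config → PMF Config
  | .skip, z => PMF.pure z
  | .set x e, z => PMF.pure ((z.tick (e.cost + 1)).setVar x (e.eval w z.store))
  | .put a e f, z =>
      PMF.pure ((z.tick (e.cost + f.cost + 1)).setArr a (e.eval w z.store) (f.eval w z.store))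
  | .rand x e, z =>
      (PMF.uniformOfFintype (Fin (2 ^ e.eval w z.store))).map fun r =>
        ((z.tick (e.cost + 1)).useBits (e.eval w z.store)).setVar x (r.val % 2 ^ w)
  | .seq c d, z => (c.exec w z).bind (d.exec w)
  | .ite e c d, z =>
      if e.eval w z.store ≠ 0 then c.exec w (z.tick (e.cost + 1))
      else d.exec w (z.tick (e.cost + 1))
  | .loop e c, z => repeatCmd (c.exec w) (e.eval w z.store) (z.tick (e.cost + 1))

/-- Run a command from a store, with the counters at zero. -/
noncomputable def Cmd.start (w : ℕ) (c : Cmd) (s : Store) : PMF Config := c.exec w ⟨s, 0, 0⟩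

/-- The law of the store after running a command. -/
noncomputable def Cmd.law (w : ℕ) (c : Cmd) (s : Store) : PMF Store :=
  (c.start w s).map Config.store

/-! ### Graphs as input, colorings as output -/

/-- `adj` lists the neighbors of every node of `G`, each exactly once and in any order. -/
def IsAdjacencyList {n : ℕ} (G : SimpleGraph (Fin n)) (adj : Fin n → List (Fin n)) : Prop :=
  ∀ v, (adj v).Nodup ∧ ∀ u, u ∈ adj v ↔ G.Adj v u

/-- The input.  Variables `1` and `2` hold the number `n` of nodes and the number `k` of colors.
Array `2` is the concatenation of the `n` neighbor lists, and cell `v` of array `1` is the position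
at which the list of node `v` starts (for `v = n`, at which the last list ends).  Everything else is
zero. -/
def inputStore (n k : ℕ) (adj : Fin n → List (Fin n)) : Store where
  var i := if i = 1 then n else if i = 2 then k else 0
  arr a j :=
    if a = 1 then ((List.ofFn adj).take j).flatten.length
    else if a = 2 then ((List.ofFn adj).flatten.map Fin.val).getD j 0
    else 0

/-- Array `0` holds the coloring `x`. -/
def Store.Holds {n k : ℕ} (s : Store) (x : Fin n → Fin k) : Prop :=
  ∀ v : Fin n, s.arr 0 v = (x v : ℕ)

/-- Variable `0` is the flag that tells the algorithm to stop. -/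
def Store.Halted (s : Store) : Prop := s.var 0 ≠ 0

instance (s : Store) : Decidable s.Halted := by unfold Store.Halted; infer_instance

/-- Proper colorings. -/
def IsProper {n k : ℕ} (G : SimpleGraph (Fin n)) (x : Fin n → Fin k) : Prop :=
  ∀ u v, G.Adj u v → x u ≠ x v

open Classical in
/-- The target weights: one for proper colorings, zero for all others. -/
noncomputable def properWeight {n k : ℕ} (G : SimpleGraph (Fin n)) (x : Fin n → Fin k) : ℝ≥0 :=
  if IsProper G x then 1 else 0

/-! ### Sampling programs -/

/-- A sampling program: run `init` once, then repeat `step` until the stop flag is set, and output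
the coloring in array `0`. -/
structure Sampler where
  init : Cmd
  step : Cmd

namespace Sampler

/-- The law of the store after the initialization and at most `t` steps. -/
noncomputable def runFor (A : Sampler) (w : ℕ) (input : Store) : ℕ → PMF Store
  | 0 => A.init.law w input
  | t + 1 => (A.runFor w input t).bind fun s => if s.Halted then PMF.pure s else A.step.law w s

/-- A store that occurs with positive probability. -/
def Reachable (A : Sampler) (w : ℕ) (input s : Store) : Prop :=
  ∃ t, s ∈ (A.runFor w input t).support

/-- The expected number `∑ₜ P(T > t)` of steps, infinite if the program fails to stop with positive
probability. -/
noncomputable def expectedSteps (A : Sampler) (w : ℕ) (input : Store) : ℝ≥0∞ :=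
  ∑' t, (A.runFor w input t).toOuterMeasure {s | ¬ s.Halted}

/-- The probability that the program stops and its output is `x`. -/
noncomputable def outputProb (A : Sampler) (w : ℕ) (input : Store) {n k : ℕ}
    (x : Fin n → Fin k) : ℝ≥0∞ :=
  ⨆ t, (A.runFor w input t).toOuterMeasure {s | s.Halted ∧ s.Holds x}

end Sampler

/-! ### Randomness recyclers -/

/-- A randomness recycler algorithm with finite state space `X` for the weights `target`.  It keeps
a state `x` and an index `i`, which stands for the weights `weight i` of the state.

It begins with a state drawn from the weights of the index `start`.  A step from the index `i` splits
these weights according to the next index `j`, which is chosen with probability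
`p_j x = ∑ y, step (x, i) (y, j)`, and then moves the state by the transition function
`step (x, i) (y, j) / p_j x`; the resulting weights `∑ x, weight i x * step (x, i) (y, j)` of `y`
have to be a multiple of `weight j`.  It ends at an index whose weights are equivalent to the target
weights. -/
structure RandomnessRecycler (X : Type) [Fintype X] (target : X → ℝ≥0) where
  Index : Type
  weight : Index → X → ℝ≥0
  start : Index
  draw : PMF X
  step : X × Index → PMF (X × Index)
  final : Set Index
  draw_eq : ∃ c : ℝ≥0, ∀ x, draw x = c * weight start x
  step_eq : ∀ i, i ∉ final → ∀ j, ∃ c : ℝ≥0, ∀ y,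
    ∑ x, (weight i x : ℝ≥0∞) * step (x, i) (y, j) = c * weight j y
  final_eq : ∀ i ∈ final, ∃ c : ℝ≥0, 0 < c ∧ ∀ x, weight i x = c * target x

/-- The program `A` carries out the randomness recycler `R` on the given input: array `0` holds the
state, the index can be read off from the memory, and each execution of `A.step` is one step
of `R`. -/
def Sampler.Implements (A : Sampler) (w : ℕ) (input : Store) {n k : ℕ}
    {target : (Fin n → Fin k) → ℝ≥0} (R : RandomnessRecycler (Fin n → Fin k) target) : Prop :=
  ∃ (state : Store → Fin n → Fin k) (index : Store → R.Index),
    (∀ s, A.Reachable w input s → s.Holds (state s) ∧ (s.Halted ↔ index s ∈ R.final)) ∧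
    (A.init.law w input).map (fun s => (state s, index s)) = R.draw.map (fun x => (x, R.start)) ∧
    ∀ s, A.Reachable w input s → ¬ s.Halted →
      (A.step.law w s).map (fun s' => (state s', index s')) = R.step (state s, index s)

/-!
The state of the recycler is a coloring of all nodes, and its index says what is known about it.
Some nodes are *active*; an inactive node `w` has a known color, and forbids this color to those of
its active neighbors that are smaller than a threshold `th w`.  The weights of an index are the
indicator of the colorings that have the known colors, that are proper between active nodes, and
that respect these restrictions (`Idx.Sat`).  Initially all nodes are inactive and restrict nothing,
so that there is only one compatible coloring; once all nodes are active, the compatible colorings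
are the proper ones.

A step takes the inactive node `v` on top of a stack.  If `v` restricts no active node, it is
activated with a random color (`Idx.add`).  Otherwise its threshold is lowered to `z`, the largest
active node that it restricts, and to compensate `z` receives the color of `v` with the right
probability (`Idx.resolve`).  Both may fail because the color occurs at an active neighbor of the
node.  What has been learned then is that this neighbor has the color and that no smaller active
neighbor has it, and this is precisely what becomes known if the two nodes are made inactive with
suitable thresholds (`Idx.collapsed_iff`).  Coincidences among the neighbors of `z` are the other
source of failure.  They make the number of colors available to `z` depend on the coloring; the
excess is one color for each coinciding neighbor, and if `z` has one of these colors, then the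
coinciding neighbor is made inactive as well.

Every move leads to each coloring that is compatible with the next index in the same number of ways,
and to no others (`Idx.recycles`); hence the weights are recycled (`Idx.sum_weight_mul_stepLaw`).
It follows that, given the index, the state is always distributed according to the weights
(`RandomnessRecycler.lawAt_apply`), so that the output is uniform.

For the number of steps, consider the potential that counts the inactive nodes, and `0.8 / D` for
each restriction, where `D` is the maximum degree.  Since the state has the law given by the weights,
failures have small probability: an active node can be recolored with at least `k - D` colors, which
bounds the probability that it has a prescribed color by `1 / (k - D)`
(`Idx.card_mul_le_of_color`).  If `k > 3.637 * D + 1`, then the potential decreases by a constant on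
average (`Idx.exists_drift_constants`), and Foster's criterion
(`RandomnessRecycler.tsum_runningProb_le`) gives a linear bound.  Conversely, a step activates at
most one node.

The program keeps the coloring, the thresholds and the stack in arrays (`Program.Rep`), and finds
what a step needs by a bounded number of loops over the neighbors of a node, with two arrays indexed
by colors in place of sets of colors (`Program.Tables`).  That it makes the moves of the recycler
within the stated time is `Program.move_does`, and `Program.implements` follows.
-/

/-! ### Runs of a randomness recycler -/

theorem PMF.bind_congr_support {α β : Type*} (p : PMF α) {f g : α → PMF β}
    (h : ∀ a ∈ p.support, f a = g a) : p.bind f = p.bind g := by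
  ext b
  simp only [PMF.bind_apply]
  refine tsum_congr fun a => ?_
  by_cases ha : a ∈ p.support
  · rw [h a ha]
  · rw [(p.apply_eq_zero_iff a).2 ha, zero_mul, zero_mul]

namespace RandomnessRecycler

variable {X : Type} [Fintype X] {target : X → ℝ≥0}

open Classical in
/-- The law of state and index after at most `t` steps of a randomness recycler. -/
noncomputable def lawAt (R : RandomnessRecycler X target) : ℕ → PMF (X × R.Index)
  | 0 => R.draw.map fun x => (x, R.start)
  | t + 1 => (R.lawAt t).bind fun s => if s.2 ∈ R.final then PMF.pure s else R.step s

/-- The principle behind the randomness recycler: given the index, the state is distributed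
according to the weights of this index. -/
theorem lawAt_apply (R : RandomnessRecycler X target) (t : ℕ) (i : R.Index) :
    ∃ c : ℝ≥0∞, ∀ x, R.lawAt t (x, i) = c * R.weight i x := by
  classical
  induction t generalizing i with
  | zero =>
    obtain ⟨c, hc⟩ := R.draw_eq
    by_cases hi : i = R.start
    · subst hi
      refine ⟨c, fun x => ?_⟩
      rw [lawAt, PMF.map_apply, tsum_eq_single x]
      · simp [hc]
      · intro y hy
        simp [Ne.symm hy]
    · refine ⟨0, fun x => ?_⟩
      rw [lawAt, PMF.map_apply, zero_mul]
      simp [hi]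
  | succ t ih =>
    choose c hc using ih
    have hstep : ∀ i' : R.Index, ∃ d : ℝ≥0∞, ∀ y,
        ∑ x, R.lawAt t (x, i') *
          (if i' ∈ R.final then PMF.pure (x, i') else R.step (x, i')) (y, i)
            = d * R.weight i y := by
      intro i'
      by_cases hf : i' ∈ R.final
      · by_cases hii : i' = i
        · subst hii
          refine ⟨c i', fun y => ?_⟩
          rw [Finset.sum_eq_single y]
          · simp [hf, hc]
          · intro x _ hx
            simp [hf, PMF.pure_apply, Ne.symm hx]
          · simp
        · refine ⟨0, fun y => ?_⟩
          simp [hf, PMF.pure_apply, Ne.symm hii]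
      · obtain ⟨e, he⟩ := R.step_eq i' hf i
        refine ⟨c i' * e, fun y => ?_⟩
        simp only [hf, if_false, hc]
        rw [mul_assoc, ← he, Finset.mul_sum]
        exact Finset.sum_congr rfl fun x _ => mul_assoc _ _ _
    choose d hd using hstep
    refine ⟨∑' i', d i', fun y => ?_⟩
    rw [lawAt, PMF.bind_apply, ENNReal.tsum_prod', ENNReal.tsum_comm, ← ENNReal.tsum_mul_right]
    refine tsum_congr fun i' => ?_
    rw [tsum_fintype, ← hd i' y]

/-- A randomness recycler outputs all states proportionally to their target weights. -/
theorem lawAt_final (R : RandomnessRecycler X target) (t : ℕ) :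
    ∃ p : ℝ≥0∞, ∀ x, (R.lawAt t).toOuterMeasure {s | s.2 ∈ R.final ∧ s.1 = x} = p * target x := by
  classical
  choose c hc using R.lawAt_apply t
  -- the weights of a final index are a multiple of the target weights
  choose d _ hd using R.final_eq
  refine ⟨∑' i, if h : i ∈ R.final then c i * d i h else 0, fun x => ?_⟩
  rw [PMF.toOuterMeasure_apply, ENNReal.tsum_prod', tsum_eq_single x, ← ENNReal.tsum_mul_right]
  · refine tsum_congr fun i => ?_
    by_cases hi : i ∈ R.final
    · simp [Set.indicator, hi, hc, hd i hi, mul_assoc]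
    · simp [Set.indicator, hi]
  · intro y hy
    simp [Set.indicator, hy]

/-- The probability of not having reached a final index within `t` steps. -/
noncomputable def runningProb (R : RandomnessRecycler X target) (t : ℕ) : ℝ≥0∞ :=
  (R.lawAt t).toOuterMeasure {s | s.2 ∉ R.final}

/-- Foster's criterion along a randomness recycler: it suffices that the potential `Ψ` decreases by
`δ` on average over the weights of each index that can occur. -/
theorem tsum_runningProb_le (R : RandomnessRecycler X target) (good : R.Index → Prop)
    (hgood : ∀ t, ∀ s ∈ (R.lawAt t).support, good s.2) (Ψ : R.Index → ℝ≥0∞) (δ : ℝ≥0∞)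
    (hdrift : ∀ i, good i → i ∉ R.final →
      ∑ x, (R.weight i x : ℝ≥0∞) * ((∑' s, R.step (x, i) s * Ψ s.2) + δ)
        ≤ ∑ x, (R.weight i x : ℝ≥0∞) * Ψ i) :
    (∑' t, R.runningProb t) * δ ≤ Ψ R.start := by
  classical
  -- the expected potential after `t` steps
  set V : ℕ → ℝ≥0∞ := fun t => ∑' s, R.lawAt t s * Ψ s.2 with hV
  have hV0 : V 0 = Ψ R.start := by
    simp only [hV, lawAt, PMF.map, PMF.bind_apply]
    rw [← one_mul (Ψ R.start), ← R.draw.tsum_coe, ← ENNReal.tsum_mul_right]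
    simp only [← ENNReal.tsum_mul_right]
    rw [ENNReal.tsum_comm]
    refine tsum_congr fun x => ?_
    rw [tsum_eq_single (x, R.start)]
    · simp
    · intro s hs
      simp [PMF.pure_apply, hs]
  have hstep : ∀ t, V (t + 1) + R.runningProb t * δ ≤ V t := by
    intro t
    have h1 : V (t + 1) = ∑' i, ∑ x, R.lawAt t (x, i) *
        ∑' s, (if i ∈ R.final then PMF.pure (x, i) else R.step (x, i)) s * Ψ s.2 := by
      simp only [hV, lawAt, PMF.bind_apply, ← ENNReal.tsum_mul_right]
      rw [ENNReal.tsum_comm, ENNReal.tsum_prod', ENNReal.tsum_comm]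
      refine tsum_congr fun i => ?_
      rw [tsum_fintype]
      refine Finset.sum_congr rfl fun x _ => ?_
      rw [← ENNReal.tsum_mul_left]
      exact tsum_congr fun s => by rw [mul_assoc]
    have h2 : R.runningProb t * δ = ∑' i, ∑ x, R.lawAt t (x, i) * if i ∈ R.final then 0 else δ := by
      rw [runningProb, PMF.toOuterMeasure_apply, ← ENNReal.tsum_mul_right, ENNReal.tsum_prod',
        ENNReal.tsum_comm]
      refine tsum_congr fun i => ?_
      rw [tsum_fintype]
      refine Finset.sum_congr rfl fun x _ => ?_
      by_cases hi : i ∈ R.final <;> simp [Set.indicator, hi]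
    have h3 : V t = ∑' i, ∑ x, R.lawAt t (x, i) * Ψ i := by
      simp only [hV]
      rw [ENNReal.tsum_prod', ENNReal.tsum_comm]
      exact tsum_congr fun i => tsum_fintype _
    rw [h1, h2, h3, ← ENNReal.tsum_add]
    refine ENNReal.tsum_le_tsum fun i => ?_
    rw [← Finset.sum_add_distrib]
    by_cases hi : i ∈ R.final
    · refine Finset.sum_le_sum fun x _ => ?_
      simp only [hi, if_true, mul_zero, add_zero]
      rw [tsum_eq_single (x, i)]
      · simp
      · intro s hs
        simp [PMF.pure_apply, hs]
    · simp only [hi, if_false, ← mul_add]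
      by_cases hg : good i
      · obtain ⟨c, hc⟩ := R.lawAt_apply t i
        simp only [hc, mul_assoc, ← Finset.mul_sum]
        exact mul_le_mul_right (hdrift i hg hi) c
      · have h0 : ∀ x, R.lawAt t (x, i) = 0 := fun x =>
          (PMF.apply_eq_zero_iff _ _).2 fun h => hg (hgood t _ h)
        simp [h0]
  have hsum : ∀ T, (∑ t ∈ Finset.range T, R.runningProb t * δ) + V T ≤ V 0 := by
    intro T
    induction T with
    | zero => simp
    | succ T ih =>
      rw [Finset.sum_range_succ, add_assoc, add_comm (_ * δ)]
      exact (add_le_add_right (hstep T) _).trans ih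
  rw [← ENNReal.tsum_mul_right, ← hV0, ENNReal.tsum_eq_iSup_nat]
  exact iSup_le fun T => le_self_add.trans (hsum T)

end RandomnessRecycler

namespace Sampler

variable {A : Sampler} {w : ℕ} {input : Store} {n k : ℕ} {target : (Fin n → Fin k) → ℝ≥0}

theorem holds_unique {s : Store} {x y : Fin n → Fin k} (hx : s.Holds x) (hy : s.Holds y) :
    x = y :=
  funext fun v => Fin.ext ((hx v).symm.trans (hy v))

/-- What a randomness recycler says about a program that carries it out: the program follows the
law of the recycler. -/
theorem runFor_map_eq (R : RandomnessRecycler (Fin n → Fin k) target)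
    (state : Store → Fin n → Fin k) (index : Store → R.Index)
    (h1 : ∀ s, A.Reachable w input s → s.Holds (state s) ∧ (s.Halted ↔ index s ∈ R.final))
    (h2 : (A.init.law w input).map (fun s => (state s, index s)) = R.draw.map (fun x => (x, R.start)))
    (h3 : ∀ s, A.Reachable w input s → ¬ s.Halted →
      (A.step.law w s).map (fun s' => (state s', index s')) = R.step (state s, index s)) (t : ℕ) :
    (A.runFor w input t).map (fun s => (state s, index s)) = R.lawAt t := by
  classical
  induction t with
  | zero => exact h2
  | succ t ih =>
    rw [runFor, RandomnessRecycler.lawAt, ← ih, PMF.map_bind, PMF.bind_map]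
    refine PMF.bind_congr_support _ fun s hs => ?_
    have hr : A.Reachable w input s := ⟨t, hs⟩
    by_cases hh : s.Halted
    · simp [hh, (h1 s hr).2.1 hh, PMF.pure_map]
    · have hf : index s ∉ R.final := fun h => hh ((h1 s hr).2.2 h)
      simp [hh, hf, h3 s hr hh]

/-- The output of a program that carries out a recycler is distributed according to the target
weights, as far as it stops. -/
theorem Implements.exists_outputProb {R : RandomnessRecycler (Fin n → Fin k) target}
    (h : A.Implements w input R) :
    ∃ p : ℝ≥0∞, ∀ x : Fin n → Fin k, A.outputProb w input x = p * target x := by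
  obtain ⟨state, index, h1, h2, h3⟩ := h
  choose p hp using R.lawAt_final
  refine ⟨⨆ t, p t, fun x => ?_⟩
  rw [outputProb, ENNReal.iSup_mul]
  refine iSup_congr fun t => ?_
  rw [← hp, ← runFor_map_eq R state index h1 h2 h3, PMF.toOuterMeasure_map_apply]
  refine PMF.toOuterMeasure_apply_eq_of_inter_support_eq _ ?_
  ext s
  simp only [Set.mem_inter_iff, Set.mem_ofPred_eq, Set.mem_preimage]
  refine and_congr_left fun hs => ?_
  have hr := h1 s ⟨t, hs⟩
  exact and_congr hr.2 ⟨fun hx => holds_unique hr.1 hx, fun hx => hx ▸ hr.1⟩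

/-- The expected number of steps is the sum of the probabilities that the recycler still runs. -/
theorem Implements.expectedSteps_eq {R : RandomnessRecycler (Fin n → Fin k) target}
    (h : A.Implements w input R) : A.expectedSteps w input = ∑' t, R.runningProb t := by
  obtain ⟨state, index, h1, h2, h3⟩ := h
  refine tsum_congr fun t => ?_
  rw [RandomnessRecycler.runningProb, ← runFor_map_eq R state index h1 h2 h3,
    PMF.toOuterMeasure_map_apply]
  refine PMF.toOuterMeasure_apply_eq_of_inter_support_eq _ ?_
  ext s
  simp only [Set.mem_inter_iff, Set.mem_ofPred_eq, Set.mem_preimage]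
  exact and_congr_left fun hs => not_congr (h1 s ⟨t, hs⟩).2

/-- If the expected number of steps is finite then the program stops almost surely, so that the
output probabilities add up to one. -/
theorem Implements.sum_outputProb {R : RandomnessRecycler (Fin n → Fin k) target}
    (h : A.Implements w input R) (hfin : A.expectedSteps w input ≠ ∞) :
    ∑ x : Fin n → Fin k, A.outputProb w input x = 1 := by
  classical
  obtain ⟨state, index, h1, h2, h3⟩ := h
  have hmono : ∀ x : Fin n → Fin k,
      Monotone fun t => (A.runFor w input t).toOuterMeasure {s | s.Halted ∧ s.Holds x} := by
    intro x
    refine monotone_nat_of_le_succ fun t => ?_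
    simp only [runFor, PMF.toOuterMeasure_bind_apply]
    rw [PMF.toOuterMeasure_apply]
    refine ENNReal.tsum_le_tsum fun s => ?_
    by_cases hs : s.Halted ∧ s.Holds x
    · simp [hs.1, hs.2, PMF.toOuterMeasure_pure_apply]
    · simp only [Set.indicator, Set.mem_ofPred_eq, hs, if_false]
      exact zero_le
  have hlim : ∀ x : Fin n → Fin k, Filter.Tendsto
      (fun t => (A.runFor w input t).toOuterMeasure {s | s.Halted ∧ s.Holds x}) Filter.atTop
      (nhds (A.outputProb w input x)) := fun x => tendsto_atTop_iSup (hmono x)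
  have hsum := tendsto_finsetSum (s := Finset.univ) fun x _ => hlim x
  have hzero : Filter.Tendsto (fun t => (A.runFor w input t).toOuterMeasure {s | ¬ s.Halted})
      Filter.atTop (nhds 0) := ENNReal.tendsto_atTop_zero_of_tsum_ne_top hfin
  have hone : ∀ t, (∑ x : Fin n → Fin k,
      (A.runFor w input t).toOuterMeasure {s | s.Halted ∧ s.Holds x})
        + (A.runFor w input t).toOuterMeasure {s | ¬ s.Halted} = 1 := by
    intro t
    simp only [PMF.toOuterMeasure_apply]
    rw [← tsum_fintype (L := .unconditional _), ENNReal.tsum_comm, ← ENNReal.tsum_add,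
      ← (A.runFor w input t).tsum_coe]
    refine tsum_congr fun s => ?_
    rw [tsum_fintype]
    by_cases hs0 : s ∈ (A.runFor w input t).support
    · by_cases hs : s.Halted
      · have hr := (h1 s ⟨t, hs0⟩).1
        rw [Finset.sum_eq_single (state s)]
        · simp [hs, hr]
        · intro y _ hy
          have : ¬ s.Holds y := fun h => hy (holds_unique h hr)
          simp [this]
        · simp
      · simp [hs]
    · simp [Set.indicator, (PMF.apply_eq_zero_iff _ _).2 hs0]
  have := hsum.add hzero
  simp only [hone, add_zero] at this
  exact tendsto_nhds_unique this tendsto_const_nhds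

end Sampler

/-! ### The recycler for colorings -/

/-- An index of the coloring recycler.  A node `w` is active if `pin w = none`; the colors of the
other nodes are known.  An inactive node `w` forbids its color to its active neighbors `u` with
`u < th w`.  The inactive nodes are kept on the stack `stk`. -/
@[ext] structure Idx (n k : ℕ) where
  pin : Fin n → Option (Fin k)
  th : Fin n → ℕ
  stk : List (Fin n)

/-- What a step of the coloring recycler reveals about the state. -/
inductive Move (n k : ℕ)
  /-- nothing -/
  | stay
  /-- the top of the stack becomes active -/
  | activate
  /-- the top of the stack does not forbid its color to `z` and larger nodes any more -/
  | release (z : Fin n)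
  /-- The nodes `a` and `b`, neighbors of `z`, have the color `e`, which `z` receives as well, and
  `a` is the smallest active neighbor of `z` of this color. -/
  | collapse (z : Fin n) (e : Fin k) (a b : Fin n)

namespace Idx

variable {n k : ℕ}

/-- The index after a move. -/
def apply (i : Idx n k) : Move n k → Idx n k
  | .stay => i
  | .activate =>
    match i.stk with
    | [] => i
    | v :: l => ⟨Function.update i.pin v none, i.th, l⟩
  | .release z =>
    match i.stk with
    | [] => i
    | v :: _ => ⟨i.pin, Function.update i.th v z, i.stk⟩
  | .collapse z e a b =>
    ⟨fun w => if w = z ∨ w = a ∨ w = b then some e else i.pin w,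
     fun w => if w = a ∨ w = b then n else if w = z then a else i.th w,
     (if a = b then [] else [b]) ++ a :: ((if i.pin z = none then [z] else []) ++ i.stk)⟩

variable (G : SimpleGraph (Fin n)) (i : Idx n k)

/-- The node `w` forbids its color to an active neighbor `u`. -/
def Blocks (w u : Fin n) : Prop := i.pin w = none ∨ (u : ℕ) < i.th w

/-- The colorings of positive weight. -/
def Sat (x : Fin n → Fin k) : Prop :=
  (∀ w c, i.pin w = some c → x w = c) ∧
    ∀ u w, i.pin u = none → G.Adj u w → i.Blocks w u → x u ≠ x w

/-- The conditions of `Sat` that do not involve the color of `z`. -/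
def SatOff (z : Fin n) (x : Fin n → Fin k) : Prop :=
  (∀ w c, w ≠ z → i.pin w = some c → x w = c) ∧
    ∀ u w, u ≠ z → w ≠ z → i.pin u = none → G.Adj u w → i.Blocks w u → x u ≠ x w

open Classical in
/-- The active neighbors of `z`. -/
noncomputable def actNb (z : Fin n) : Finset (Fin n) :=
  Finset.univ.filter fun w => G.Adj z w ∧ i.pin w = none

/-- The color of an inactive neighbor of `z` that forbids it to `z` is `c`. -/
def Known (z : Fin n) (c : Fin k) : Prop :=
  ∃ f, G.Adj z f ∧ (z : ℕ) < i.th f ∧ i.pin f = some c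

open Classical in
/-- The colors that inactive neighbors forbid to `z`. -/
noncomputable def known (z : Fin n) : Finset (Fin k) := Finset.univ.filter (i.Known G z)

open Classical in
/-- The colors that are forbidden to `z`. -/
noncomputable def forb (z : Fin n) (x : Fin n → Fin k) : Finset (Fin k) :=
  i.known G z ∪ (i.actNb G z).image x

/-- The color of the active neighbor `w` of `z` is already taken into account by an inactive
neighbor or by a smaller active one. -/
def Coincides (z : Fin n) (x : Fin n → Fin k) (w : Fin n) : Prop :=
  w ∈ i.actNb G z ∧ (x w ∈ i.known G z ∨ ∃ w' ∈ i.actNb G z, w' < w ∧ x w' = x w)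

open Classical in
/-- The number of colors available at `z` that are smaller than `d`. -/
noncomputable def rank (z : Fin n) (x : Fin n → Fin k) (d : Fin k) : ℕ :=
  ((i.forb G z x)ᶜ.filter (· < d)).card

open Classical in
/-- The smallest active neighbor of `z` of color `e`, if there is one. -/
noncomputable def first (z : Fin n) (x : Fin n → Fin k) (e : Fin k) : Option (Fin n) :=
  if h : ((i.actNb G z).filter fun w => x w = e).Nonempty then some (Finset.min' _ h) else none

/-- The number of colors that are forbidden to `z` if no two of its neighbors agree needlessly. -/
noncomputable def load (z : Fin n) : ℕ := (i.known G z).card + (i.actNb G z).card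

open Classical in
/-- The largest active neighbor to which `v` forbids its color, if there is one. -/
noncomputable def target (v : Fin n) : Option (Fin n) :=
  if h : ((i.actNb G v).filter fun u : Fin n => (u : ℕ) < i.th v).Nonempty then some (Finset.max' _ h)
  else none

/-- The color `c` of `v` is forbidden to `z` by another inactive neighbor, too. -/
def Blocked (v : Fin n) (c : Fin k) (z : Fin n) : Prop :=
  ∃ f, f ≠ v ∧ G.Adj z f ∧ (z : ℕ) < i.th f ∧ i.pin f = some c

open Classical in
/-- An attempt to activate `v` with color `r`. -/
noncomputable def add (v : Fin n) (x : Fin n → Fin k) (r : ℕ) : Move n k × (Fin n → Fin k) :=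
  if hr : r < k then
    if i.Known G v ⟨r, hr⟩ then (.stay, x)
    else
      match i.first G v x ⟨r, hr⟩ with
      | some u => (.collapse v ⟨r, hr⟩ u u, Function.update x v ⟨r, hr⟩)
      | none => (.activate, Function.update x v ⟨r, hr⟩)
  else (.stay, x)

open Classical in
/-- An attempt to make the color `c` of `v` available to `z` as well.  With `m = k - load`, this
gives `z` the color `c` with probability `1 / (m + 1)`.  If `a` colors are available to `z` then only
a fraction `m / a` of these attempts may succeed, so that those attempts are discarded in which the
rank of the color of `z` is at least `m`.  There is one such color for each coinciding neighbor. -/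
noncomputable def resolve (adj : Fin n → List (Fin n)) (v : Fin n) (c : Fin k) (z : Fin n)
    (x : Fin n → Fin k) (r : ℕ) : Move n k × (Fin n → Fin k) :=
  if k + 1 ≤ r + i.load G z then (.stay, x)
  else if r ≠ 0 ∨ i.Blocked G v c z then (.release z, x)
  else if i.rank G z x (x z) + i.load G z < k then
    match i.first G z x c with
    | some a => (.collapse z c a a, Function.update x z c)
    | none => (.release z, Function.update x z c)
  else
    match ((adj z).filter fun w => i.Coincides G z x w)[i.rank G z x (x z) + i.load G z - k]? with
    | some b =>
      match i.first G z x (x b) with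
      | some a => (.collapse z (x b) a b, Function.update x z (x b))
      | none => (.stay, x)
    | none => (.stay, x)

/-- The move from the index `i` in state `x` with random number `r`, and the next state. -/
noncomputable def move (adj : Fin n → List (Fin n)) (x : Fin n → Fin k) (r : ℕ) :
    Move n k × (Fin n → Fin k) :=
  match i.stk with
  | [] => (.stay, x)
  | v :: _ =>
    match i.pin v with
    | none => (.stay, x)
    | some c =>
      match i.target G v with
      | some z => i.resolve G adj v c z x r
      | none => i.add G v x r

variable {G} {i} {z : Fin n} {x y : Fin n → Fin k}

theorem mem_actNb {w : Fin n} : w ∈ i.actNb G z ↔ G.Adj z w ∧ i.pin w = none := by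
  simp [actNb]

theorem mem_known {c : Fin k} : c ∈ i.known G z ↔ i.Known G z c := by
  simp [known]

theorem mem_forb {c : Fin k} :
    c ∈ i.forb G z x ↔ i.Known G z c ∨ ∃ w, G.Adj z w ∧ i.pin w = none ∧ x w = c := by
  simp [forb, mem_known, mem_actNb, and_assoc]

theorem first_eq_some {e : Fin k} {a : Fin n} :
    i.first G z x e = some a ↔
      a ∈ i.actNb G z ∧ x a = e ∧ ∀ w ∈ i.actNb G z, w < a → x w ≠ e := by
  classical
  unfold first
  split_ifs with h
  · simp only [Option.some.injEq]
    constructor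
    · rintro rfl
      have := Finset.min'_mem _ h
      rw [Finset.mem_filter] at this
      refine ⟨this.1, this.2, fun w hw hlt he => ?_⟩
      exact absurd (Finset.min'_le _ w (Finset.mem_filter.2 ⟨hw, he⟩)) (not_le.2 hlt)
    · rintro ⟨ha, hx, hm⟩
      refine le_antisymm (Finset.min'_le _ _ (Finset.mem_filter.2 ⟨ha, hx⟩)) ?_
      refine Finset.le_min' _ _ _ fun w hw => not_lt.1 fun hlt => ?_
      exact hm w (Finset.mem_filter.1 hw).1 hlt (Finset.mem_filter.1 hw).2
  · simp only [false_iff]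
    rintro ⟨ha, hx, -⟩
    exact h ⟨a, Finset.mem_filter.2 ⟨ha, hx⟩⟩

theorem first_eq_none {e : Fin k} :
    i.first G z x e = none ↔ ∀ w ∈ i.actNb G z, x w ≠ e := by
  classical
  unfold first
  split_ifs with h
  · obtain ⟨w, hw⟩ := h
    rw [Finset.mem_filter] at hw
    simp only [false_iff]
    exact fun h => h w hw.1 hw.2
  · simp only [true_iff]
    exact fun w hw he => h ⟨w, Finset.mem_filter.2 ⟨hw, he⟩⟩

theorem target_eq_some {v : Fin n} :
    i.target G v = some z ↔ z ∈ i.actNb G v ∧ (z : ℕ) < i.th v ∧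
      ∀ w ∈ i.actNb G v, (w : ℕ) < i.th v → w ≤ z := by
  classical
  unfold target
  split_ifs with h
  · simp only [Option.some.injEq]
    constructor
    · rintro rfl
      have := Finset.max'_mem _ h
      rw [Finset.mem_filter] at this
      refine ⟨this.1, this.2, fun w hw hlt => ?_⟩
      exact Finset.le_max' _ w (Finset.mem_filter.2 ⟨hw, hlt⟩)
    · rintro ⟨ha, hx, hm⟩
      refine le_antisymm ?_ (Finset.le_max' _ _ (Finset.mem_filter.2 ⟨ha, hx⟩))
      exact Finset.max'_le _ _ _ fun w hw => hm w (Finset.mem_filter.1 hw).1 (Finset.mem_filter.1 hw).2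
  · simp only [false_iff]
    rintro ⟨ha, hx, -⟩
    exact h ⟨z, Finset.mem_filter.2 ⟨ha, hx⟩⟩

theorem target_eq_none {v : Fin n} :
    i.target G v = none ↔ ∀ w ∈ i.actNb G v, i.th v ≤ w := by
  classical
  unfold target
  split_ifs with h
  · obtain ⟨w, hw⟩ := h
    rw [Finset.mem_filter] at hw
    simp only [false_iff]
    exact fun h => absurd hw.2 (not_lt.2 (h w hw.1))
  · simp only [true_iff]
    exact fun w hw => not_lt.1 fun he => h ⟨w, Finset.mem_filter.2 ⟨hw, he⟩⟩

theorem ne_of_mem_actNb {w : Fin n} (h : w ∈ i.actNb G z) : w ≠ z :=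
  fun e => G.loopless.irrefl z (e ▸ (mem_actNb.1 h).1)

/-! The color of `z` is irrelevant to what its neighbors forbid. -/

theorem forb_update (d : Fin k) : i.forb G z (Function.update x z d) = i.forb G z x := by
  classical
  unfold forb
  congr 1
  exact Finset.image_congr fun w hw => Function.update_of_ne (ne_of_mem_actNb hw) _ _

theorem rank_update (d : Fin k) : i.rank G z (Function.update x z d) = i.rank G z x := by
  funext e
  unfold rank
  rw [forb_update]

theorem first_update (d : Fin k) : i.first G z (Function.update x z d) = i.first G z x := by
  classical
  funext e
  have : ((i.actNb G z).filter fun w => Function.update x z d w = e)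
      = (i.actNb G z).filter fun w => x w = e :=
    Finset.filter_congr fun w hw => by rw [Function.update_of_ne (ne_of_mem_actNb hw)]
  unfold first
  simp only [this]

theorem coincides_update (d : Fin k) :
    i.Coincides G z (Function.update x z d) = i.Coincides G z x := by
  funext w
  refine propext (and_congr_right fun hw => ?_)
  rw [Function.update_of_ne (ne_of_mem_actNb hw)]
  refine or_congr_right ⟨?_, ?_⟩ <;> rintro ⟨w', hw', h⟩ <;> refine ⟨w', hw', ?_⟩ <;>
    simpa [Function.update_of_ne (ne_of_mem_actNb hw')] using h

theorem satOff_update (d : Fin k) : i.SatOff G z (Function.update x z d) ↔ i.SatOff G z x := by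
  unfold SatOff
  refine and_congr ?_ ?_
  · refine forall₂_congr fun w c => forall_congr' fun hw => ?_
    rw [Function.update_of_ne hw]
  · refine forall₂_congr fun u w => forall₂_congr fun hu hw => ?_
    rw [Function.update_of_ne hu, Function.update_of_ne hw]

theorem Sat.satOff (h : i.Sat G x) (z : Fin n) : i.SatOff G z x :=
  ⟨fun w c _ => h.1 w c, fun u w _ _ => h.2 u w⟩

/-- For an active node `z`, compatibility splits into conditions without the color of `z`, and
the condition that this color is not forbidden. -/
theorem sat_iff_of_active (hz : i.pin z = none) :
    i.Sat G x ↔ i.SatOff G z x ∧ x z ∉ i.forb G z x := by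
  constructor
  · refine fun h => ⟨h.satOff z, ?_⟩
    rw [mem_forb]
    rintro (⟨f, hf, hlt, hp⟩ | ⟨w, hw, hp, he⟩)
    · exact h.2 z f hz hf (Or.inr hlt) (h.1 f _ hp).symm
    · exact h.2 z w hz hw (Or.inl hp) he.symm
  · rintro ⟨h, hf⟩
    rw [mem_forb, not_or] at hf
    refine ⟨fun w c hw => h.1 w c (fun e => ?_) hw, fun u w hu huw hb he => ?_⟩
    · rw [e, hz] at hw
      exact absurd hw (by simp)
    · by_cases huz : u = z
      · subst huz
        have hwz : w ≠ u := fun e => G.loopless.irrefl u (e ▸ huw)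
        cases hp : i.pin w with
        | none => exact hf.2 ⟨w, huw, hp, he.symm⟩
        | some c =>
          refine hf.1 ⟨w, huw, ?_, ?_⟩
          · simpa [Blocks, hp] using hb
          · rw [he, h.1 w c hwz hp, hp]
      · by_cases hwz : w = z
        · subst hwz
          exact hf.2 ⟨u, huw.symm, hu, he⟩
        · exact h.2 u w huz hwz hu huw hb he

/-- If the inactive node `v` restricts no active node, then its color matters to no other condition
than its own being known. -/
theorem sat_iff_of_pin {v : Fin n} {c : Fin k} (hv : i.pin v = some c)
    (ht : i.target G v = none) : i.Sat G x ↔ i.SatOff G v x ∧ x v = c := by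
  rw [target_eq_none] at ht
  constructor
  · exact fun h => ⟨h.satOff v, h.1 v c hv⟩
  · rintro ⟨h, hc⟩
    refine ⟨fun w d hw => ?_, fun u w hu huw hb => ?_⟩
    · by_cases hwv : w = v
      · subst hwv
        rw [hv, Option.some.injEq] at hw
        rw [hc, hw]
      · exact h.1 w d hwv hw
    · have huv : u ≠ v := fun e => by simp [e, hv] at hu
      by_cases hwv : w = v
      · subst hwv
        have := ht u (mem_actNb.2 ⟨huw.symm, hu⟩)
        rcases hb with hb | hb
        · simp [hv] at hb
        · omega
      · exact h.2 u w huv hwv hu huw hb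

/-! ### Ranks of colors and coinciding neighbors -/

/-- The ranks of the elements of a finite set are the numbers below its cardinality, each taken
once. -/
theorem image_rank {α : Type*} [LinearOrder α] (S : Finset α) :
    S.image (fun d => (S.filter (· < d)).card) = Finset.range S.card ∧
      Set.InjOn (fun d => (S.filter (· < d)).card) S := by
  have hmono : ∀ d ∈ S, ∀ e ∈ S, d < e → (S.filter (· < d)).card < (S.filter (· < e)).card := by
    intro d hd e he hlt
    refine Finset.card_lt_card ⟨fun c hc => ?_, fun h => ?_⟩
    · rw [Finset.mem_filter] at hc ⊢
      exact ⟨hc.1, hc.2.trans hlt⟩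
    · exact absurd (Finset.mem_filter.1 (h (Finset.mem_filter.2 ⟨hd, hlt⟩))).2 (lt_irrefl d)
  have hinj : Set.InjOn (fun d => (S.filter (· < d)).card) S := by
    intro d hd e he h
    rcases lt_trichotomy d e with hlt | heq | hlt
    · exact absurd h (hmono d hd e he hlt).ne
    · exact heq
    · exact absurd h (hmono e he d hd hlt).ne'
  refine ⟨Finset.eq_of_subset_of_card_le ?_ ?_, hinj⟩
  · intro t ht
    obtain ⟨d, hd, rfl⟩ := Finset.mem_image.1 ht
    refine Finset.mem_range.2 (Finset.card_lt_card ⟨Finset.filter_subset _ _, fun h => ?_⟩)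
    exact absurd (Finset.mem_filter.1 (h hd)).2 (lt_irrefl d)
  · rw [Finset.card_image_of_injOn hinj, Finset.card_range]

open Classical in
/-- Available colors are counted by their ranks. -/
theorem card_rank (P : ℕ → Prop) [DecidablePred P] (i : Idx n k) (z : Fin n) (x : Fin n → Fin k) :
    ((i.forb G z x)ᶜ.filter fun d => P (i.rank G z x d)).card
      = ((Finset.range (i.forb G z x)ᶜ.card).filter P).card := by
  obtain ⟨h1, h2⟩ := image_rank (i.forb G z x)ᶜ
  rw [← h1, Finset.filter_image, Finset.card_image_of_injOn]
  · simp only [rank]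
    congr! 5
  · exact h2.mono (Finset.coe_subset.2 (Finset.filter_subset _ _))

open Classical in
/-- The load exceeds the number of forbidden colors by the number of coinciding neighbors. -/
theorem card_forb_add (i : Idx n k) (z : Fin n) (x : Fin n → Fin k) :
    (i.forb G z x).card + ((i.actNb G z).filter (i.Coincides G z x)).card = i.load G z := by
  have h1 : i.forb G z x = i.known G z ∪
      ((i.actNb G z).filter fun w => ¬ i.Coincides G z x w).image x := by
    ext c
    simp only [forb, Finset.mem_union, Finset.mem_image, Finset.mem_filter]
    constructor
    · rintro (h | ⟨w, hw, rfl⟩)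
      · exact Or.inl h
      · by_cases hk : x w ∈ i.known G z
        · exact Or.inl hk
        · right
          cases hf : i.first G z x (x w) with
          | none => exact absurd rfl (first_eq_none.1 hf w hw)
          | some a =>
            obtain ⟨ha, hxa, hm⟩ := first_eq_some.1 hf
            refine ⟨a, ⟨ha, ?_⟩, hxa⟩
            rintro ⟨-, h | ⟨w', hw', hlt, he⟩⟩
            · exact hk (hxa ▸ h)
            · exact hm w' hw' hlt (he.trans hxa)
    · rintro (h | ⟨w, hw, rfl⟩)
      · exact Or.inl h
      · exact Or.inr ⟨w, hw.1, rfl⟩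
  rw [h1, Finset.card_union_of_disjoint, Finset.card_image_of_injOn, load, add_assoc, add_comm
    (Finset.card (Finset.filter _ _)), Finset.card_filter_add_card_filter_not]
  · intro u hu w hw he
    simp only [Finset.coe_filter, Set.mem_ofPred_eq] at hu hw
    rcases lt_trichotomy u w with hlt | heq | hlt
    · exact absurd ⟨hw.1, Or.inr ⟨u, hu.1, hlt, he⟩⟩ hw.2
    · exact heq
    · exact absurd ⟨hu.1, Or.inr ⟨w, hw.1, hlt, he.symm⟩⟩ hu.2
  · rw [Finset.disjoint_left]
    intro c hc hc'
    obtain ⟨w, hw, rfl⟩ := Finset.mem_image.1 hc'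
    rw [Finset.mem_filter] at hw
    exact hw.2 ⟨hw.1, Or.inl hc⟩

open Classical in
theorem length_coincides {adj : Fin n → List (Fin n)} (hadj : IsAdjacencyList G adj)
    (i : Idx n k) (z : Fin n) (x : Fin n → Fin k) :
    ((adj z).filter fun w => i.Coincides G z x w).length
      = ((i.actNb G z).filter (i.Coincides G z x)).card := by
  rw [← List.toFinset_card_of_nodup ((hadj z).1.filter _)]
  congr 1
  ext w
  simp only [List.mem_toFinset, List.mem_filter, (hadj z).2, decide_eq_true_eq, Finset.mem_filter,
    mem_actNb]
  exact ⟨fun h => ⟨mem_actNb.1 h.2.1, h.2⟩, fun h => ⟨h.1.1, h.2⟩⟩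

end Idx

/-! ### The recycling identity -/

namespace Idx

variable {n k : ℕ} {G : SimpleGraph (Fin n)} {i : Idx n k} {z v : Fin n} {x y : Fin n → Fin k}
  {adj : Fin n → List (Fin n)}

/-- The colorings that a collapse can lead to. -/
def Collapsed (i : Idx n k) (G : SimpleGraph (Fin n)) (z : Fin n) (e : Fin k) (a b : Fin n)
    (y : Fin n → Fin k) : Prop :=
  i.SatOff G z y ∧ y z = e ∧ i.first G z y e = some a ∧ b ∈ i.actNb G z ∧ y b = e

/-- The index after a collapse describes exactly the colorings that the collapse can lead to.  The
witness `y₀` excludes collapses that contradict the index. -/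
theorem collapsed_iff {e : Fin k} {a b : Fin n} {y₀ : Fin n → Fin k}
    (h₀ : i.Collapsed G z e a b y₀) :
    i.Collapsed G z e a b y ↔ (i.apply (.collapse z e a b)).Sat G y := by
  obtain ⟨h0, h0z, h0a, hb, h0b⟩ := h₀
  rw [first_eq_some] at h0a
  obtain ⟨ha, h0a, h0m⟩ := h0a
  have haz := ne_of_mem_actNb ha
  have hbz := ne_of_mem_actNb hb
  rw [mem_actNb] at ha hb
  have h0ab : ∀ u, u = a ∨ u = b → y₀ u = e := by rintro u (rfl | rfl) <;> assumption
  have hpab : ∀ u, u = a ∨ u = b → i.pin u = none := by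
    rintro u (rfl | rfl); exacts [ha.2, hb.2]
  constructor
  · rintro ⟨h, hz, hf, -, hyb⟩
    rw [first_eq_some] at hf
    obtain ⟨-, hya, hm⟩ := hf
    have hab : ∀ u, u = a ∨ u = b → y u = e := by rintro u (rfl | rfl) <;> assumption
    refine ⟨fun w c hw => ?_, fun u w hu huw hbl => ?_⟩
    · simp only [apply] at hw
      split_ifs at hw with hc
      · rw [Option.some.injEq] at hw
        subst hw
        rcases hc with rfl | hc
        · exact hz
        · exact hab w hc
      · exact h.1 w c (fun e => hc (Or.inl e)) hw
    · simp only [apply] at hu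
      split_ifs at hu with hc
      have hc' : u ≠ z ∧ u ≠ a ∧ u ≠ b := by simpa [not_or] using hc
      by_cases hwz : w = z
      · subst hwz
        simp only [Blocks, apply, true_or, if_true, reduceCtorEq, false_or, haz.symm, hbz.symm,
          or_self, if_false] at hbl
        rw [hz]
        exact hm u (mem_actNb.2 ⟨huw.symm, hu⟩) hbl
      · by_cases hwab : w = a ∨ w = b
        · exact h.2 u w hc'.1 hwz hu huw (Or.inl (hpab w hwab))
        · refine h.2 u w hc'.1 hwz hu huw ?_
          simpa [Blocks, apply, hwab, hwz] using hbl
  · intro h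
    have hpin : ∀ w, w = z ∨ w = a ∨ w = b → y w = e := fun w hw => h.1 w e (by simp [apply, hw])
    have hpin' : ∀ w c, w ≠ z → i.pin w = some c → y w = c := by
      intro w c hwz hw
      refine h.1 w c ?_
      have : ¬ (w = a ∨ w = b) := fun hc => by simp [hpab w hc] at hw
      simp [apply, hwz, this, hw]
    -- an active neighbor of `a` or `b` cannot have the color `e`
    have key : ∀ u w, w ≠ z → u = a ∨ u = b → ¬ (w = a ∨ w = b) → i.pin w = none → G.Adj u w →
        y w ≠ y u := by
      intro u w hwz hu hw hp huw
      refine h.2 w u (by simp [apply, hwz, hw, hp]) huw.symm (Or.inr ?_)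
      simp [apply, hu]
    refine ⟨⟨hpin', fun u w huz hwz hu huw hbl => ?_⟩, hpin z (Or.inl rfl), ?_, mem_actNb.2 hb,
      hpin b (by simp)⟩
    · by_cases huab : u = a ∨ u = b
      · by_cases hwab : w = a ∨ w = b
        · have := h0.2 u w huz hwz hu huw hbl
          rw [h0ab u huab, h0ab w hwab] at this
          exact absurd rfl this
        · cases hp : i.pin w with
          | none => exact (key u w hwz huab hwab hp huw).symm
          | some c =>
            rw [hpin' w c hwz hp, ← h0.1 w c hwz hp, hpin u (Or.inr huab), ← h0ab u huab]
            exact h0.2 u w huz hwz hu huw hbl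
      · by_cases hwab : w = a ∨ w = b
        · exact key w u huz hwab huab hu huw.symm
        · refine h.2 u w (by simp [apply, huz, huab, hu]) huw ?_
          simpa [Blocks, apply, hwab, hwz] using hbl
    · refine first_eq_some.2 ⟨mem_actNb.2 ha, hpin a (by simp), fun w hw hlt => ?_⟩
      have hwz := ne_of_mem_actNb hw
      have hwb : w ≠ b := fun e' => h0m w hw hlt (by rw [e', h0b])
      rw [mem_actNb] at hw
      rw [← hpin z (Or.inl rfl)]
      refine h.2 w z (by simp [apply, hwz, hlt.ne, hwb, hw.2]) hw.1.symm (Or.inr ?_)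
      simpa [apply, haz.symm, hbz.symm] using hlt

/-- The colorings that are compatible with the index after `v` has been activated: `v` has any color
that is not forbidden to it. -/
theorem sat_activate {l : List (Fin n)} (hs : i.stk = v :: l) :
    (i.apply .activate).Sat G y ↔ i.SatOff G v y ∧ y v ∉ i.forb G v y := by
  rw [sat_iff_of_active (z := v) (by simp [apply, hs])]
  have hne : ∀ w, G.Adj v w → w ≠ v := fun w hw e => G.loopless.irrefl v (e ▸ hw)
  refine and_congr ?_ (not_congr ?_)
  · simp only [SatOff, Blocks, apply, hs]
    refine and_congr ?_ ?_
    · refine forall₂_congr fun w c => forall_congr' fun hw => ?_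
      rw [Function.update_of_ne hw]
    · refine forall₂_congr fun u w => forall₂_congr fun hu hw => ?_
      rw [Function.update_of_ne hu, Function.update_of_ne hw]
  · rw [mem_forb, mem_forb]
    simp only [Known, apply, hs]
    refine or_congr ?_ ?_
    · refine exists_congr fun f => and_congr_right fun hf => ?_
      rw [Function.update_of_ne (hne f hf)]
    · refine exists_congr fun f => and_congr_right fun hf => ?_
      rw [Function.update_of_ne (hne f hf)]

theorem known_of_target {c : Fin k} (hv : i.pin v = some c) (ht : i.target G v = some z) :
    i.Known G z c :=
  have ht := target_eq_some.1 ht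
  ⟨v, (mem_actNb.1 ht.1).1.symm, ht.2.1, hv⟩

/-- The colorings that are compatible with the index after `v` has ceased to restrict `z`: either the
old restrictions hold, or `z` has the color `c` of `v`, and nothing but `v` forbids that. -/
theorem sat_release {l : List (Fin n)} {c : Fin k} (hs : i.stk = v :: l) (hv : i.pin v = some c)
    (ht : i.target G v = some z) :
    (i.apply (.release z)).Sat G y ↔ i.SatOff G z y ∧
      (y z ∉ i.forb G z y ∨ (y z = c ∧ ¬ i.Blocked G v c z ∧ i.first G z y c = none)) := by
  have hkn := known_of_target hv ht
  rw [target_eq_some] at ht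
  obtain ⟨hz, hlt, hm⟩ := ht
  have hzv := ne_of_mem_actNb hz
  rw [mem_actNb] at hz
  rw [sat_iff_of_active (z := z) (by simp [apply, hs, hz.2])]
  refine and_congr ?_ ?_
  · simp only [SatOff, Blocks, apply, hs]
    refine and_congr Iff.rfl ?_
    refine forall₂_congr fun u w => forall₂_congr fun hu hw => forall₂_congr fun hpu huw => ?_
    by_cases hwv : w = v
    · subst hwv
      simp only [hv, reduceCtorEq, false_or, Function.update_self]
      have : (u : ℕ) < z ↔ (u : ℕ) < i.th w := by
        refine ⟨fun h => h.trans hlt, fun h => ?_⟩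
        exact lt_of_le_of_ne (hm u (mem_actNb.2 ⟨huw.symm, hpu⟩) h) fun e => hu (Fin.ext e)
      rw [this]
    · rw [Function.update_of_ne hwv]
  · have hK : ∀ d, (i.apply (.release z)).Known G z d ↔
        ∃ f, f ≠ v ∧ G.Adj z f ∧ (z : ℕ) < i.th f ∧ i.pin f = some d := by
      intro d
      simp only [Known, apply, hs]
      refine exists_congr fun f => ?_
      by_cases hf : f = v
      · subst hf; simp
      · simp [hf]
    have hP : ∀ w, (i.apply (.release z)).pin w = i.pin w := fun w => by simp [apply, hs]
    have hK' : i.Known G z (y z) ↔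
        (∃ f, f ≠ v ∧ G.Adj z f ∧ (z : ℕ) < i.th f ∧ i.pin f = some (y z)) ∨ y z = c := by
      constructor
      · rintro ⟨f, hf⟩
        by_cases hfv : f = v
        · right
          subst hfv
          simpa [hv, eq_comm] using hf.2.2
        · exact Or.inl ⟨f, hfv, hf⟩
      · rintro (⟨f, -, hf⟩ | rfl)
        · exact ⟨f, hf⟩
        · exact hkn
    rw [mem_forb, mem_forb, hK, hK', first_eq_none]
    simp only [hP, not_or]
    by_cases hyc : y z = c
    · simp only [hyc, not_true_eq_false, and_false, false_and, true_and, false_or, Blocked]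
      refine and_congr Iff.rfl ?_
      simp only [mem_actNb, not_exists, not_and, and_imp, ne_eq]
    · simp [hyc]

/-- The states and random numbers below `M` from which the move `o` leads to `y`. -/
noncomputable def outcomes (i : Idx n k) (G : SimpleGraph (Fin n)) (adj : Fin n → List (Fin n))
    (M : ℕ) (o : Move n k) (y : Fin n → Fin k) : Finset ((Fin n → Fin k) × ℕ) :=
  open Classical in
  (Finset.univ ×ˢ Finset.range M).filter fun p => i.Sat G p.1 ∧ i.move G adj p.1 p.2 = (o, y)

theorem mem_outcomes {M : ℕ} {o : Move n k} {p : (Fin n → Fin k) × ℕ} :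
    p ∈ i.outcomes G adj M o y ↔ p.2 < M ∧ i.Sat G p.1 ∧ i.move G adj p.1 p.2 = (o, y) := by
  simp [outcomes]

/-- If a move does not change the state, and whether it happens depends on the random number only,
then it happens with the same weight for all states. -/
theorem card_outcomes_of_fixed {M : ℕ} {o : Move n k} (P : ℕ → Prop) [DecidablePred P]
    (h : ∀ x r, r < M → i.Sat G x → (i.move G adj x r = (o, y) ↔ x = y ∧ P r)) (hy : i.Sat G y) :
    (i.outcomes G adj M o y).card = ((Finset.range M).filter P).card := by
  classical
  have : i.outcomes G adj M o y = ((Finset.range M).filter P).image fun r => (y, r) := by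
    ext ⟨x, r⟩
    simp only [mem_outcomes, Finset.mem_image, Finset.mem_filter, Finset.mem_range, Prod.mk.injEq]
    constructor
    · rintro ⟨hr, hx, hm⟩
      obtain ⟨rfl, hP⟩ := (h x r hr hx).1 hm
      exact ⟨r, ⟨hr, hP⟩, rfl, rfl⟩
    · rintro ⟨r', ⟨hr, hP⟩, rfl, rfl⟩
      exact ⟨hr, hy, (h _ _ hr hy).2 ⟨rfl, hP⟩⟩
  rw [this, Finset.card_image_of_injective]
  exact fun a b h => (Prod.mk.inj h).2

theorem outcomes_eq_empty {M : ℕ} {o : Move n k}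
    (h : ∀ x r, r < M → i.Sat G x → i.move G adj x r ≠ (o, y)) :
    i.outcomes G adj M o y = ∅ := by
  refine Finset.eq_empty_of_forall_notMem fun p hp => ?_
  rw [mem_outcomes] at hp
  exact h _ _ hp.1 hp.2.1 hp.2.2

/-- The move `o` from the index `i` recycles: the resulting weights are a multiple of those of the
next index. -/
def Recycles (i : Idx n k) (G : SimpleGraph (Fin n)) (adj : Fin n → List (Fin n)) (M : ℕ)
    (o : Move n k) : Prop :=
  ∃ c : ℕ, ∀ y, ((i.apply o).Sat G y → (i.outcomes G adj M o y).card = c) ∧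
    (¬ (i.apply o).Sat G y → i.outcomes G adj M o y = ∅)

theorem recycles_of_never {M : ℕ} {o : Move n k}
    (h : ∀ x r y, r < M → i.Sat G x → i.move G adj x r ≠ (o, y)) : i.Recycles G adj M o := by
  refine ⟨0, fun y => ⟨fun _ => ?_, fun _ => ?_⟩⟩
  · rw [outcomes_eq_empty fun x r => h x r y, Finset.card_empty]
  · exact outcomes_eq_empty fun x r => h x r y

theorem recycles_of_fixed {M : ℕ} {o : Move n k} (P : ℕ → Prop) [DecidablePred P]
    (h : ∀ x r y, r < M → i.Sat G x → (i.move G adj x r = (o, y) ↔ x = y ∧ P r))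
    (ho : ∀ y, (i.apply o).Sat G y ↔ i.Sat G y) : i.Recycles G adj M o := by
  refine ⟨_, fun y => ⟨fun hy => card_outcomes_of_fixed P (fun x r => h x r y) ((ho y).1 hy),
    fun hy => outcomes_eq_empty fun x r hr hx hm => hy ?_⟩⟩
  obtain ⟨rfl, -⟩ := (h x r y hr hx).1 hm
  exact (ho x).2 hx

/-- Attempts to activate a node recycle.  A coloring with a new color at `v` arises from only one
coloring, as the old color of `v` is known. -/
theorem recycles_add {l : List (Fin n)} {c : Fin k} {M : ℕ} (hkM : k ≤ M) (hs : i.stk = v :: l)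
    (hv : i.pin v = some c) (ht : i.target G v = none) (o : Move n k) :
    i.Recycles G adj M o := by
  classical
  have hmove : ∀ x r, i.move G adj x r = i.add G v x r := fun x r => by simp [move, hs, hv, ht]
  have hsat : ∀ x, i.Sat G x ↔ i.SatOff G v x ∧ x v = c := fun x => sat_iff_of_pin hv ht
  have hback : ∀ x : Fin n → Fin k, x v = c → ∀ d,
      Function.update (Function.update x v d) v c = x := by
    rintro x rfl d
    simp
  cases o with
  | stay =>
    refine recycles_of_fixed (fun r => ∀ h : r < k, i.Known G v ⟨r, h⟩) (fun x r y hr hx => ?_)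
      fun y => Iff.rfl
    rw [hmove]
    unfold add
    split_ifs with h1 h2
    · simp [h1, h2]
    · split <;> simp [h1, h2]
    · simp [h1]
  | activate =>
    refine ⟨1, fun y => ⟨fun hy => ?_, fun hy => ?_⟩⟩
    · rw [sat_activate hs, mem_forb, not_or] at hy
      obtain ⟨hoff, hK, hU⟩ := hy
      refine Finset.card_eq_one.2 ⟨(Function.update y v c, y v), ?_⟩
      ext ⟨x, r⟩
      rw [mem_outcomes, hmove, hsat, Finset.mem_singleton, Prod.mk.injEq]
      constructor
      · rintro ⟨hr, ⟨hx, hxv⟩, hm⟩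
        unfold add at hm
        split_ifs at hm with h1 h2
        · simp at hm
        · split at hm
          · simp at hm
          · simp only [true_and] at hm
            subst hm
            simp [hback x hxv]
        · simp at hm
      · rintro ⟨rfl, rfl⟩
        refine ⟨(y v).2.trans_le hkM, ⟨(satOff_update c).2 hoff, by simp⟩, ?_⟩
        have hnone : i.first G v y (y v) = none :=
          first_eq_none.2 fun w hw he => hU ⟨w, (mem_actNb.1 hw).1, (mem_actNb.1 hw).2, he⟩
        simp [add, hK, first_update, hnone]
    · refine outcomes_eq_empty fun x r hr hx hm => hy ?_
      rw [hsat] at hx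
      rw [hmove] at hm
      unfold add at hm
      split_ifs at hm with h1 h2
      · simp at hm
      · split at hm
        · simp at hm
        · rename_i hf
          simp only [Prod.mk.injEq, true_and] at hm
          subst hm
          rw [sat_activate hs, satOff_update, forb_update, Function.update_self, mem_forb, not_or]
          refine ⟨hx.1, h2, ?_⟩
          rintro ⟨w, hw, hp, he⟩
          exact first_eq_none.1 hf w (mem_actNb.2 ⟨hw, hp⟩) he
      · simp at hm
  | release z =>
    refine recycles_of_never fun x r y hr hx hm => ?_
    rw [hmove] at hm
    unfold add at hm
    split_ifs at hm
    · simp at hm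
    · split at hm <;> simp at hm
    · simp at hm
  | collapse z e a b =>
    -- the colorings that come from this move
    have hout : ∀ x r y, i.Sat G x → i.move G adj x r = (.collapse z e a b, y) →
        z = v ∧ a = b ∧ ¬ i.Known G v e ∧ r = e ∧ x = Function.update y v c ∧
          i.Collapsed G v e a b y := by
      intro x r y hx hm
      rw [hsat] at hx
      rw [hmove] at hm
      unfold add at hm
      split_ifs at hm with h1 h2
      · simp at hm
      · split at hm
        · rename_i u hf
          simp only [Prod.mk.injEq, Move.collapse.injEq] at hm
          obtain ⟨⟨rfl, rfl, rfl, rfl⟩, rfl⟩ := hm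
          refine ⟨rfl, rfl, h2, rfl, (hback x hx.2 _).symm, (satOff_update _).2 hx.1, by simp, ?_⟩
          rw [first_update]
          refine ⟨hf, (first_eq_some.1 hf).1, ?_⟩
          rw [Function.update_of_ne (ne_of_mem_actNb (first_eq_some.1 hf).1)]
          exact (first_eq_some.1 hf).2.1
        · simp at hm
      · simp at hm
    by_cases hex : ∃ x r y, i.Sat G x ∧ i.move G adj x r = (.collapse z e a b, y)
    · obtain ⟨x, r, y₀, hx, hm⟩ := hex
      obtain ⟨rfl, rfl, hK, -, -, h₀⟩ := hout x r y₀ hx hm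
      refine ⟨1, fun y => ⟨fun hy => ?_, fun hy => outcomes_eq_empty fun x r hr hx hm => hy ?_⟩⟩
      · rw [← collapsed_iff h₀] at hy
        refine Finset.card_eq_one.2 ⟨(Function.update y z c, (e : ℕ)), ?_⟩
        ext ⟨x, r⟩
        rw [mem_outcomes, Finset.mem_singleton]
        constructor
        · rintro ⟨hr, hx, hm⟩
          obtain ⟨-, -, -, h1, h2, -⟩ := hout x r y hx hm
          exact Prod.ext h2 h1
        · intro hp
          obtain ⟨rfl, rfl⟩ := Prod.mk.inj hp
          refine ⟨e.2.trans_le hkM, (hsat _).2 ⟨(satOff_update c).2 hy.1, by simp⟩, ?_⟩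
          obtain ⟨-, hz, hf, -⟩ := hy
          subst hz
          rw [hmove]
          simp [add, hK, first_update, hf]
      · exact (collapsed_iff h₀).1 (hout x r y hx hm).2.2.2.2.2
    · exact recycles_of_never fun x r y hr hx hm => hex ⟨x, r, y, hx, hm⟩

theorem rank_lt {d : Fin k} (hd : d ∉ i.forb G z x) :
    i.rank G z x d < (i.forb G z x)ᶜ.card := by
  classical
  refine Finset.card_lt_card ⟨Finset.filter_subset _ _, fun h => ?_⟩
  exact absurd (Finset.mem_filter.1 (h (Finset.mem_compl.2 hd))).2 (lt_irrefl d)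

open Classical in
theorem card_compl_forb (i : Idx n k) (G : SimpleGraph (Fin n)) (z : Fin n) (x : Fin n → Fin k) :
    (i.forb G z x)ᶜ.card + i.load G z
      = k + ((i.actNb G z).filter (i.Coincides G z x)).card := by
  have h1 := card_forb_add (G := G) i z x
  have h2 := Finset.card_add_card_compl (i.forb G z x)
  rw [Fintype.card_fin] at h2
  omega

theorem coincides_of_first {e : Fin k} {a b : Fin n} (hf : i.first G z y e = some a)
    (hb : b ∈ i.actNb G z) (hyb : y b = e) :
    i.Coincides G z y b ↔ i.Known G z e ∨ a ≠ b := by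
  obtain ⟨ha, hya, hm⟩ := first_eq_some.1 hf
  unfold Coincides
  rw [hyb, mem_known]
  simp only [hb, true_and]
  refine or_congr Iff.rfl ⟨?_, fun h => ⟨a, ha, lt_of_le_of_ne ?_ h, hya⟩⟩
  · rintro ⟨w, hw, hlt, he⟩ rfl
    exact hm w hw hlt he
  · exact not_lt.1 fun h => hm b hb h hyb

theorem resolve_stay {c : Fin k} {r : ℕ} (hadj : IsAdjacencyList G adj)
    (ht : i.target G v = some z) (hx : i.Sat G x) :
    i.resolve G adj v c z x r = (.stay, y) ↔ x = y ∧ k + 1 ≤ r + i.load G z := by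
  classical
  have hz := (mem_actNb.1 (target_eq_some.1 ht).1).2
  have hlt := rank_lt ((sat_iff_of_active hz).1 hx).2
  have hcard := card_compl_forb i G z x
  unfold resolve
  split_ifs with h1 h2 h3
  · simp [h1]
  · simp [h1]
  · split <;> simp [h1]
  · simp only [h1, and_false, iff_false]
    have hlen : i.rank G z x (x z) + i.load G z - k
        < ((adj z).filter fun w => i.Coincides G z x w).length := by
      rw [length_coincides hadj]
      omega
    rw [List.getElem?_eq_getElem hlen]
    have hmem := List.getElem_mem hlen
    set b := ((adj z).filter fun w => i.Coincides G z x w)[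
      i.rank G z x (x z) + i.load G z - k] with hb
    simp only [List.mem_filter, decide_eq_true_eq] at hmem
    cases hf : i.first G z x (x b) with
    | none => exact absurd rfl (first_eq_none.1 hf b hmem.2.1)
    | some a => simp [hf]

open Classical in
theorem resolve_release {c : Fin k} {r : ℕ} :
    i.resolve G adj v c z x r = (.release z, y) ↔ r + i.load G z ≤ k ∧
      ((x = y ∧ (r ≠ 0 ∨ i.Blocked G v c z)) ∨
        (Function.update x z c = y ∧ r = 0 ∧ ¬ i.Blocked G v c z ∧
          i.rank G z x (x z) + i.load G z < k ∧ i.first G z x c = none)) := by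
  unfold resolve
  split_ifs with h1 h2 h3
  · simp only [Prod.mk.injEq, reduceCtorEq, false_and, false_iff, not_and]
    omega
  · have h1' : r + i.load G z ≤ k := by omega
    simp only [Prod.mk.injEq, true_and, h1', h2, and_true]
    constructor
    · exact Or.inl
    · rintro (h | ⟨-, h, h', -⟩)
      · exact h
      · exact absurd h2 (by simp [h, h'])
  · push Not at h2
    have h1'' : i.load G z ≤ k := by omega
    cases hf : i.first G z x c <;> simp [h1'', h2, h3]
  · push Not at h2
    constructor
    · intro h
      split at h
      · split at h <;> simp at h
      · simp at h
    · simp [h2, h3]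

open Classical in
theorem resolve_collapse {c e : Fin k} {r : ℕ} {z' a b : Fin n} :
    i.resolve G adj v c z x r = (.collapse z' e a b, y) ↔ i.load G z ≤ k ∧ r = 0 ∧
      ¬ i.Blocked G v c z ∧ z' = z ∧ Function.update x z e = y ∧ i.first G z x e = some a ∧
      ((i.rank G z x (x z) + i.load G z < k ∧ e = c ∧ a = b) ∨
        (k ≤ i.rank G z x (x z) + i.load G z ∧ x b = e ∧
          ((adj z).filter fun w => i.Coincides G z x w)[i.rank G z x (x z) + i.load G z - k]?
            = some b)) := by
  unfold resolve
  split_ifs with h1 h2 h3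
  · simp only [Prod.mk.injEq, reduceCtorEq, false_and, false_iff, not_and]
    intro h3 h4
    omega
  · simp only [Prod.mk.injEq, reduceCtorEq, false_and, false_iff, not_and]
    intro _ h4 h5
    simp [h4, h5] at h2
  · push Not at h2
    have h1' : i.load G z ≤ k := by omega
    have h3' : ¬ k ≤ i.rank G z x (x z) + i.load G z := by omega
    simp only [h1', h2, h3, h3', true_and, false_and, or_false, not_false_eq_true]
    cases hf : i.first G z x c with
    | none =>
      simp only [Prod.mk.injEq, reduceCtorEq, false_and, false_iff]
      rintro ⟨-, -, h, rfl, -⟩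
      simp [hf] at h
    | some u =>
      simp only [Prod.mk.injEq, Move.collapse.injEq]
      constructor
      · rintro ⟨⟨rfl, rfl, rfl, rfl⟩, rfl⟩
        exact ⟨rfl, rfl, hf, rfl, rfl⟩
      · rintro ⟨rfl, rfl, h, rfl, rfl⟩
        rw [hf, Option.some.injEq] at h
        subst h
        simp
  · push Not at h2
    have h1' : i.load G z ≤ k := by omega
    have h3' : k ≤ i.rank G z x (x z) + i.load G z := by omega
    simp only [h1', h2, h3, h3', true_and, false_and, false_or, not_false_eq_true]
    cases hl : ((adj z).filter fun w => i.Coincides G z x w)[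
        i.rank G z x (x z) + i.load G z - k]? with
    | none => simp
    | some u =>
      have hu := List.mem_of_getElem? hl
      simp only [List.mem_filter, decide_eq_true_eq] at hu
      cases hf : i.first G z x (x u) with
      | none => exact absurd rfl (first_eq_none.1 hf u hu.2.1)
      | some a' =>
        simp only [hf, Prod.mk.injEq, Move.collapse.injEq, Option.some.injEq]
        constructor
        · rintro ⟨⟨rfl, rfl, rfl, rfl⟩, rfl⟩
          exact ⟨rfl, rfl, hf, rfl, rfl⟩
        · rintro ⟨rfl, rfl, h, h', rfl⟩
          subst h'
          rw [hf, Option.some.injEq] at h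
          subst h
          simp

theorem sat_update_iff (hz : i.pin z = none) (hy : i.SatOff G z y) {d : Fin k} :
    i.Sat G (Function.update y z d) ↔ d ∉ i.forb G z y := by
  rw [sat_iff_of_active hz, satOff_update, forb_update, Function.update_self]
  simp [hy]

/-- States that agree with `y` outside of `z` are counted by their color at `z`. -/
theorem card_outcomes_of_update {M : ℕ} {o : Move n k} (hz : i.pin z = none) (hM : 0 < M)
    (hy : i.SatOff G z y) (P : ℕ → Prop) [DecidablePred P]
    (h : ∀ x r, r < M → i.Sat G x → (i.move G adj x r = (o, y) ↔
      x = Function.update y z (x z) ∧ r = 0 ∧ P (i.rank G z y (x z)))) :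
    (i.outcomes G adj M o y).card = ((Finset.range (i.forb G z y)ᶜ.card).filter P).card := by
  classical
  rw [← card_rank P i z y]
  have : i.outcomes G adj M o y = ((i.forb G z y)ᶜ.filter fun d => P (i.rank G z y d)).image
      fun d => (Function.update y z d, 0) := by
    ext ⟨x, r⟩
    simp only [mem_outcomes, Finset.mem_image, Finset.mem_filter, Finset.mem_compl, Prod.mk.injEq]
    constructor
    · rintro ⟨hr, hx, hm⟩
      obtain ⟨hxy, rfl, hP⟩ := (h x r hr hx).1 hm
      refine ⟨x z, ⟨?_, hP⟩, hxy.symm, rfl⟩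
      rw [hxy, sat_update_iff hz hy] at hx
      exact hx
    · rintro ⟨d, ⟨hd, hP⟩, rfl, rfl⟩
      have hx := (sat_update_iff hz hy).2 hd
      exact ⟨hM, hx, (h _ _ hM hx).2 (by simpa using hP)⟩
  rw [this, Finset.card_image_of_injective]
  intro d e hde
  simpa using congrFun (Prod.mk.inj hde).1 z

theorem eq_update_of_update_eq {d : Fin k} (h : Function.update x z d = y) :
    x = Function.update y z (x z) := by
  subst h
  simp

/-- Lowering the threshold of `v` recycles.  If another inactive node forbids the color `c` of `v` to
`z`, then this has no effect on the compatible colorings.  Otherwise, with `m = k - load`, there are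
`m` outcomes for each compatible coloring `y`: if `z` does not have the color `c`, these are the
random numbers `1, …, m`, which leave `y` as it is; otherwise the random number is `0`, and `z` has
had one of the `m` available colors of rank below `m`. -/
theorem recycles_release {l : List (Fin n)} {c : Fin k} {M : ℕ}
    (hkM : k ≤ M) (hs : i.stk = v :: l) (hv : i.pin v = some c) (ht : i.target G v = some z) :
    i.Recycles G adj M (.release z) := by
  classical
  have hmove : ∀ x r, i.move G adj x r = i.resolve G adj v c z x r :=
    fun x r => by simp [move, hs, hv, ht]
  have hz := (mem_actNb.1 (target_eq_some.1 ht).1).2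
  have hvz : v ≠ z := fun e => by simp [← e, hv] at hz
  have hload : 0 < i.load G z :=
    Nat.add_pos_left (Finset.card_pos.2 ⟨c, mem_known.2 (known_of_target hv ht)⟩) _
  by_cases hB : i.Blocked G v c z
  · refine recycles_of_fixed (fun r => r + i.load G z ≤ k) (fun x r y hr hx => ?_) fun y => ?_
    · rw [hmove, resolve_release]
      simp only [hB, or_true, and_true, not_true_eq_false, false_and, and_false, or_false]
      exact and_comm
    · rw [sat_release hs hv ht, sat_iff_of_active hz]
      simp [hB]
  · refine ⟨k - i.load G z, fun y => ⟨fun hy => ?_, fun hy => ?_⟩⟩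
    · rw [sat_release hs hv ht] at hy
      obtain ⟨hoff, hy⟩ := hy
      by_cases hyc : y z = c
      · have hcf : c ∈ i.forb G z y := mem_forb.2 (Or.inl (known_of_target hv ht))
        have hfirst : i.first G z y c = none := by
          rcases hy with h | h
          · exact absurd hcf (hyc ▸ h)
          · exact h.2.2
        rw [card_outcomes_of_update hz (c.pos.trans_le hkM) hoff
          (fun t => t + i.load G z < k) fun x r hr hx => ?_]
        · have h1 := card_compl_forb i G z y
          have : (Finset.range (i.forb G z y)ᶜ.card).filter (fun t => t + i.load G z < k)
              = Finset.range (k - i.load G z) := by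
            ext t
            simp only [Finset.mem_filter, Finset.mem_range]
            omega
          rw [this, Finset.card_range]
        · rw [hmove, resolve_release]
          constructor
          · rintro ⟨hl, ⟨rfl, -⟩ | ⟨h1, h2, -, h4, -⟩⟩
            · exact absurd hcf (hyc ▸ ((sat_iff_of_active hz).1 hx).2)
            · refine ⟨eq_update_of_update_eq h1, h2, ?_⟩
              rw [← h1, rank_update]
              exact h4
          · rintro ⟨h1, rfl, h2⟩
            refine ⟨by omega, Or.inr ⟨?_, rfl, hB, ?_, ?_⟩⟩
            · rw [h1, Function.update_idem, ← hyc, Function.update_eq_self]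
            · rw [h1, rank_update, Function.update_self]
              exact h2
            · rw [h1, first_update, hfirst]
      · have hsat : i.Sat G y := (sat_iff_of_active hz).2 ⟨hoff, by tauto⟩
        rw [card_outcomes_of_fixed (fun r => r ≠ 0 ∧ r + i.load G z ≤ k) (fun x r hr hx => ?_) hsat]
        · have : (Finset.range M).filter (fun r => r ≠ 0 ∧ r + i.load G z ≤ k)
              = Finset.Ioc 0 (k - i.load G z) := by
            ext t
            simp only [Finset.mem_filter, Finset.mem_range, Finset.mem_Ioc]
            omega
          rw [this, Nat.card_Ioc, Nat.sub_zero]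
        · rw [hmove, resolve_release]
          constructor
          · rintro ⟨hl, ⟨rfl, h⟩ | ⟨rfl, -⟩⟩
            · exact ⟨rfl, by tauto, hl⟩
            · simp at hyc
          · rintro ⟨rfl, h1, h2⟩
            exact ⟨h2, Or.inl ⟨rfl, Or.inl h1⟩⟩
    · refine outcomes_eq_empty fun x r hr hx hm => hy ?_
      rw [hmove, resolve_release] at hm
      rw [sat_release hs hv ht]
      rw [sat_iff_of_active hz] at hx
      obtain ⟨hl, ⟨rfl, -⟩ | ⟨rfl, h1, h2, h3, h4⟩⟩ := hm
      · exact ⟨hx.1, Or.inl hx.2⟩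
      · refine ⟨(satOff_update c).2 hx.1, Or.inr ⟨by simp, hB, ?_⟩⟩
        rw [first_update, h4]

/-- The number of ranks that lead to a given collapse.  Ranks below `K - L` all lead to the collapse
singled out by `p`, and the higher ones correspond to the entries of the list `l`, of which one may
be `b`. -/
theorem card_filter_ranks {K L m : ℕ} (l : List (Fin n)) (hl : l.Nodup) (hL : L ≤ K)
    (hm : m + L = K + l.length) (p : Prop) [Decidable p] (b : Fin n) :
    ((Finset.range m).filter fun t => (t + L < K ∧ p) ∨ (K ≤ t + L ∧ l[t + L - K]? = some b)).card
      = (if p then K - L else 0) + if b ∈ l then 1 else 0 := by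
  rw [Finset.filter_or, Finset.card_union_of_disjoint]
  · congr 1
    · split_ifs with hp
      · have : (Finset.range m).filter (fun t => t + L < K ∧ p) = Finset.range (K - L) := by
          ext t
          simp only [Finset.mem_filter, Finset.mem_range, hp, and_true]
          omega
        rw [this, Finset.card_range]
      · simp [hp]
    · split_ifs with hb
      · obtain ⟨s, hs, rfl⟩ := List.getElem_of_mem hb
        refine Finset.card_eq_one.2 ⟨s + K - L, ?_⟩
        ext t
        simp only [Finset.mem_filter, Finset.mem_range, Finset.mem_singleton]
        constructor
        · rintro ⟨-, h1, h2⟩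
          obtain ⟨h3, h4⟩ := List.getElem?_eq_some_iff.1 h2
          have := (hl.getElem_inj_iff).1 h4
          omega
        · rintro rfl
          have : s + K - L + L - K = s := by omega
          refine ⟨by omega, by omega, ?_⟩
          rw [this, List.getElem?_eq_getElem hs]
      · rw [Finset.card_eq_zero, Finset.filter_eq_empty_iff]
        rintro t - ⟨-, h⟩
        exact hb (List.mem_of_getElem? h)
  · rw [Finset.disjoint_filter]
    rintro t - ⟨h1, -⟩ ⟨h2, -⟩
    omega

/-- Attempts to remove a restriction recycle. -/
theorem recycles_resolve {l : List (Fin n)} {c : Fin k} {M : ℕ} (hadj : IsAdjacencyList G adj)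
    (hkM : k ≤ M) (hs : i.stk = v :: l) (hv : i.pin v = some c) (ht : i.target G v = some z)
    (o : Move n k) : i.Recycles G adj M o := by
  classical
  have hmove : ∀ x r, i.move G adj x r = i.resolve G adj v c z x r :=
    fun x r => by simp [move, hs, hv, ht]
  have hz := (mem_actNb.1 (target_eq_some.1 ht).1).2
  cases o with
  | stay =>
    refine recycles_of_fixed (fun r => k + 1 ≤ r + i.load G z) (fun x r y hr hx => ?_)
      fun y => Iff.rfl
    rw [hmove, resolve_stay hadj ht hx]
  | activate =>
    refine recycles_of_never fun x r y hr hx hm => ?_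
    rw [hmove] at hm
    unfold resolve at hm
    split_ifs at hm
    · simp at hm
    · simp at hm
    · split at hm <;> simp at hm
    · split at hm
      · split at hm <;> simp at hm
      · simp at hm
  | release z' =>
    by_cases hzz : z' = z
    · subst hzz
      exact recycles_release hkM hs hv ht
    · refine recycles_of_never fun x r y hr hx hm => hzz ?_
      rw [hmove] at hm
      unfold resolve at hm
      split_ifs at hm
      · simp at hm
      · simpa [eq_comm] using (Prod.mk.inj hm).1
      · split at hm
        · simp at hm
        · simpa [eq_comm] using (Prod.mk.inj hm).1
      · split at hm
        · split at hm <;> simp at hm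
        · simp at hm
  | collapse z' e a b =>
    have hout : ∀ x r y, i.Sat G x → i.move G adj x r = (.collapse z' e a b, y) →
        z' = z ∧ i.load G z ≤ k ∧ ¬ i.Blocked G v c z ∧ i.Collapsed G z e a b y := by
      intro x r y hx hm
      rw [sat_iff_of_active hz] at hx
      rw [hmove, resolve_collapse] at hm
      obtain ⟨h1, -, h2, rfl, rfl, h3, h4⟩ := hm
      refine ⟨rfl, h1, h2, (satOff_update _).2 hx.1, by simp, by rw [first_update, h3], ?_⟩
      have hb : b ∈ i.actNb G z' ∧ x b = e := by
        rcases h4 with ⟨-, -, rfl⟩ | ⟨-, h5, h6⟩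
        · exact ⟨(first_eq_some.1 h3).1, (first_eq_some.1 h3).2.1⟩
        · have := List.mem_of_getElem? h6
          simp only [List.mem_filter, decide_eq_true_eq] at this
          exact ⟨this.2.1, h5⟩
      exact ⟨hb.1, by rw [Function.update_of_ne (ne_of_mem_actNb hb.1), hb.2]⟩
    by_cases hex : ∃ x r y, i.Sat G x ∧ i.move G adj x r = (.collapse z' e a b, y)
    · obtain ⟨x, r, y₀, hx, hm⟩ := hex
      obtain ⟨rfl, hload, hB, h₀⟩ := hout x r y₀ hx hm
      -- a coinciding neighbor `b` of color `e` accounts for one rank, and a collapse to the color `c`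
      -- of `v` without coincidence for all ranks that are not discarded
      refine ⟨(if e = c ∧ a = b then k - i.load G z' else 0) +
          if i.Known G z' e ∨ a ≠ b then 1 else 0,
        fun y => ⟨fun hy => ?_, fun hy => outcomes_eq_empty fun x r hr hx hm => hy ?_⟩⟩
      · rw [← collapsed_iff h₀] at hy
        obtain ⟨hoff, hyz, hf, hb, hyb⟩ := hy
        rw [card_outcomes_of_update hz (c.pos.trans_le hkM) hoff
          (fun t => (t + i.load G z' < k ∧ e = c ∧ a = b) ∨ (k ≤ t + i.load G z' ∧
            ((adj z').filter fun w => i.Coincides G z' y w)[t + i.load G z' - k]? = some b))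
          fun x r hr hx => ?_]
        · rw [card_filter_ranks _ ((hadj z').1.filter _) hload]
          · congr 1
            have : b ∈ (adj z').filter (fun w => i.Coincides G z' y w) ↔ i.Known G z' e ∨ a ≠ b := by
              rw [← coincides_of_first hf hb hyb]
              simp only [List.mem_filter, (hadj z').2, decide_eq_true_eq]
              exact ⟨fun h => h.2, fun h => ⟨(mem_actNb.1 hb).1, h⟩⟩
            simp only [this]
          · rw [length_coincides hadj]
            exact card_compl_forb i G z' y
        · rw [hmove, resolve_collapse]
          constructor
          · rintro ⟨-, rfl, -, -, h1, -, h2⟩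
            subst h1
            refine ⟨by simp, rfl, ?_⟩
            rw [rank_update, coincides_update]
            tauto
          · rintro ⟨h1, rfl, h2⟩
            rw [h1]
            simp only [rank_update, first_update, coincides_update, Function.update_self,
              Function.update_idem]
            refine ⟨hload, trivial, hB, trivial, ?_, hf, ?_⟩
            · rw [← hyz, Function.update_eq_self]
            · rw [Function.update_of_ne (ne_of_mem_actNb hb)]
              tauto
      · obtain ⟨-, -, -, h⟩ := hout x r y hx hm
        exact (collapsed_iff h₀).1 h
    · exact recycles_of_never fun x r y hr hx hm => hex ⟨x, r, y, hx, hm⟩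

/-- Every move recycles. -/
theorem recycles (hadj : IsAdjacencyList G adj) {M : ℕ} (hkM : k ≤ M) (i : Idx n k)
    (o : Move n k) : i.Recycles G adj M o := by
  have hstay : (∀ x r, i.move G adj x r = (.stay, x)) → i.Recycles G adj M o := by
    intro h
    cases o with
    | stay =>
      refine recycles_of_fixed (fun _ => True) (fun x r y _ _ => ?_) fun y => Iff.rfl
      simp [h]
    | _ => exact recycles_of_never fun x r y _ _ => by simp [h]
  cases hs : i.stk with
  | nil => exact hstay fun x r => by simp [move, hs]
  | cons v l =>
    cases hv : i.pin v with
    | none => exact hstay fun x r => by simp [move, hs, hv]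
    | some c =>
      cases ht : i.target G v with
      | none => exact recycles_add hkM hs hv ht o
      | some z => exact recycles_resolve hadj hkM hs hv ht o

end Idx

/-! ### The coloring recycler as a randomness recycler -/

theorem PMF.tsum_map_mul {α β : Type*} (p : PMF α) (f : α → β) (g : β → ℝ≥0∞) :
    ∑' b, p.map f b * g b = ∑' a, p a * g (f a) := by
  classical
  simp only [PMF.map_apply, ← ENNReal.tsum_mul_right]
  rw [ENNReal.tsum_comm]
  refine tsum_congr fun a => ?_
  rw [tsum_eq_single (f a)]
  · simp
  · intro b hb
    simp [hb]

namespace Idx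

variable {n k : ℕ} {G : SimpleGraph (Fin n)} {i : Idx n k} {x y : Fin n → Fin k}
  {adj : Fin n → List (Fin n)}

open Classical in
/-- The weights of an index: the indicator of the colorings that are compatible with it. -/
noncomputable def weight (G : SimpleGraph (Fin n)) (i : Idx n k) (x : Fin n → Fin k) : ℝ≥0 :=
  if i.Sat G x then 1 else 0

/-- The number of random bits that a step uses: the least that make random numbers below `k`
possible.  The instruction for the most significant bit yields it as a logarithm rounded down. -/
def bits (k : ℕ) : ℕ := Nat.log 2 (k + k - 1)

theorem le_two_pow_bits (k : ℕ) : k ≤ 2 ^ bits k := by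
  have h := Nat.lt_pow_succ_log_self (b := 2) (by norm_num) (k + k - 1)
  rw [pow_succ] at h
  unfold bits
  omega

theorem two_pow_bits_le (hk : 1 ≤ k) : 2 ^ bits k ≤ 2 * k := by
  have h := Nat.pow_log_le_self 2 (x := k + k - 1) (by omega)
  unfold bits
  omega

/-- A step of the recycler with random number `r`. -/
noncomputable def next (G : SimpleGraph (Fin n)) (adj : Fin n → List (Fin n))
    (s : (Fin n → Fin k) × Idx n k) (r : ℕ) : (Fin n → Fin k) × Idx n k :=
  ((s.2.move G adj s.1 r).2, s.2.apply (s.2.move G adj s.1 r).1)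

/-- The law of a step of the recycler. -/
noncomputable def stepLaw (G : SimpleGraph (Fin n)) (adj : Fin n → List (Fin n))
    (s : (Fin n → Fin k) × Idx n k) : PMF ((Fin n → Fin k) × Idx n k) :=
  (PMF.uniformOfFintype (Fin (2 ^ bits k))).map fun r : Fin (2 ^ bits k) => next G adj s r.val

theorem tsum_stepLaw_mul (s : (Fin n → Fin k) × Idx n k)
    (g : (Fin n → Fin k) × Idx n k → ℝ≥0∞) :
    ∑' b, stepLaw G adj s b * g b
      = (2 ^ bits k : ℝ≥0∞)⁻¹ * ∑ r ∈ Finset.range (2 ^ bits k), g (next G adj s r) := by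
  rw [stepLaw, PMF.tsum_map_mul, tsum_fintype, Finset.sum_range, Finset.mul_sum]
  simp

/-- Weights are recycled: whatever move is made, the next state is distributed according to the
weights of the next index. -/
theorem sum_weight_mul_stepLaw (hadj : IsAdjacencyList G adj) (i j : Idx n k) :
    ∃ c : ℝ≥0, ∀ y, ∑ x, (weight G i x : ℝ≥0∞) * stepLaw G adj (x, i) (y, j)
      = c * weight G j y := by
  classical
  set M := 2 ^ bits k with hM
  choose c hc using recycles hadj (le_two_pow_bits k) i
  set O : Finset (Move n k) :=
    ((Finset.univ ×ˢ Finset.range M).image fun p : (Fin n → Fin k) × ℕ =>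
      (i.move G adj p.1 p.2).1).filter fun o => i.apply o = j with hO
  refine ⟨(M : ℝ≥0)⁻¹ * ∑ o ∈ O, (c o : ℝ≥0), fun y => ?_⟩
  have h1 : ∀ x, (weight G i x : ℝ≥0∞) * stepLaw G adj (x, i) (y, j)
      = (M : ℝ≥0∞)⁻¹ * ∑ r ∈ Finset.range M,
          if i.Sat G x ∧ next G adj (x, i) r = (y, j) then 1 else 0 := by
    intro x
    have := tsum_stepLaw_mul (G := G) (adj := adj) (x, i) fun b => if b = (y, j) then 1 else 0
    rw [tsum_eq_single (y, j) (by intro b hb; simp [hb])] at this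
    simp only [if_true, mul_one] at this
    rw [this]
    by_cases hx : i.Sat G x
    · simp [weight, hx, hM]
    · simp [weight, hx]
  have h2 : ∑ x, ∑ r ∈ Finset.range M,
      (if i.Sat G x ∧ next G adj (x, i) r = (y, j) then (1 : ℝ≥0∞) else 0)
        = ∑ o ∈ O, ((i.outcomes G adj M o y).card : ℝ≥0∞) := by
    rw [← Finset.sum_product', Finset.sum_boole, ← Nat.cast_sum]
    congr 1
    rw [Finset.card_eq_sum_card_fiberwise (f := fun p => (i.move G adj p.1 p.2).1) (t := O)]
    · refine Finset.sum_congr rfl fun o ho => congrArg Finset.card ?_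
      ext p
      simp only [outcomes, Finset.mem_filter, next, Prod.ext_iff]
      have hj := (Finset.mem_filter.1 ho).2
      constructor
      · rintro ⟨⟨h, h1, h2, -⟩, h3⟩
        exact ⟨h, h1, h3, h2⟩
      · rintro ⟨h, h1, h3, h2⟩
        exact ⟨⟨h, h1, h2, by rw [h3, hj]⟩, h3⟩
    · intro p hp
      simp only [Finset.coe_filter, Set.mem_ofPred_eq, next, Prod.mk.injEq] at hp
      refine Finset.mem_coe.2 (Finset.mem_filter.2 ⟨?_, hp.2.2.2⟩)
      exact Finset.mem_image_of_mem (fun p : (Fin n → Fin k) × ℕ => (i.move G adj p.1 p.2).1) hp.1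
  rw [Finset.sum_congr rfl fun x _ => h1 x, ← Finset.mul_sum, h2]
  have h3 : ∑ o ∈ O, ((i.outcomes G adj M o y).card : ℝ≥0∞)
      = (∑ o ∈ O, (c o : ℝ≥0∞)) * weight G j y := by
    rw [Finset.sum_mul]
    refine Finset.sum_congr rfl fun o ho => ?_
    have hj := (Finset.mem_filter.1 ho).2
    by_cases hy : j.Sat G y
    · rw [(hc o y).1 (hj ▸ hy)]
      simp [weight, hy]
    · rw [(hc o y).2 (hj ▸ hy)]
      simp [weight, hy]
  rw [h3, ← mul_assoc]
  congr 1
  have : (M : ℝ≥0) ≠ 0 := by simp [hM]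
  rw [ENNReal.coe_mul, ENNReal.coe_inv this]
  simp

/-- All nodes are active. -/
def Done (i : Idx n k) : Prop := i.stk = [] ∧ ∀ w, i.pin w = none

/-- In the beginning all nodes are inactive and forbid nothing. -/
def initial (n : ℕ) {k : ℕ} (hk : 0 < k) : Idx n k :=
  ⟨fun _ => some ⟨0, hk⟩, fun _ => 0, (List.finRange n).reverse⟩

theorem sat_initial (hk : 0 < k) : (initial n hk).Sat G x ↔ x = fun _ => ⟨0, hk⟩ := by
  constructor
  · exact fun h => funext fun w => h.1 w _ rfl
  · rintro rfl
    refine ⟨fun w c hw => ?_, fun u w hu => ?_⟩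
    · simpa [initial] using hw
    · simp [initial] at hu

theorem Done.sat_iff (h : i.Done) : i.Sat G x ↔ IsProper G x := by
  constructor
  · exact fun hx u w huw => hx.2 u w (h.2 u) huw (Or.inl (h.2 w))
  · refine fun hx => ⟨fun w c hw => ?_, fun u w _ huw _ => hx u w huw⟩
    simp [h.2 w] at hw

/-- The coloring recycler. -/
noncomputable def recycler (G : SimpleGraph (Fin n)) (adj : Fin n → List (Fin n))
    (hadj : IsAdjacencyList G adj) (hk : 0 < k) :
    RandomnessRecycler (Fin n → Fin k) (properWeight G) where
  Index := Idx n k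
  weight := weight G
  start := initial n hk
  draw := PMF.pure fun _ => ⟨0, hk⟩
  step := stepLaw G adj
  final := {i | i.Done}
  draw_eq := ⟨1, fun x => by
    by_cases hx : x = fun _ => ⟨0, hk⟩ <;> simp [weight, sat_initial, PMF.pure_apply, hx]⟩
  step_eq i _ j := sum_weight_mul_stepLaw hadj i j
  final_eq i hi := ⟨1, one_pos, fun x => by
    have hi : i.Done := hi
    by_cases hx : IsProper G x <;> simp [weight, properWeight, hi.sat_iff, hx]⟩

/-! ### Indices that occur -/

/-- The stack lists the inactive nodes. -/
def Valid (i : Idx n k) : Prop := i.stk.Nodup ∧ ∀ w, w ∈ i.stk ↔ i.pin w ≠ none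

theorem valid_initial (hk : 0 < k) : (initial n hk).Valid := by
  refine ⟨List.nodup_reverse.2 (List.nodup_finRange n), fun w => ?_⟩
  simp [initial]

/-- What the moves satisfy that can be made. -/
def Possible (i : Idx n k) (G : SimpleGraph (Fin n)) : Move n k → Prop
  | .stay => True
  | .activate => i.stk ≠ []
  | .release z => ∃ v l, i.stk = v :: l ∧ i.pin v ≠ none ∧ G.Adj v z ∧ (z : ℕ) < i.th v
  | .collapse z _ a b => a ∈ i.actNb G z ∧ b ∈ i.actNb G z

theorem possible_move (x : Fin n → Fin k) (r : ℕ) :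
    i.Possible G (i.move G adj x r).1 := by
  classical
  cases hs : i.stk with
  | nil => simp [move, hs, Possible]
  | cons v l =>
    cases hv : i.pin v with
    | none => simp [move, hs, hv, Possible]
    | some c =>
      cases ht : i.target G v with
      | none =>
        have hmove : i.move G adj x r = i.add G v x r := by simp [move, hs, hv, ht]
        rw [hmove]
        unfold add
        split_ifs
        · trivial
        · split
          · rename_i u hf
            exact ⟨(first_eq_some.1 hf).1, (first_eq_some.1 hf).1⟩
          · simp [Possible, hs]
        · trivial
      | some z =>
        have hmove : i.move G adj x r = i.resolve G adj v c z x r := by simp [move, hs, hv, ht]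
        rw [target_eq_some] at ht
        have hrel : i.Possible G (.release z) :=
          ⟨v, l, hs, by simp [hv], (mem_actNb.1 ht.1).1, ht.2.1⟩
        rw [hmove]
        unfold resolve
        split_ifs
        · trivial
        · exact hrel
        · split
          · rename_i u hf
            exact ⟨(first_eq_some.1 hf).1, (first_eq_some.1 hf).1⟩
          · exact hrel
        · split
          · rename_i b hb
            have hb := List.mem_of_getElem? hb
            simp only [List.mem_filter, decide_eq_true_eq] at hb
            split
            · rename_i a hf
              exact ⟨(first_eq_some.1 hf).1, hb.2.1⟩
            · trivial
          · trivial

theorem Valid.apply (h : i.Valid) {o : Move n k} (ho : i.Possible G o) : (i.apply o).Valid := by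
  obtain ⟨hn, hm⟩ := h
  cases o with
  | stay => exact ⟨hn, hm⟩
  | activate =>
    cases hs : i.stk with
    | nil => exact absurd hs ho
    | cons v l =>
      rw [hs] at hn hm
      rw [List.nodup_cons] at hn
      simp only [Idx.apply, hs, Valid]
      refine ⟨hn.2, fun w => ?_⟩
      by_cases hw : w = v
      · subst hw
        simp [hn.1]
      · rw [Function.update_of_ne hw, ← hm w]
        simp [hw]
  | release z =>
    obtain ⟨v, l, hs, -⟩ := ho
    simp only [Idx.apply, hs, Valid]
    rw [← hs]
    exact ⟨hn, hm⟩
  | collapse z e a b =>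
    obtain ⟨ha, hb⟩ := ho
    have haz := ne_of_mem_actNb ha
    have hbz := ne_of_mem_actNb hb
    rw [mem_actNb] at ha hb
    have ha' : a ∉ i.stk := by simp [hm, ha.2]
    have hb' : b ∉ i.stk := by simp [hm, hb.2]
    have hz' : i.pin z = none ↔ z ∉ i.stk := by simp [hm]
    simp only [Idx.apply, Valid, hz']
    refine ⟨?_, fun w => ?_⟩
    · by_cases hab : a = b
      · subst hab
        by_cases hz : z ∈ i.stk <;> simp [hz, ha', hn, haz]
      · by_cases hz : z ∈ i.stk <;> simp [hab, hz, ha', hb', hn, haz, hbz, Ne.symm hab]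
    · have := hm w
      by_cases hab : a = b <;> by_cases hz : z ∈ i.stk <;> by_cases h1 : w = z <;>
        by_cases h2 : w = a <;> by_cases h3 : w = b <;> simp_all

theorem Valid.ne_nil (h : i.Valid) (hd : ¬ i.Done) : i.stk ≠ [] := by
  intro hs
  refine hd ⟨hs, fun w => ?_⟩
  by_contra hw
  simpa [hs] using (h.2 w).2 hw

theorem Valid.done_iff (h : i.Valid) : i.Done ↔ i.stk = [] :=
  ⟨fun hd => hd.1, fun hs => by_contra fun hd => h.ne_nil hd hs⟩

theorem length_apply (o : Move n k) : i.stk.length ≤ (i.apply o).stk.length + 1 := by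
  cases o with
  | stay => simp [apply]
  | activate =>
    cases hs : i.stk <;> simp [apply, hs]
  | release z =>
    cases hs : i.stk <;> simp [apply, hs]
  | collapse z e a b =>
    simp [apply]
    omega

/-- Indices that occur are valid, and at most one node leaves the stack in each step. -/
theorem mem_support_lawAt {hadj : IsAdjacencyList G adj} {hk : 0 < k} {t : ℕ}
    {s : (Fin n → Fin k) × Idx n k} (hs : s ∈ ((recycler G adj hadj hk).lawAt t).support) :
    s.2.Valid ∧ n ≤ s.2.stk.length + t := by
  induction t generalizing s with
  | zero =>
    obtain ⟨x, hx, rfl⟩ := (PMF.mem_support_map_iff _ _ _).1 hs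
    exact ⟨valid_initial hk, by simp [recycler, initial]⟩
  | succ t ih =>
    obtain ⟨s', hs', hs⟩ := (PMF.mem_support_bind_iff _ _ _).1 hs
    obtain ⟨h1, h2⟩ := ih hs'
    split_ifs at hs with hf
    · obtain rfl := (PMF.mem_support_pure_iff _ _).1 hs
      exact ⟨h1, by omega⟩
    · obtain ⟨r, -, rfl⟩ := (PMF.mem_support_map_iff _ _ _).1 hs
      refine ⟨h1.apply (possible_move _ _), ?_⟩
      have := length_apply (i := s'.2) (s'.2.move G adj s'.1 r).1
      simp only [next]
      omega

end Idx

/-! ### The potential -/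

namespace Idx

variable {n k : ℕ} {G : SimpleGraph (Fin n)} {i : Idx n k} {z v : Fin n} {x y : Fin n → Fin k}
  {adj : Fin n → List (Fin n)} {D : ℕ} {lam : ℝ}

open Classical in
/-- The number of neighbors to which `w` forbids its color as soon as they are active. -/
noncomputable def reach (G : SimpleGraph (Fin n)) (i : Idx n k) (w : Fin n) : ℕ :=
  (Finset.univ.filter fun u : Fin n => G.Adj w u ∧ (u : ℕ) < i.th w).card

/-- The contribution of `w` to the potential. -/
noncomputable def nodeCost (G : SimpleGraph (Fin n)) (lam : ℝ) (i : Idx n k) (w : Fin n) : ℝ :=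
  if i.pin w = none then 0 else 1 + lam * reach G i w

/-- The potential: the inactive nodes, and `lam` times the restrictions that they impose. -/
noncomputable def cost (G : SimpleGraph (Fin n)) (lam : ℝ) (i : Idx n k) : ℝ :=
  ∑ w, nodeCost G lam i w

/-- The degrees are at most `D`. -/
def DegLE (G : SimpleGraph (Fin n)) (D : ℕ) : Prop :=
  ∀ (v : Fin n) (s : Finset (Fin n)), (∀ u ∈ s, G.Adj v u) → s.card ≤ D

theorem nodeCost_nonneg (hlam : 0 ≤ lam) (w : Fin n) : 0 ≤ nodeCost G lam i w := by
  unfold nodeCost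
  split_ifs <;> positivity

theorem cost_nonneg (hlam : 0 ≤ lam) : 0 ≤ cost G lam i :=
  Finset.sum_nonneg fun w _ => nodeCost_nonneg hlam w

theorem cost_initial (hk : 0 < k) : cost G lam (initial n hk) = n := by
  simp [cost, nodeCost, reach, initial]

theorem cost_activate {l : List (Fin n)} (hlam : 0 ≤ lam) (hs : i.stk = v :: l)
    (hv : i.pin v ≠ none) : cost G lam (i.apply .activate) ≤ cost G lam i - 1 := by
  have : cost G lam i - 1 = ∑ w, (nodeCost G lam i w - if w = v then 1 else 0) := by
    simp [cost, Finset.sum_sub_distrib]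
  rw [this]
  have ha : i.apply .activate = ⟨Function.update i.pin v none, i.th, l⟩ := by simp [apply, hs]
  refine Finset.sum_le_sum fun w _ => ?_
  rw [ha]
  by_cases hw : w = v
  · subst hw
    have : 0 ≤ lam * reach G i w := by positivity
    simpa [nodeCost, hv] using this
  · simp [nodeCost, hw, reach]

theorem cost_release {l : List (Fin n)} (hlam : 0 ≤ lam) (hs : i.stk = v :: l)
    (hv : i.pin v ≠ none) (hz : G.Adj v z) (hlt : (z : ℕ) < i.th v) :
    cost G lam (i.apply (.release z)) ≤ cost G lam i - lam := by
  classical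
  have : cost G lam i - lam = ∑ w, (nodeCost G lam i w - if w = v then lam else 0) := by
    simp [cost, Finset.sum_sub_distrib]
  rw [this]
  refine Finset.sum_le_sum fun w _ => ?_
  by_cases hw : w = v
  · subst hw
    have h1 : reach G (i.apply (.release z)) w + 1 ≤ reach G i w := by
      refine Nat.succ_le_of_lt (Finset.card_lt_card ⟨fun u hu => ?_, fun h => ?_⟩)
      · simp only [apply, hs, Function.update_self, Finset.mem_filter] at hu ⊢
        exact ⟨hu.1, hu.2.1, hu.2.2.trans hlt⟩
      · have := h (Finset.mem_filter.2 ⟨Finset.mem_univ z, hz, hlt⟩)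
        simp [apply, hs] at this
    have h2 : (i.apply (.release z)).pin w ≠ none := by simpa [apply, hs] using hv
    have h3 : ((reach G (i.apply (.release z)) w : ℕ) : ℝ) + 1 ≤ reach G i w := by
      exact_mod_cast h1
    simp only [nodeCost, h2, hv, if_false, if_true]
    nlinarith
  · have ha : i.apply (.release z) = ⟨i.pin, Function.update i.th v z, i.stk⟩ := by
      simp [apply, hs]
    rw [ha]
    simp [nodeCost, hw, reach]

theorem reach_le (hD : DegLE G D) (w : Fin n) : reach G i w ≤ D := by
  unfold reach
  refine hD w _ fun u hu => ?_
  simp only [Finset.mem_filter] at hu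
  exact hu.2.1

/-- The price of a collapse.  The node `z` becomes inactive if it was not, and restricts at most
`D - 1` neighbors because its threshold is its neighbor `a`; `a` and `b` become inactive and may
restrict all of their neighbors. -/
theorem cost_collapse (hlam : 0 ≤ lam) (hD : DegLE G D) {e : Fin k} {a b : Fin n}
    (ha : a ∈ i.actNb G z) (hb : b ∈ i.actNb G z) :
    cost G lam (i.apply (.collapse z e a b)) ≤ cost G lam i +
      (if i.pin z = none then 1 else 0) + lam * (D - 1) + (1 + lam * D) +
        if a = b then 0 else 1 + lam * D := by
  classical
  have haz := ne_of_mem_actNb ha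
  have hbz := ne_of_mem_actNb hb
  rw [mem_actNb] at ha hb
  set i' := i.apply (.collapse z e a b) with hi'
  have hsum : cost G lam i + (if i.pin z = none then 1 else 0) + lam * (D - 1) + (1 + lam * D) +
      (if a = b then 0 else 1 + lam * D) = ∑ w, (nodeCost G lam i w
        + (if w = z then (if i.pin z = none then 1 else 0) + lam * (D - 1) else 0)
        + (if w = a then 1 + lam * D else 0)
        + (if w = b then (if a = b then 0 else 1 + lam * D) else 0)) := by
    simp [cost, Finset.sum_add_distrib]
    ring
  rw [hsum]
  refine Finset.sum_le_sum fun w _ => ?_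
  have hnn := nodeCost_nonneg (G := G) (i := i) hlam w
  have hreach : ((reach G i' w : ℕ) : ℝ) ≤ D := by exact_mod_cast reach_le hD w
  have hreach' := mul_le_mul_of_nonneg_left hreach hlam
  have hin : nodeCost G lam i' w ≤ 1 + lam * reach G i' w := by
    unfold nodeCost
    split_ifs
    · positivity
    · exact le_rfl
  by_cases hwz : w = z
  · subst hwz
    have h1 : reach G i' w + 1 ≤ D := by
      have hna : a ∉ Finset.univ.filter fun u : Fin n => G.Adj w u ∧ (u : ℕ) < i'.th w := by
        simp [i', apply, haz.symm, hbz.symm]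
      have := hD w (insert a (Finset.univ.filter fun u : Fin n => G.Adj w u ∧ (u : ℕ) < i'.th w))
        fun u hu => by
          rcases Finset.mem_insert.1 hu with rfl | hu
          · exact ha.1
          · exact (Finset.mem_filter.1 hu).2.1
      rwa [Finset.card_insert_of_notMem hna] at this
    have h2 : ((reach G i' w : ℕ) : ℝ) + 1 ≤ D := by exact_mod_cast h1
    have h3 : 1 ≤ nodeCost G lam i w + if i.pin w = none then 1 else 0 := by
      unfold nodeCost
      split_ifs
      · simp
      · simp only [add_zero, le_add_iff_nonneg_right]
        positivity
    simp only [haz.symm, hbz.symm, if_true, if_false, add_zero]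
    nlinarith
  · by_cases hwa : w = a
    · subst hwa
      by_cases hwb : w = b
      · subst hwb
        simp only [hwz, if_true, if_false, add_zero]
        linarith
      · simp only [hwz, hwb, if_true, if_false, add_zero]
        linarith
    · by_cases hwb : w = b
      · subst hwb
        simp only [hwz, hwa, Ne.symm hwa, if_true, if_false, add_zero]
        linarith
      · simp only [hwz, hwa, hwb, if_false, add_zero]
        simp [nodeCost, i', apply, hwz, hwa, hwb, reach]

/-! ### Probabilities of coincidences -/

open Classical in
/-- The compatible colorings. -/
noncomputable def sats (G : SimpleGraph (Fin n)) (i : Idx n k) : Finset (Fin n → Fin k) :=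
  Finset.univ.filter (i.Sat G)

theorem mem_sats : x ∈ i.sats G ↔ i.Sat G x := by simp [sats]

open Classical in
/-- Double counting by exchanging the color of `z`: the pairs of a coloring with `x z ∈ T x` and a
color in `S x` are mapped injectively to those with the roles of `S` and `T` exchanged. -/
theorem sum_card_swap_le (hz : i.pin z = none) (S T : (Fin n → Fin k) → Finset (Fin k))
    (hS : ∀ x, S x ⊆ (i.forb G z x)ᶜ) (hSu : ∀ x d, S (Function.update x z d) = S x)
    (hTu : ∀ x d, T (Function.update x z d) = T x) :
    ∑ x ∈ (i.sats G).filter (fun x => x z ∈ T x), (S x).card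
      ≤ ∑ x ∈ (i.sats G).filter (fun x => x z ∈ S x), (T x).card := by
  rw [← Finset.card_sigma, ← Finset.card_sigma]
  refine Finset.card_le_card_of_injOn (fun p => ⟨Function.update p.1 z p.2, p.1 z⟩) ?_ ?_
  · rintro ⟨x, d⟩ hx
    simp only [Finset.coe_sigma, Set.mem_sigma_iff, Finset.mem_coe, Finset.mem_filter, mem_sats,
      Function.update_self, hSu, hTu] at hx ⊢
    obtain ⟨⟨hx, ht⟩, hd⟩ := hx
    refine ⟨⟨?_, hd⟩, ht⟩
    rw [sat_iff_of_active hz] at hx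
    exact (sat_update_iff hz hx.1).2 (Finset.mem_compl.1 (hS x hd))
  · rintro ⟨x, d⟩ hx ⟨x', d'⟩ hx' h
    simp only [Sigma.mk.injEq, heq_eq_eq] at h
    obtain ⟨h1, h2⟩ := h
    have h3 : d = d' := by simpa using congrFun h1 z
    have h4 : x = x' := by
      funext w
      by_cases hw : w = z
      · rw [hw, h2]
      · simpa [hw] using congrFun h1 w
    subst h3 h4
    rfl

theorem card_known_le (i : Idx n k) (G : SimpleGraph (Fin n)) (z : Fin n) :
    open Classical in
    (i.known G z).card ≤ (Finset.univ.filter fun f => G.Adj z f ∧ i.pin f ≠ none).card := by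
  classical
  have : (i.known G z).card ≤
      ((Finset.univ.filter fun f => G.Adj z f ∧ i.pin f ≠ none).image i.pin).card := by
    refine Finset.card_le_card_of_injOn some (fun c hc => ?_) fun c _ d _ h => Option.some.inj h
    obtain ⟨f, h1, -, h2⟩ := mem_known.1 hc
    exact Finset.mem_coe.2 (Finset.mem_image.2 ⟨f, by simp [h1, h2], h2⟩)
  exact this.trans Finset.card_image_le

theorem load_le (hD : DegLE G D) (i : Idx n k) (z : Fin n) : i.load G z ≤ D := by
  classical
  have h1 := card_known_le i G z
  have h2 := hD z ((Finset.univ.filter fun f => G.Adj z f ∧ i.pin f ≠ none) ∪ i.actNb G z)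
    fun u hu => by
      rcases Finset.mem_union.1 hu with hu | hu
      · exact (Finset.mem_filter.1 hu).2.1
      · exact (mem_actNb.1 hu).1
  rw [Finset.card_union_of_disjoint] at h2
  · unfold load
    omega
  · rw [Finset.disjoint_left]
    intro u hu hu'
    exact (Finset.mem_filter.1 hu).2.2 (mem_actNb.1 hu').2

open Classical in
/-- The color of an active node lies in a set of `t` colors with probability at most `t / (k - D)`,
even if the set depends on the colors of the other nodes. -/
theorem card_mul_le_of_color (hD : DegLE G D) (hz : i.pin z = none)
    (T : (Fin n → Fin k) → Finset (Fin k)) (t : ℕ) (hT : ∀ x, (T x).card ≤ t)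
    (hTu : ∀ x d, T (Function.update x z d) = T x) :
    (k - D) * ((i.sats G).filter fun x => x z ∈ T x).card ≤ t * (i.sats G).card := by
  have h := sum_card_swap_le (G := G) hz (fun x => (i.forb G z x)ᶜ) T (fun x => le_rfl)
    (fun x d => by simp only [forb_update]) hTu
  have h1 : ∀ x, k - D ≤ (i.forb G z x)ᶜ.card := fun x => by
    have := card_compl_forb i G z x
    have := load_le hD i z
    omega
  calc (k - D) * ((i.sats G).filter fun x => x z ∈ T x).card
      = ∑ x ∈ (i.sats G).filter (fun x => x z ∈ T x), (k - D) := by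
        rw [Finset.sum_const, smul_eq_mul, mul_comm]
    _ ≤ _ := Finset.sum_le_sum fun x _ => h1 x
    _ ≤ _ := h
    _ ≤ ∑ x ∈ (i.sats G).filter (fun x => x z ∈ (i.forb G z x)ᶜ), t :=
        Finset.sum_le_sum fun x _ => hT x
    _ ≤ t * (i.sats G).card := by
        rw [Finset.sum_const, smul_eq_mul, mul_comm]
        exact Nat.mul_le_mul_left _ (Finset.card_le_card (Finset.filter_subset _ _))

open Classical in
/-- The probability that a neighbor of `z` has the color `c` that `z` ought to receive. -/
theorem card_mul_le_of_nb (hD : DegLE G D) {c : Fin k} (hc : i.Known G z c) :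
    (k - D) * ((i.sats G).filter fun x => ∃ w ∈ i.actNb G z, x w = c).card
      ≤ (D - 1) * (i.sats G).card := by
  have hU : (i.actNb G z).card ≤ D - 1 := by
    have h1 := load_le hD i z
    have h2 : 0 < (i.known G z).card := Finset.card_pos.2 ⟨c, mem_known.2 hc⟩
    unfold load at h1
    omega
  have h1 : (i.sats G).filter (fun x => ∃ w ∈ i.actNb G z, x w = c) ⊆
      (i.actNb G z).biUnion fun w => (i.sats G).filter fun x => x w ∈ ({c} : Finset (Fin k)) := by
    intro x hx
    obtain ⟨h, w, hw, he⟩ := Finset.mem_filter.1 hx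
    exact Finset.mem_biUnion.2 ⟨w, hw, Finset.mem_filter.2 ⟨h, by simpa using he⟩⟩
  calc _ ≤ (k - D) * ∑ w ∈ i.actNb G z,
        ((i.sats G).filter fun x => x w ∈ ({c} : Finset (Fin k))).card :=
        Nat.mul_le_mul_left _ ((Finset.card_le_card h1).trans Finset.card_biUnion_le)
    _ = ∑ w ∈ i.actNb G z, (k - D) *
        ((i.sats G).filter fun x => x w ∈ ({c} : Finset (Fin k))).card := Finset.mul_sum _ _ _
    _ ≤ ∑ w ∈ i.actNb G z, 1 * (i.sats G).card := Finset.sum_le_sum fun w hw =>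
        card_mul_le_of_color hD (mem_actNb.1 hw).2 (fun _ => {c}) 1 (by simp) (by simp)
    _ ≤ _ := by
        rw [Finset.sum_const, smul_eq_mul, one_mul]
        exact Nat.mul_le_mul_right _ hU

open Classical in
/-- The probability that the neighbor `w` of `z` coincides with a smaller active neighbor or with a
known color. -/
theorem card_mul_le_of_coincides (hD : DegLE G D) {w : Fin n} (hw : w ∈ i.actNb G z) :
    (k - D) * ((i.sats G).filter fun x => i.Coincides G z x w).card
      ≤ ((i.known G z).card + ((i.actNb G z).filter (· < w)).card) * (i.sats G).card := by
  have h := card_mul_le_of_color (G := G) hD (mem_actNb.1 hw).2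
    (fun x => i.known G z ∪ ((i.actNb G z).filter (· < w)).image x) _
    (fun x => (Finset.card_union_le _ _).trans (Nat.add_le_add_left Finset.card_image_le _))
    (fun x d => by
      congr 1
      refine Finset.image_congr fun u hu => ?_
      have hu := (Finset.mem_filter.1 hu).2
      exact Function.update_of_ne hu.ne _ _)
  refine le_trans (Nat.mul_le_mul_left _ (Finset.card_le_card fun x hx => ?_)) h
  rw [Finset.mem_filter] at hx ⊢
  refine ⟨hx.1, ?_⟩
  obtain ⟨-, -, h | ⟨w', hw', hlt, he⟩⟩ := hx
  · exact Finset.mem_union_left _ h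
  · exact Finset.mem_union_right _
      (Finset.mem_image.2 ⟨w', Finset.mem_filter.2 ⟨hw', hlt⟩, he⟩)

open Classical in
/-- The expected number of coinciding neighbors of `z` is at most `D * (D - 1) / (2 * (k - D))`. -/
theorem sum_coincides_le (hD : DegLE G D) {c : Fin k} (hc : i.Known G z c) :
    2 * (k - D) * ∑ x ∈ i.sats G, ((i.actNb G z).filter (i.Coincides G z x)).card
      ≤ D * (D - 1) * (i.sats G).card := by
  have h1 : ∑ x ∈ i.sats G, ((i.actNb G z).filter (i.Coincides G z x)).card
      = ∑ w ∈ i.actNb G z, ((i.sats G).filter fun x => i.Coincides G z x w).card := by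
    simp only [Finset.card_filter]
    exact Finset.sum_comm
  have h2 : ∑ w ∈ i.actNb G z, ((i.actNb G z).filter (· < w)).card
      = ∑ t ∈ Finset.range (i.actNb G z).card, t := by
    obtain ⟨h3, h4⟩ := image_rank (i.actNb G z)
    rw [← h3]
    refine Eq.trans ?_ (Finset.sum_image (f := fun t => t) h4).symm
    exact Finset.sum_congr rfl fun w _ => by congr
  have h3 := Finset.sum_range_id_mul_two (i.actNb G z).card
  have h4 : 0 < (i.known G z).card := Finset.card_pos.2 ⟨c, mem_known.2 hc⟩
  have h5 := load_le hD i z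
  unfold load at h5
  have h6 : 2 * ((i.known G z).card * (i.actNb G z).card
      + ∑ t ∈ Finset.range (i.actNb G z).card, t) ≤ D * (D - 1) := by
    rw [mul_add, mul_comm 2 (∑ t ∈ _, t), h3]
    obtain ⟨a, ha⟩ := Nat.exists_eq_add_of_le h5
    generalize (i.known G z).card = K at *
    generalize (i.actNb G z).card = U at *
    obtain ⟨K, rfl⟩ : ∃ K', K = K' + 1 := ⟨K - 1, by omega⟩
    rw [ha]
    cases U with
    | zero => simp
    | succ U =>
      have : K + 1 + (U + 1) + a - 1 = K + U + 1 + a := by omega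
      rw [this, Nat.add_sub_cancel]
      nlinarith [Nat.zero_le (K * K), Nat.zero_le (K * U), Nat.zero_le (a * a),
        Nat.zero_le (K * a), Nat.zero_le (U * a)]
  calc _ = 2 * ∑ w ∈ i.actNb G z, (k - D) *
        ((i.sats G).filter fun x => i.Coincides G z x w).card := by
        rw [h1, mul_assoc, Finset.mul_sum]
    _ ≤ 2 * ∑ w ∈ i.actNb G z,
        ((i.known G z).card + ((i.actNb G z).filter (· < w)).card) * (i.sats G).card :=
        Nat.mul_le_mul_left _ (Finset.sum_le_sum fun w hw => card_mul_le_of_coincides hD hw)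
    _ = 2 * ((i.known G z).card * (i.actNb G z).card
          + ∑ t ∈ Finset.range (i.actNb G z).card, t) * (i.sats G).card := by
        rw [← Finset.sum_mul, Finset.sum_add_distrib, h2, Finset.sum_const, smul_eq_mul, mul_assoc,
          mul_comm (i.known G z).card]
    _ ≤ _ := Nat.mul_le_mul_right _ h6

open Classical in
/-- The probability that the color of `z` has a rank that is to be discarded. -/
theorem card_mul_le_of_rank (hz : i.pin z = none) (hL : i.load G z ≤ k) :
    (k - i.load G z) * ((i.sats G).filter fun x => k ≤ i.rank G z x (x z) + i.load G z).card
      ≤ ∑ x ∈ i.sats G, ((i.actNb G z).filter (i.Coincides G z x)).card := by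
  have h := sum_card_swap_le (G := G) hz
    (fun x => (i.forb G z x)ᶜ.filter fun d => i.rank G z x d + i.load G z < k)
    (fun x => (i.forb G z x)ᶜ.filter fun d => k ≤ i.rank G z x d + i.load G z)
    (fun x => Finset.filter_subset _ _) (fun x d => by simp only [forb_update, rank_update])
    (fun x d => by simp only [forb_update, rank_update])
  have hcS : ∀ x, ((i.forb G z x)ᶜ.filter fun d => i.rank G z x d + i.load G z < k).card
      = k - i.load G z := by
    intro x
    have h1 := card_compl_forb i G z x
    rw [card_rank (fun t => t + i.load G z < k)]
    have : (Finset.range (i.forb G z x)ᶜ.card).filter (fun t => t + i.load G z < k)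
        = Finset.range (k - i.load G z) := by
      ext t
      simp only [Finset.mem_filter, Finset.mem_range]
      omega
    rw [this, Finset.card_range]
  have hcT : ∀ x, ((i.forb G z x)ᶜ.filter fun d => k ≤ i.rank G z x d + i.load G z).card
      = ((i.actNb G z).filter (i.Coincides G z x)).card := by
    intro x
    have h1 := card_compl_forb i G z x
    have h2 := hcS x
    have h3 := Finset.card_filter_add_card_filter_not (s := (i.forb G z x)ᶜ)
      fun d => i.rank G z x d + i.load G z < k
    simp only [not_lt] at h3
    omega
  simp only [hcS, hcT] at h
  rw [Finset.sum_const, smul_eq_mul, mul_comm] at h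
  refine le_trans (Nat.mul_le_mul_left _ (Finset.card_le_card fun x hx => ?_))
    (h.trans (Finset.sum_le_sum_of_subset (Finset.filter_subset _ _)))
  rw [Finset.mem_filter] at hx ⊢
  refine ⟨hx.1, Finset.mem_filter.2 ⟨?_, hx.2⟩⟩
  exact Finset.mem_compl.2 ((sat_iff_of_active hz).1 (mem_sats.1 hx.1)).2

end Idx

/-! ### The drift of a step and the number of steps -/

namespace Idx

variable {n k : ℕ} {G : SimpleGraph (Fin n)} {i : Idx n k} {z v : Fin n} {x y : Fin n → Fin k}
  {adj : Fin n → List (Fin n)} {D M : ℕ} {lam : ℝ}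

/-- The change of the potential in a step with random number `r`. -/
noncomputable def costChange (G : SimpleGraph (Fin n)) (adj : Fin n → List (Fin n)) (lam : ℝ)
    (i : Idx n k) (x : Fin n → Fin k) (r : ℕ) : ℝ :=
  cost G lam (i.apply (i.move G adj x r).1) - cost G lam i

/-- The drift of attempts to activate a node.  At most `D` colors are forbidden. -/
theorem sum_costChange_add (hlam : 0 ≤ lam) (hD : DegLE G D) (hkM : k ≤ M)
    {l : List (Fin n)} {c : Fin k} (hs : i.stk = v :: l) (hv : i.pin v = some c)
    (ht : i.target G v = none) (x : Fin n → Fin k) :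
    ∑ r ∈ Finset.range M, costChange G adj lam i x r
      ≤ -(k - D) + D * (1 + 2 * lam * D) := by
  classical
  set B : ℝ := 1 + 2 * lam * D with hB
  have hB0 : 0 ≤ B := by positivity
  set g : ℕ → ℝ := fun r => if h : r < k then (if (⟨r, h⟩ : Fin k) ∈ i.forb G v x then B else -1)
    else 0 with hg
  have hle : ∀ r, costChange G adj lam i x r ≤ g r := by
    intro r
    have hmove : i.move G adj x r = i.add G v x r := by simp [move, hs, hv, ht]
    unfold costChange
    rw [hmove]
    unfold add
    simp only [hg]
    split_ifs with h1 h2 h3 h3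
    · simpa [apply] using hB0
    · exact absurd (mem_forb.2 (Or.inl h2)) h3
    · split
      · rename_i u hf
        have hu := (first_eq_some.1 hf).1
        have := cost_collapse hlam hD (e := ⟨r, h1⟩) hu hu
        simp only [hv, reduceCtorEq, if_false, if_true] at this
        simp only [hB]
        linarith
      · have := cost_activate (G := G) hlam hs (by simp [hv])
        simp only
        linarith
    · split
      · rename_i u hf
        obtain ⟨hu, he, -⟩ := first_eq_some.1 hf
        rw [mem_actNb] at hu
        exact absurd (mem_forb.2 (Or.inr ⟨u, hu.1, hu.2, he⟩)) h3
      · have := cost_activate (G := G) hlam hs (by simp [hv])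
        simp only
        linarith
    · simp [apply]
  have hsum : ∑ r ∈ Finset.range M, g r = ∑ r ∈ Finset.range k, g r := by
    refine (Finset.sum_subset (Finset.range_mono hkM) fun r _ hr => ?_).symm
    simp only [Finset.mem_range] at hr
    simp [hg, hr]
  have hsum' : ∑ r ∈ Finset.range k, g r
      = (i.forb G v x).card * B + -((i.forb G v x)ᶜ.card : ℝ) := by
    rw [Finset.sum_range]
    have : ∀ r : Fin k, g r = if r ∈ i.forb G v x then B else -1 := fun r => by simp [hg]
    rw [Finset.sum_congr rfl fun r _ => this r, Finset.sum_ite]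
    simp [Finset.compl_eq_univ_sdiff, Finset.filter_not]
  have h1 : (i.forb G v x).card ≤ D := by
    have := card_forb_add (G := G) i v x
    have := load_le hD i v
    omega
  have h2 := Finset.card_add_card_compl (i.forb G v x)
  rw [Fintype.card_fin] at h2
  have h1' : ((i.forb G v x).card : ℝ) ≤ D := by exact_mod_cast h1
  have h2' : ((i.forb G v x).card : ℝ) + ((i.forb G v x)ᶜ.card : ℝ) = k := by exact_mod_cast h2
  calc _ ≤ ∑ r ∈ Finset.range M, g r := Finset.sum_le_sum fun r _ => hle r
    _ = (i.forb G v x).card * B + -((i.forb G v x)ᶜ.card : ℝ) := by rw [hsum, hsum']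
    _ ≤ _ := by
      have := mul_le_mul_of_nonneg_right h1' hB0
      linarith

open Classical in
/-- The drift of attempts to remove a restriction, for a given coloring.  The random numbers
`1, …, k - load` remove a restriction; the random number `0` may lead to a collapse of `z` with one
neighbor if that has the color `c`, and with two neighbors if the rank of the color of `z` is to be
discarded. -/
theorem sum_costChange_resolve_le (hlam : 0 ≤ lam) (hD : DegLE G D) (hkM : k ≤ M)
    {l : List (Fin n)} {c : Fin k} (hs : i.stk = v :: l) (hv : i.pin v = some c)
    (ht : i.target G v = some z) (x : Fin n → Fin k) (hL : i.load G z ≤ k) :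
    ∑ r ∈ Finset.range M, costChange G adj lam i x r
      ≤ -(lam * (k - i.load G z)) + (2 + lam * (2 * D - 1)) *
          (if ∃ w ∈ i.actNb G z, x w = c then 1 else 0)
        + (3 + lam * (3 * D - 1)) * (if k ≤ i.rank G z x (x z) + i.load G z then 1 else 0) := by
  have hkn := known_of_target hv ht
  have ht' := target_eq_some.1 ht
  have hz := (mem_actNb.1 ht'.1).2
  have hload : 0 < i.load G z :=
    Nat.add_pos_left (Finset.card_pos.2 ⟨c, mem_known.2 hkn⟩) _
  have hD1 : (1 : ℝ) ≤ D := by exact_mod_cast hload.trans_le (load_le hD i z)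
  have hlD := mul_le_mul_of_nonneg_left hD1 hlam
  set B₁ : ℝ := 2 + lam * (2 * D - 1) with hB₁
  set B₂ : ℝ := 3 + lam * (3 * D - 1) with hB₂
  have hB₁0 : 0 ≤ B₁ := by rw [hB₁]; nlinarith
  have hB₂0 : 0 ≤ B₂ := by rw [hB₂]; nlinarith
  set E : ℝ := B₁ * (if ∃ w ∈ i.actNb G z, x w = c then 1 else 0)
        + B₂ * (if k ≤ i.rank G z x (x z) + i.load G z then 1 else 0) with hE
  have hE0 : 0 ≤ E := by
    rw [hE]
    refine add_nonneg (mul_nonneg hB₁0 ?_) (mul_nonneg hB₂0 ?_) <;> split_ifs <;> norm_num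
  have hrel := cost_release (G := G) hlam hs (by simp [hv]) (mem_actNb.1 ht'.1).1 ht'.2.1
  have hmove : ∀ r, i.move G adj x r = i.resolve G adj v c z x r :=
    fun r => by simp [move, hs, hv, ht]
  have hle : ∀ r, costChange G adj lam i x r ≤
      (if r ∈ Finset.Ioc 0 (k - i.load G z) then -lam else 0) + if r = 0 then E else 0 := by
    intro r
    unfold costChange
    rw [hmove]
    unfold resolve
    by_cases hr : r = 0
    · subst hr
      simp only [Finset.mem_Ioc, lt_irrefl, false_and, if_false, zero_add, if_true]
      split_ifs with h1 h2 h3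
      · simpa [apply] using hE0
      · simp only
        linarith
      · split
        · rename_i u hf
          obtain ⟨hu, he, -⟩ := first_eq_some.1 hf
          have := cost_collapse hlam hD (e := c) hu hu
          simp only [hz, if_true] at this
          have hex : ∃ w ∈ i.actNb G z, x w = c := ⟨u, hu, he⟩
          have h4 : ¬ k ≤ i.rank G z x (x z) + i.load G z := by omega
          rw [hE, if_pos hex, if_neg h4, hB₁]
          simp only
          linarith
        · simp only
          linarith
      · have h4 : k ≤ i.rank G z x (x z) + i.load G z := by omega
        have hE' : B₂ ≤ E := by
          rw [hE, if_pos h4]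
          have : 0 ≤ B₁ * (if ∃ w ∈ i.actNb G z, x w = c then 1 else 0) := by
            refine mul_nonneg hB₁0 ?_
            split_ifs <;> norm_num
          linarith
        split
        · rename_i b hb
          have hb := List.mem_of_getElem? hb
          simp only [List.mem_filter, decide_eq_true_eq] at hb
          split
          · rename_i a hf
            have := cost_collapse hlam hD (e := x b) (first_eq_some.1 hf).1 hb.2.1
            simp only [hz, if_true] at this
            have h5 : (if a = b then 0 else 1 + lam * D) ≤ 1 + lam * (D : ℝ) := by
              split_ifs
              · positivity
              · exact le_rfl
            simp only
            linarith
          · simpa [apply] using hE0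
        · simpa [apply] using hE0
    · simp only [hr, if_false, add_zero]
      split_ifs with h1 h2 h3 h4 h4
      · rw [Finset.mem_Ioc] at h2
        omega
      · simp [apply]
      · simp only
        linarith
      · rw [Finset.mem_Ioc] at h4
        omega
      · simp at h3
        exact absurd h3.1 hr
      · simp at h3
        exact absurd h3.1 hr
      · simp at h3
        exact absurd h3.1 hr
      · simp at h3
        exact absurd h3.1 hr
  refine (Finset.sum_le_sum fun r _ => hle r).trans (le_of_eq ?_)
  rw [Finset.sum_add_distrib, Finset.sum_ite_mem, Finset.sum_ite_eq' (Finset.range M),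
    if_pos (Finset.mem_range.2 (c.pos.trans_le hkM)), Finset.sum_const]
  have : Finset.range M ∩ Finset.Ioc 0 (k - i.load G z) = Finset.Ioc 0 (k - i.load G z) := by
    refine Finset.inter_eq_right.2 fun r hr => ?_
    rw [Finset.mem_Ioc] at hr
    rw [Finset.mem_range]
    omega
  rw [this, Nat.card_Ioc, Nat.sub_zero, nsmul_eq_mul, Nat.cast_sub hL, hE]
  ring

/-- The drift of attempts to remove a restriction. -/
theorem sum_costChange_resolve (hlam : 0 ≤ lam) (hD : DegLE G D) (hDk : D < k) (hkM : k ≤ M)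
    {l : List (Fin n)} {c : Fin k} (hs : i.stk = v :: l) (hv : i.pin v = some c)
    (ht : i.target G v = some z) :
    ∑ x ∈ i.sats G, ∑ r ∈ Finset.range M, costChange G adj lam i x r
      ≤ (-(lam * (k - D)) + (2 + lam * (2 * D - 1)) * ((D - 1) / (k - D))
        + (3 + lam * (3 * D - 1)) * (D * (D - 1) / (2 * (k - D) ^ 2))) * (i.sats G).card := by
  classical
  have hkn := known_of_target hv ht
  have hz := (mem_actNb.1 (target_eq_some.1 ht).1).2
  have hLD := load_le hD i z
  have hload : 0 < i.load G z :=
    Nat.add_pos_left (Finset.card_pos.2 ⟨c, mem_known.2 hkn⟩) _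
  have hD1 : 1 ≤ D := hload.trans_le hLD
  have hD1' : (1 : ℝ) ≤ D := by exact_mod_cast hD1
  have hlD := mul_le_mul_of_nonneg_left hD1' hlam
  have hB₁0 : 0 ≤ 2 + lam * (2 * D - 1) := by nlinarith
  have hB₂0 : 0 ≤ 3 + lam * (3 * D - 1) := by nlinarith
  have h1 := card_mul_le_of_nb hD hkn
  have h2 := card_mul_le_of_rank hz (hLD.trans hDk.le)
  have h3 := sum_coincides_le hD hkn
  refine (Finset.sum_le_sum fun x _ => sum_costChange_resolve_le hlam hD hkM hs hv ht x
    (hLD.trans hDk.le)).trans ?_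
  rw [Finset.sum_add_distrib, Finset.sum_add_distrib, ← Finset.mul_sum, ← Finset.mul_sum,
    Finset.sum_const, nsmul_eq_mul, Finset.sum_boole, Finset.sum_boole]
  set S := (i.sats G).card
  set T₁ := ((i.sats G).filter fun x => ∃ w ∈ i.actNb G z, x w = c).card
  set T₂ := ((i.sats G).filter fun x => k ≤ i.rank G z x (x z) + i.load G z).card
  set C := ∑ x ∈ i.sats G, ((i.actNb G z).filter (i.Coincides G z x)).card
  have hq : (0 : ℝ) < k - D := by
    have : (D : ℝ) < k := by exact_mod_cast hDk
    linarith
  have h1' : ((k : ℝ) - D) * T₁ ≤ (D - 1) * S := by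
    have : (((k - D) * T₁ : ℕ) : ℝ) ≤ (((D - 1) * S : ℕ) : ℝ) := by exact_mod_cast h1
    rwa [Nat.cast_mul, Nat.cast_mul, Nat.cast_sub hDk.le, Nat.cast_sub hD1, Nat.cast_one] at this
  have h2' : 2 * ((k : ℝ) - D) ^ 2 * T₂ ≤ D * (D - 1) * S := by
    have h4 : 2 * (k - D) * ((k - D) * T₂) ≤ D * (D - 1) * S := by
      refine le_trans (Nat.mul_le_mul_left _ (le_trans ?_ h2)) h3
      exact Nat.mul_le_mul_right _ (by omega)
    have : ((2 * (k - D) * ((k - D) * T₂) : ℕ) : ℝ) ≤ ((D * (D - 1) * S : ℕ) : ℝ) := by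
      exact_mod_cast h4
    rw [Nat.cast_mul, Nat.cast_mul, Nat.cast_mul, Nat.cast_mul, Nat.cast_mul, Nat.cast_sub hDk.le,
      Nat.cast_sub hD1, Nat.cast_one, Nat.cast_ofNat] at this
    nlinarith
  have h1'' : (T₁ : ℝ) ≤ (D - 1) / (k - D) * S := by
    rw [div_mul_eq_mul_div, le_div_iff₀ hq]
    linarith
  have h2'' : (T₂ : ℝ) ≤ D * (D - 1) / (2 * (k - D) ^ 2) * S := by
    rw [div_mul_eq_mul_div, le_div_iff₀ (by positivity)]
    linarith
  have h5 : (i.load G z : ℝ) ≤ D := by exact_mod_cast hLD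
  have h6 := mul_le_mul_of_nonneg_left h1'' hB₁0
  have h7 := mul_le_mul_of_nonneg_left h2'' hB₂0
  have h8 : lam * (k - D) ≤ lam * (k - i.load G z) :=
    mul_le_mul_of_nonneg_left (by linarith) hlam
  have h9 := mul_le_mul_of_nonneg_right h8 (Nat.cast_nonneg (α := ℝ) S)
  nlinarith

/-- Weights of the potential for which its drift is negative. -/
theorem exists_drift_constants {D k : ℕ} (h : (k : ℝ) > 3.637 * D + 1) :
    ∃ lam δ : ℝ, 0 ≤ lam ∧ 0 < δ ∧
      -((k : ℝ) - D) + D * (1 + 2 * lam * D) ≤ -δ ∧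
      (1 ≤ D → -(lam * ((k : ℝ) - D)) + (2 + lam * (2 * D - 1)) * ((D - 1) / (k - D))
        + (3 + lam * (3 * D - 1)) * (D * (D - 1) / (2 * (k - D) ^ 2)) ≤ -δ) := by
  rcases Nat.eq_zero_or_pos D with rfl | hD
  · refine ⟨0, 1, le_rfl, one_pos, ?_, by simp⟩
    norm_num at h ⊢
    exact_mod_cast h.le
  · have hD' : (1 : ℝ) ≤ D := by exact_mod_cast hD
    have hD0 : (0 : ℝ) < D := by linarith
    -- With the weight `0.8 / D`, activation needs `k - D > 2.6 * D`.  For the removal of a restriction,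
    -- the gain is then at least `0.8 * 2.6 = 2.08`, and the loss is at most
    -- `3.6 / 2.6 + 5.4 / 13.52 < 1.79`, where `13.52 = 2 * 2.6 ^ 2`.
    refine ⟨0.8 / D, 0.01, by positivity, by norm_num, ?_, fun _ => ?_⟩
    · have e : 2 * (0.8 / (D : ℝ)) * D = 1.6 := by
        field_simp
        norm_num
      rw [e]
      norm_num at h ⊢
      linarith
    · have hq : 2.6 * (D : ℝ) ≤ k - D := by
        norm_num at h ⊢
        linarith
      have hq0 : (0 : ℝ) < k - D := by linarith
      have h1 : 2.08 ≤ 0.8 / (D : ℝ) * (k - D) := by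
        rw [div_mul_eq_mul_div, le_div_iff₀ hD0]
        linarith
      have h2 : 2 + 0.8 / (D : ℝ) * (2 * D - 1) ≤ 3.6 := by
        have : 0.8 / (D : ℝ) * (2 * D - 1) = 1.6 - 0.8 / D := by field_simp; ring
        have : 0 ≤ 0.8 / (D : ℝ) := by positivity
        linarith
      have h3 : 3 + 0.8 / (D : ℝ) * (3 * D - 1) ≤ 5.4 := by
        have : 0.8 / (D : ℝ) * (3 * D - 1) = 2.4 - 0.8 / D := by field_simp; ring
        have : 0 ≤ 0.8 / (D : ℝ) := by positivity
        linarith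
      have h4 : ((D : ℝ) - 1) / (k - D) ≤ 1 / 2.6 := by
        rw [div_le_div_iff₀ hq0 (by norm_num)]
        linarith
      have h5 : (D : ℝ) * (D - 1) / (2 * (k - D) ^ 2) ≤ 1 / 13.52 := by
        rw [div_le_div_iff₀ (by positivity) (by norm_num)]
        nlinarith
      have h4' : 0 ≤ ((D : ℝ) - 1) / (k - D) := div_nonneg (by linarith) hq0.le
      have h5' : 0 ≤ (D : ℝ) * (D - 1) / (2 * (k - D) ^ 2) :=
        div_nonneg (mul_nonneg hD0.le (by linarith)) (by positivity)
      have h6 := mul_le_mul h2 h4 h4' (by norm_num)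
      have h7 := mul_le_mul h3 h5 h5' (by norm_num)
      norm_num at h6 h7 ⊢
      linarith

/-- The expected number of steps of the recycler is linear. -/
theorem exists_tsum_runningProb_le {D k : ℕ} (h : (k : ℝ) > 3.637 * D + 1) :
    ∃ b : ℝ≥0, ∀ (n : ℕ) (G : SimpleGraph (Fin n)) (adj : Fin n → List (Fin n))
      (hadj : IsAdjacencyList G adj) (hk : 0 < k), DegLE G D →
      ∑' t, (recycler G adj hadj hk).runningProb t ≤ b * n := by
  obtain ⟨lam, δ, hlam, hδ, hA, hB⟩ := exists_drift_constants h
  have hDk : D < k := by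
    have h1 : (0 : ℝ) ≤ D := Nat.cast_nonneg D
    have : (D : ℝ) < k := by
      norm_num at h
      linarith
    exact_mod_cast this
  set M := 2 ^ bits k with hM
  have hkM : k ≤ M := le_two_pow_bits k
  have hM0 : (0 : ℝ) < M := by rw [hM]; positivity
  -- the potential starts at `n`, and each of the `M` random numbers has probability `1 / M`
  refine ⟨(M / δ).toNNReal, fun n G adj hadj hk hD => ?_⟩
  have hdrift : ∀ i : Idx n k, i.Valid → ¬ i.Done →
      ∑ x ∈ i.sats G, ∑ r ∈ Finset.range M, costChange G adj lam i x r
        ≤ -δ * (i.sats G).card := by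
    intro i hi hd
    obtain ⟨v, l, hs⟩ := List.exists_cons_of_ne_nil (hi.ne_nil hd)
    have hv : i.pin v ≠ none := (hi.2 v).1 (by simp [hs])
    obtain ⟨c, hv⟩ := Option.ne_none_iff_exists'.1 hv
    cases ht : i.target G v with
    | none =>
      refine (Finset.sum_le_sum fun x _ =>
        (sum_costChange_add hlam hD hkM hs hv ht x).trans hA).trans (le_of_eq ?_)
      rw [Finset.sum_const, nsmul_eq_mul]
      ring
    | some z =>
      refine (sum_costChange_resolve hlam hD hDk hkM hs hv ht).trans ?_
      refine mul_le_mul_of_nonneg_right (hB ?_) (Nat.cast_nonneg _)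
      have h1 := load_le hD i z
      have h2 : 0 < i.load G z :=
        Nat.add_pos_left (Finset.card_pos.2 ⟨c, mem_known.2 (known_of_target hv ht)⟩) _
      omega
  have hmain := (recycler G adj hadj hk).tsum_runningProb_le (fun i => Valid i)
    (fun t s hs => (mem_support_lawAt hs).1) (fun i => ENNReal.ofReal (cost G lam i))
    (ENNReal.ofReal (δ / M)) ?_
  · have h1 : ENNReal.ofReal (cost G lam (initial n hk)) = n := by
      rw [cost_initial, ENNReal.ofReal_natCast]
    have h2 : ENNReal.ofReal (δ / M) ≠ 0 := by
      rw [Ne, ENNReal.ofReal_eq_zero, not_le]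
      positivity
    have h3 : (((M / δ).toNNReal : ℝ≥0) : ℝ≥0∞) = (ENNReal.ofReal (δ / M))⁻¹ := by
      rw [← ENNReal.ofReal_inv_of_pos (by positivity), inv_div]
      rfl
    rw [h3, mul_comm, ← div_eq_mul_inv, ENNReal.le_div_iff_mul_le (Or.inl h2)
      (Or.inl ENNReal.ofReal_ne_top), ← h1]
    exact hmain
  · intro (i : Idx n k) hi hd
    have hsum : ∀ f : (Fin n → Fin k) → ℝ≥0∞,
        ∑ x, (weight G i x : ℝ≥0∞) * f x = ∑ x ∈ i.sats G, f x := by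
      classical
      intro f
      rw [sats, Finset.sum_filter]
      refine Finset.sum_congr rfl fun x _ => ?_
      by_cases hx : i.Sat G x <;> simp [weight, hx]
    have hstep : ∀ x, ∑' s, (recycler G adj hadj hk).step (x, i) s * ENNReal.ofReal (cost G lam s.2)
        = ENNReal.ofReal ((M : ℝ)⁻¹ * ∑ r ∈ Finset.range M,
            cost G lam (i.apply (i.move G adj x r).1)) := by
      intro x
      have := tsum_stepLaw_mul (G := G) (adj := adj) (x, i) fun s => ENNReal.ofReal (cost G lam s.2)
      refine this.trans ?_
      rw [ENNReal.ofReal_mul (by positivity), ENNReal.ofReal_inv_of_pos hM0,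
        ENNReal.ofReal_sum_of_nonneg fun r _ => cost_nonneg hlam]
      simp [hM, next]
    have hd' := hdrift i hi hd
    change ∑ x, (weight G i x : ℝ≥0∞) * _ ≤ ∑ x, (weight G i x : ℝ≥0∞) * _
    rw [hsum, hsum]
    simp only [hstep]
    have hnn : ∀ x, 0 ≤ (M : ℝ)⁻¹ * ∑ r ∈ Finset.range M,
        cost G lam (i.apply (i.move G adj x r).1) := fun x =>
      mul_nonneg (by positivity) (Finset.sum_nonneg fun r _ => cost_nonneg hlam)
    rw [Finset.sum_congr rfl fun x _ => (ENNReal.ofReal_add (hnn x) (by positivity)).symm,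
      ← ENNReal.ofReal_sum_of_nonneg fun x _ => add_nonneg (hnn x) (by positivity),
      ← ENNReal.ofReal_sum_of_nonneg fun x _ => cost_nonneg hlam]
    refine ENNReal.ofReal_le_ofReal ?_
    simp only [costChange, Finset.sum_sub_distrib, Finset.sum_const, Finset.card_range,
      nsmul_eq_mul] at hd'
    rw [Finset.sum_add_distrib, ← Finset.mul_sum, Finset.sum_const, Finset.sum_const, nsmul_eq_mul,
      nsmul_eq_mul]
    have h4 : (M : ℝ) * ((M : ℝ)⁻¹ * ∑ x ∈ i.sats G, ∑ r ∈ Finset.range M,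
        cost G lam (i.apply (i.move G adj x r).1) + (i.sats G).card * (δ / M))
        ≤ M * ((i.sats G).card * cost G lam i) := by
      rw [mul_add, ← mul_assoc, mul_inv_cancel₀ hM0.ne', one_mul]
      have : (M : ℝ) * ((i.sats G).card * (δ / M)) = δ * (i.sats G).card := by
        field_simp
      rw [this]
      linarith
    exact le_of_mul_le_mul_left h4 hM0

/-- All `n` nodes start inactive and at most one becomes active per step, so that the recycler runs
for at least `n` steps. -/
theorem le_tsum_runningProb (hadj : IsAdjacencyList G adj) (hk : 0 < k) :
    (n : ℝ≥0∞) ≤ ∑' t, (recycler G adj hadj hk).runningProb t := by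
  have h1 : ∀ t ∈ Finset.range n, (recycler G adj hadj hk).runningProb t = 1 := by
    intro t ht
    rw [RandomnessRecycler.runningProb, PMF.toOuterMeasure_apply_eq_one_iff]
    intro s hs hd
    have h2 := (mem_support_lawAt hs).2
    have hd : s.2.Done := hd
    rw [hd.1] at h2
    rw [Finset.mem_range] at ht
    simp at h2
    omega
  calc (n : ℝ≥0∞) = ∑ t ∈ Finset.range n, (recycler G adj hadj hk).runningProb t := by
        rw [Finset.sum_congr rfl h1]
        simp
    _ ≤ _ := ENNReal.sum_le_tsum _

end Idx

/-! ### Programs without randomness -/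

/-- Set variable `x` to `v`. -/
def Store.setVar (s : Store) (x v : ℕ) : Store := ⟨Function.update s.var x v, s.arr⟩

/-- Set cell `j` of array `a` to `v`. -/
def Store.setArr (s : Store) (a j v : ℕ) : Store :=
  ⟨s.var, Function.update s.arr a (Function.update (s.arr a) j v)⟩

@[simp] theorem Store.setVar_var (s : Store) (x v y : ℕ) :
    (s.setVar x v).var y = if y = x then v else s.var y := by
  simp [Store.setVar, Function.update_apply]

@[simp] theorem Store.setVar_arr (s : Store) (x v : ℕ) : (s.setVar x v).arr = s.arr := rfl

@[simp] theorem Store.setArr_var (s : Store) (a j v : ℕ) : (s.setArr a j v).var = s.var := rfl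

@[simp] theorem Store.setArr_arr (s : Store) (a j v b l : ℕ) :
    (s.setArr a j v).arr b l = if b = a ∧ l = j then v else s.arr b l := by
  by_cases h : b = a
  · subst h
    simp [Store.setArr, Function.update_apply]
  · simp [Store.setArr, h]

namespace Cmd

/-- The command does not use randomness. -/
def Det : Cmd → Prop
  | skip => True
  | set _ _ => True
  | put _ _ _ => True
  | rand _ _ => False
  | seq c d => c.Det ∧ d.Det
  | ite _ c d => c.Det ∧ d.Det
  | loop _ c => c.Det

/-- The effect of a command that does not use randomness.  On `rand` the value is irrelevant. -/
def run (w : ℕ) : Cmd → Store → Store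
  | skip, s => s
  | set x e, s => s.setVar x (e.eval w s)
  | put a e f, s => s.setArr a (e.eval w s) (f.eval w s)
  | rand _ _, s => s
  | seq c d, s => d.run w (c.run w s)
  | ite e c d, s => if e.eval w s ≠ 0 then c.run w s else d.run w s
  | loop e c, s => (c.run w)^[e.eval w s] s

/-- The running time of a command that does not use randomness. -/
def dur (w : ℕ) : Cmd → Store → ℕ
  | skip, _ => 0
  | set _ e, _ => e.cost + 1
  | put _ e f, _ => e.cost + f.cost + 1
  | rand _ _, _ => 0
  | seq c d, s => c.dur w s + d.dur w (c.run w s)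
  | ite e c d, s => e.cost + 1 + if e.eval w s ≠ 0 then c.dur w s else d.dur w s
  | loop e c, s =>
    e.cost + 1 + ∑ j ∈ Finset.range (e.eval w s), (1 + c.dur w ((c.run w)^[j] s))

/-- A command without randomness is executed deterministically. -/
theorem exec_eq (w : ℕ) (c : Cmd) (hc : c.Det) (z : Config) :
    c.exec w z = PMF.pure ⟨c.run w z.store, z.time + c.dur w z.store, z.bits⟩ := by
  induction c generalizing z with
  | skip => rfl
  | set x e => simp [exec, run, dur, Config.tick, Config.setVar, Store.setVar]
  | put a e f => simp [exec, run, dur, Config.tick, Config.setArr, Store.setArr]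
  | rand x e => exact absurd hc id
  | seq c d ihc ihd =>
    rw [exec, ihc hc.1, PMF.pure_bind, ihd hc.2]
    simp [run, dur, add_assoc]
  | ite e c d ihc ihd =>
    rw [exec]
    by_cases h : e.eval w z.store = 0
    · simp [h, ihd hc.2, run, dur, Config.tick, add_assoc]
    · simp [h, ihc hc.1, run, dur, Config.tick, add_assoc]
  | loop e c ih =>
    have key : ∀ (m : ℕ) (z : Config), repeatCmd (c.exec w) m z = PMF.pure
        ⟨(c.run w)^[m] z.store,
          z.time + ∑ j ∈ Finset.range m, (1 + c.dur w ((c.run w)^[j] z.store)), z.bits⟩ := by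
      intro m
      induction m with
      | zero => intro z; rfl
      | succ m ihm =>
        intro z
        rw [repeatCmd, ih hc, PMF.pure_bind, ihm, Finset.sum_range_succ']
        simp only [Config.tick, Function.iterate_succ, Function.comp, Function.iterate_zero, id]
        congr 2
        omega
    rw [exec, key]
    simp [run, dur, Config.tick, add_assoc]

/-- The variable `x` is not assigned by the command. -/
def KeepsVar (x : ℕ) : Cmd → Prop
  | skip => True
  | set y _ => x ≠ y
  | put _ _ _ => True
  | rand y _ => x ≠ y
  | seq c d => c.KeepsVar x ∧ d.KeepsVar x
  | ite _ c d => c.KeepsVar x ∧ d.KeepsVar x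
  | loop _ c => c.KeepsVar x

/-- The command does not write into the array `a`. -/
def KeepsArr (a : ℕ) : Cmd → Prop
  | skip => True
  | set _ _ => True
  | put b _ _ => a ≠ b
  | rand _ _ => True
  | seq c d => c.KeepsArr a ∧ d.KeepsArr a
  | ite _ c d => c.KeepsArr a ∧ d.KeepsArr a
  | loop _ c => c.KeepsArr a

theorem run_var (w : ℕ) {c : Cmd} {x : ℕ} (h : c.KeepsVar x) (s : Store) :
    (c.run w s).var x = s.var x := by
  induction c generalizing s with
  | skip => rfl
  | set y e => simp [run, show x ≠ y from h]
  | put a e f => rfl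
  | rand y e => rfl
  | seq c d ihc ihd => rw [run, ihd h.2, ihc h.1]
  | ite e c d ihc ihd =>
    rw [run]
    split_ifs
    · exact ihc h.1 s
    · exact ihd h.2 s
  | loop e c ih =>
    rw [run]
    generalize e.eval w s = m
    induction m with
    | zero => rfl
    | succ m ihm => rw [Function.iterate_succ_apply', ih h, ihm]

theorem run_arr (w : ℕ) {c : Cmd} {a : ℕ} (h : c.KeepsArr a) (s : Store) :
    (c.run w s).arr a = s.arr a := by
  induction c generalizing s with
  | skip => rfl
  | set y e => rfl
  | put b e f =>
    funext l
    simp [run, show a ≠ b from h]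
  | rand y e => rfl
  | seq c d ihc ihd => rw [run, ihd h.2, ihc h.1]
  | ite e c d ihc ihd =>
    rw [run]
    split_ifs
    · exact ihc h.1 s
    · exact ihd h.2 s
  | loop e c ih =>
    rw [run]
    generalize e.eval w s = m
    induction m with
    | zero => rfl
    | succ m ihm => rw [Function.iterate_succ_apply', ih h, ihm]

/-- A bound for the running time of commands without loops. -/
def cost : Cmd → ℕ
  | skip => 0
  | set _ e => e.cost + 1
  | put _ e f => e.cost + f.cost + 1
  | rand _ _ => 0
  | seq c d => c.cost + d.cost
  | ite e c d => e.cost + 1 + (c.cost + d.cost)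
  | loop _ _ => 0

/-- The command has no loops. -/
def Flat : Cmd → Prop
  | seq c d => c.Flat ∧ d.Flat
  | ite _ c d => c.Flat ∧ d.Flat
  | loop _ _ => False
  | _ => True

theorem Flat.dur_le {w : ℕ} {c : Cmd} (h : c.Flat) (s : Store) : c.dur w s ≤ c.cost := by
  induction c generalizing s with
  | skip => exact le_rfl
  | set y e => exact le_rfl
  | put b e f => exact le_rfl
  | rand y e => exact le_rfl
  | seq c d ihc ihd => exact Nat.add_le_add (ihc h.1 s) (ihd h.2 _)
  | ite e c d ihc ihd =>
    rw [dur, cost]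
    have h1 := ihc h.1 s
    have h2 := ihd h.2 s
    split_ifs <;> omega
  | loop e c ih => exact absurd h id

/-- The command takes time at most `T` from the store `s` and leads to a store with property `Q`. -/
def Does (w : ℕ) (c : Cmd) (s : Store) (T : ℕ) (Q : Store → Prop) : Prop :=
  Q (c.run w s) ∧ c.dur w s ≤ T

theorem Does.mono {w : ℕ} {c : Cmd} {s : Store} {T T' : ℕ} {Q Q' : Store → Prop}
    (h : c.Does w s T Q) (hT : T ≤ T') (hQ : Q (c.run w s) → Q' (c.run w s)) : c.Does w s T' Q' :=
  ⟨hQ h.1, h.2.trans hT⟩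

theorem Does.le {w : ℕ} {c : Cmd} {s : Store} {T T' : ℕ} {Q : Store → Prop}
    (h : c.Does w s T Q) (hT : T ≤ T') : c.Does w s T' Q :=
  ⟨h.1, h.2.trans hT⟩

theorem Does.seq {w : ℕ} {c d : Cmd} {s : Store} {T T' : ℕ} {Q Q' : Store → Prop}
    (h : c.Does w s T Q) (h' : Q (c.run w s) → d.Does w (c.run w s) T' Q') :
    (c.seq d).Does w s (T + T') Q' :=
  ⟨(h' h.1).1, Nat.add_le_add h.2 (h' h.1).2⟩

theorem Does.ite_pos {w : ℕ} {c d : Cmd} {e : Expr} {s : Store} {T : ℕ} {Q : Store → Prop}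
    (he : e.eval w s ≠ 0) (h : c.Does w s T Q) : (Cmd.ite e c d).Does w s (e.cost + 1 + T) Q := by
  unfold Does at *
  rw [run, dur, if_pos he, if_pos he]
  exact ⟨h.1, by omega⟩

theorem Does.ite_neg {w : ℕ} {c d : Cmd} {e : Expr} {s : Store} {T : ℕ} {Q : Store → Prop}
    (he : e.eval w s = 0) (h : d.Does w s T Q) : (Cmd.ite e c d).Does w s (e.cost + 1 + T) Q := by
  unfold Does at *
  rw [run, dur, if_neg (not_not.2 he), if_neg (not_not.2 he)]
  exact ⟨h.1, by omega⟩

theorem does_skip {w : ℕ} {s : Store} {Q : Store → Prop} (hQ : Q s) : skip.Does w s 0 Q :=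
  ⟨hQ, le_rfl⟩

end Cmd

/-! ### Loops over the neighbors of a node -/

section Input

variable {n : ℕ} (adj : Fin n → List (Fin n))

/-- The position in array `2` at which the list of node `j` starts. -/
def offset (j : ℕ) : ℕ := ((List.ofFn adj).take j).flatten.length

theorem offset_succ (v : Fin n) : offset adj (v + 1) = offset adj v + (adj v).length := by
  have h : (v : ℕ) < (List.ofFn adj).length := by simp
  rw [offset, List.take_succ_eq_append_getElem h]
  simp [offset]

theorem offset_le {D : ℕ} (hD : ∀ v, (adj v).length ≤ D) (j : ℕ) : offset adj j ≤ n * D := by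
  rw [offset, List.length_flatten]
  calc _ ≤ (((List.ofFn adj).take j).map List.length).length * D := by
        rw [← smul_eq_mul]
        refine List.sum_le_card_nsmul _ _ fun a ha => ?_
        obtain ⟨l, hl, rfl⟩ := List.mem_map.1 ha
        obtain ⟨v, rfl⟩ := (List.mem_ofFn' _ _).1 (List.mem_of_mem_take hl)
        exact hD v
    _ ≤ n * D := Nat.mul_le_mul_right _ (by simp)

/-- The neighbors of `v` are found in the input from position `offset adj v` on. -/
theorem getD_flatten (v : Fin n) (j : ℕ) (hj : j < (adj v).length) :
    ((List.ofFn adj).flatten.map Fin.val).getD (offset adj v + j) 0 = ((adj v)[j] : Fin n) := by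
  have h : (v : ℕ) < (List.ofFn adj).length := by simp
  have h1 : (List.ofFn adj).flatten = ((List.ofFn adj).take v).flatten ++
      (adj v ++ ((List.ofFn adj).drop (v + 1)).flatten) := by
    conv_lhs => rw [← List.take_append_drop v (List.ofFn adj), List.drop_eq_getElem_cons h]
    simp
  rw [List.getD_eq_getElem?_getD, List.getElem?_map, h1,
    List.getElem?_append_right (by simp only [offset, Nat.le_add_right]),
    show offset adj v + j - ((List.ofFn adj).take v).flatten.length = j from
      Nat.add_sub_cancel_left _ _,
    List.getElem?_append_left hj, List.getElem?_eq_getElem hj]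
  rfl

end Input

namespace Program

/-- For all neighbors `u` of the node in variable `q`: set variable `9` to `u` and run `c`.
Variable `8` is the position in the array of neighbors. -/
def forNb (q : ℕ) (c : Cmd) : Cmd :=
  (Cmd.set 8 (.get 1 (.var q))).seq
    (.loop (.op .sub (.get 1 (.op .add (.var q) (.const 1))) (.get 1 (.var q)))
      ((Cmd.set 9 (.get 2 (.var 8))).seq
        ((Cmd.set 8 (.op .add (.var 8) (.const 1))).seq c)))

/-- The words are long enough for the numbers that occur. -/
structure Fits (n k w : ℕ) (adj : Fin n → List (Fin n)) : Prop where
  small : 4 * (n + k) + 8 < 2 ^ w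
  offset : ∀ j, offset adj j + 1 < 2 ^ w

/-- The graph is in its place. -/
structure HasGraph {n : ℕ} (adj : Fin n → List (Fin n)) (s : Store) : Prop where
  off : ∀ j, s.arr 1 j = offset adj j
  nb : ∀ v : Fin n, ∀ j, (hj : j < (adj v).length) → s.arr 2 (offset adj v + j) = (adj v)[j]

/-- The rule for `forNb`, with an invariant `I` that depends on the list of neighbors that have been
processed. -/
theorem forNb_does {n k w q : ℕ} {adj : Fin n → List (Fin n)} (hw : Fits n k w adj) {c : Cmd}
    (hc : c.Flat) (hc2 : c.KeepsArr 2) (hc8 : c.KeepsVar 8)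
    (I : List (Fin n) → Store → Prop) {s : Store} (hs : HasGraph adj s) (v : Fin n)
    (hv : s.var q = v) (hq8 : q ≠ 8) (h0 : I [] s)
    (hI : ∀ l s a b, I l s → I l ((s.setVar 9 a).setVar 8 b))
    (hstep : ∀ l (u : Fin n) s', l ++ [u] <+: adj v → s'.var 9 = (u : ℕ) →
      (∀ x, c.KeepsVar x → x ≠ 8 → x ≠ 9 → s'.var x = s.var x) →
      (∀ a, c.KeepsArr a → s'.arr a = s.arr a) → I l s' → I (l ++ [u]) (c.run w s')) :
    (forNb q c).Does w s (20 + (adj v).length * (c.cost + 9)) fun s' => I (adj v) s' := by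
  have h1 : 1 < 2 ^ w := by have := hw.small; omega
  have hq1 : (s.var q + 1) % 2 ^ w = v + 1 := by
    rw [hv]
    exact Nat.mod_eq_of_lt (by have := hw.small; have := v.2; omega)
  set body := ((Cmd.set 9 (.get 2 (.var 8))).seq
        ((Cmd.set 8 (.op .add (.var 8) (.const 1))).seq c)) with hbody
  set s₀ := s.setVar 8 (offset adj v) with hs₀
  have hkey : ∀ j, j ≤ (adj v).length →
      ((body.run w)^[j] s₀).var 8 = offset adj v + j ∧
      (∀ x, c.KeepsVar x → x ≠ 8 → x ≠ 9 → ((body.run w)^[j] s₀).var x = s.var x) ∧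
      (∀ a, c.KeepsArr a → ((body.run w)^[j] s₀).arr a = s.arr a) ∧
      I ((adj v).take j) ((body.run w)^[j] s₀) := by
    intro j
    induction j with
    | zero =>
      refine fun _ => ⟨by simp [hs₀], fun x _ hx _ => by simp [hs₀, hx], fun a _ => rfl, ?_⟩
      have := hI [] s (s.var 9) (offset adj v) h0
      have e : s.setVar 9 (s.var 9) = s := by
        unfold Store.setVar
        rw [Function.update_eq_self]
      rwa [e] at this
    | succ j ih =>
      intro hj
      obtain ⟨ih8, ihv, iha, ihI⟩ := ih (by omega)
      set t := (body.run w)^[j] s₀ with ht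
      set u : Fin n := (adj v)[j] with hu
      have hoff := hw.offset (v + 1)
      rw [offset_succ] at hoff
      have hrun : body.run w t = c.run w ((t.setVar 9 u).setVar 8 (offset adj v + (j + 1))) := by
        have e1 : t.arr 2 (t.var 8) = u := by
          rw [iha 2 hc2, ih8]
          exact hs.nb v j (by omega)
        have e2 : (t.var 8 + 1) % 2 ^ w = offset adj v + (j + 1) := by
          rw [ih8]
          exact Nat.mod_eq_of_lt (by omega)
        simp [hbody, Cmd.run, Expr.eval, BinOp.run, e1, Nat.mod_eq_of_lt h1, e2]
      rw [Function.iterate_succ_apply', ← ht, hrun]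
      refine ⟨?_, fun x hx hx8 hx9 => ?_, fun a ha => ?_, ?_⟩
      · rw [Cmd.run_var w hc8]
        simp
      · rw [Cmd.run_var w hx]
        simp [hx8, hx9, ihv x hx hx8 hx9]
      · rw [Cmd.run_arr w ha]
        exact iha a ha
      · have htake : (adj v).take (j + 1) = (adj v).take j ++ [u] :=
          List.take_succ_eq_append_getElem (by omega)
        rw [htake]
        refine hstep _ u _ ?_ (by simp) (fun x hx hx8 hx9 => ?_) (fun a ha => ?_) (hI _ _ _ _ ihI)
        · rw [← htake]
          exact List.take_prefix _ _
        · simp [hx8, hx9, ihv x hx hx8 hx9]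
        · exact iha a ha
  have hcount : (Expr.op .sub (.get 1 (.op .add (.var q) (.const 1))) (.get 1 (.var q))).eval w s₀
      = (adj v).length := by
    have hoff := hw.offset (v + 1)
    have hoff' := offset_succ adj v
    simp only [Expr.eval, BinOp.run, hs₀, Store.setVar_var, hq8, if_false, Nat.mod_eq_of_lt h1,
      hq1, Store.setVar_arr, hs.off]
    rw [hv, Nat.mod_eq_of_lt (by omega)]
    omega
  have hset : (Cmd.set 8 (.get 1 (.var q))).run w s = s₀ := by
    simp [Cmd.run, Expr.eval, hs.off, hv, hs₀]
  have hlen := hkey _ le_rfl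
  rw [List.take_length] at hlen
  have hbflat : body.Flat := ⟨trivial, trivial, hc⟩
  have hbcost : body.cost = c.cost + 7 := by
    simp [hbody, Cmd.cost, Expr.cost]
    omega
  refine ⟨?_, ?_⟩
  · rw [forNb, Cmd.run, hset, Cmd.run, hcount]
    exact hlen.2.2.2
  · rw [forNb, Cmd.dur, hset, Cmd.dur, Cmd.dur, hcount, ← hbody]
    have : ∑ j ∈ Finset.range (adj v).length, (1 + body.dur w ((body.run w)^[j] s₀))
        ≤ (adj v).length * (c.cost + 8) := by
      calc _ ≤ ∑ _j ∈ Finset.range (adj v).length, (c.cost + 8) :=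
            Finset.sum_le_sum fun j _ => by
              have := hbflat.dur_le (w := w) ((body.run w)^[j] s₀)
              omega
        _ = _ := by simp
    simp only [Expr.cost]
    have h2 := Nat.mul_le_mul_left (adj v).length (show c.cost + 8 ≤ c.cost + 9 by omega)
    omega

end Program

/-! ### Tests and folds -/

/-- The value of the expression `e` is the truth value of `P`. -/
def Expr.Tests (w : ℕ) (e : Expr) (s : Store) (P : Prop) : Prop :=
  (P → e.eval w s = 1) ∧ (¬ P → e.eval w s = 0)

namespace Expr

variable {w : ℕ} {e f : Expr} {s : Store} {P Q : Prop}

theorem Tests.ne_zero (h : e.Tests w s P) : e.eval w s ≠ 0 ↔ P := by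
  by_cases hP : P
  · simp [h.1 hP, hP]
  · simp [h.2 hP, hP]

theorem Tests.congr (h : e.Tests w s P) (hPQ : P ↔ Q) : e.Tests w s Q := propext hPQ ▸ h

theorem Tests.and (h1 : 1 < 2 ^ w) (he : e.Tests w s P) (hf : f.Tests w s Q) :
    (op .mul e f).Tests w s (P ∧ Q) := by
  by_cases hP : P <;> by_cases hQ : Q <;>
    simp [Tests, eval, BinOp.run, hP, hQ, he.1, he.2, hf.1, hf.2, Nat.mod_eq_of_lt h1]

theorem Tests.not (h1 : 1 < 2 ^ w) (he : e.Tests w s P) :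
    (op .sub (const 1) e).Tests w s (¬ P) := by
  by_cases hP : P <;> simp [Tests, eval, BinOp.run, hP, he.1, he.2, Nat.mod_eq_of_lt h1]

/-- Disjunction of truth values. -/
def or (e f : Expr) : Expr := op .sub (const 1) (op .mul (op .sub (const 1) e) (op .sub (const 1) f))

theorem Tests.or (h1 : 1 < 2 ^ w) (he : e.Tests w s P) (hf : f.Tests w s Q) :
    (e.or f).Tests w s (P ∨ Q) :=
  ((he.not h1).and h1 (hf.not h1) |>.not h1).congr (by tauto)

theorem tests_lt (h1 : 1 < 2 ^ w) : (op .lt e f).Tests w s (e.eval w s < f.eval w s) := by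
  constructor <;> intro h <;> simp [eval, BinOp.run, h, Nat.mod_eq_of_lt h1]

theorem tests_eq (h1 : 1 < 2 ^ w) : (op .eq e f).Tests w s (e.eval w s = f.eval w s) := by
  constructor <;> intro h <;> simp [eval, BinOp.run, h, Nat.mod_eq_of_lt h1]

end Expr

namespace Program

/-- The store `s'` differs from `s` at most in the variables in `X` and the arrays in `Y`. -/
def Agrees (X Y : List ℕ) (s s' : Store) : Prop :=
  (∀ x, x ∉ X → s'.var x = s.var x) ∧ ∀ a, a ∉ Y → s'.arr a = s.arr a

theorem Agrees.refl {X Y : List ℕ} (s : Store) : Agrees X Y s s := ⟨fun _ _ => rfl, fun _ _ => rfl⟩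

theorem Agrees.trans {X Y : List ℕ} {s s' s'' : Store} (h : Agrees X Y s s')
    (h' : Agrees X Y s' s'') : Agrees X Y s s'' :=
  ⟨fun x hx => (h'.1 x hx).trans (h.1 x hx), fun a ha => (h'.2 a ha).trans (h.2 a ha)⟩

theorem Agrees.mono {X Y X' Y' : List ℕ} {s s' : Store} (h : Agrees X Y s s') (hX : X ⊆ X')
    (hY : Y ⊆ Y') : Agrees X' Y' s s' :=
  ⟨fun x hx => h.1 x fun h => hx (hX h), fun a ha => h.2 a fun h => ha (hY h)⟩

theorem HasGraph.agrees {n : ℕ} {adj : Fin n → List (Fin n)} {X Y : List ℕ} {s s' : Store}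
    (hs : HasGraph adj s) (h : Agrees X Y s s') (h1 : 1 ∉ Y) (h2 : 2 ∉ Y) : HasGraph adj s' :=
  ⟨by rw [h.2 1 h1]; exact hs.off, by rw [h.2 2 h2]; exact hs.nb⟩

variable {n k w D : ℕ} {adj : Fin n → List (Fin n)}

/-- A loop over the neighbors that only assigns variable `t` folds over the list of neighbors. -/
theorem forNb_fold (hw : Fits n k w adj) (hD : ∀ v, (adj v).length ≤ D) {c : Cmd} {q t : ℕ}
    (hc : c.Flat) (hcv : ∀ x, x ≠ t → c.KeepsVar x) (hca : ∀ a, c.KeepsArr a) (ht8 : t ≠ 8)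
    (ht9 : t ≠ 9) (hq8 : q ≠ 8) {s : Store} (hs : HasGraph adj s) (v : Fin n) (hv : s.var q = v)
    (f : ℕ → Fin n → ℕ)
    (hstep : ∀ l (u : Fin n) s', l ++ [u] <+: adj v → s'.var 9 = (u : ℕ) →
      Agrees [t, 8, 9] [] s s' → s'.var t = l.foldl f (s.var t) →
      (c.run w s').var t = f (s'.var t) u) :
    (forNb q c).Does w s (20 + D * (c.cost + 9)) fun s' =>
      s'.var t = (adj v).foldl f (s.var t) ∧ Agrees [t, 8, 9] [] s s' := by
  refine (forNb_does hw hc (hca 2) (hcv 8 ht8.symm)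
    (fun l s' => s'.var t = l.foldl f (s.var t) ∧ Agrees [t, 8, 9] [] s s') hs v hv hq8
    ⟨rfl, Agrees.refl s⟩ ?_ ?_).mono
    (Nat.add_le_add_left (Nat.mul_le_mul_right _ (hD v)) _) id
  · rintro l s' a b ⟨h1, h2⟩
    refine ⟨by simp [ht8, ht9, h1], fun x hx => ?_, h2.2⟩
    rw [← h2.1 x hx]
    simp only [List.mem_cons, not_or] at hx
    simp [hx.2.1, hx.2.2.1]
  · rintro l u s' hl hu - - ⟨h1, h2⟩
    refine ⟨?_, fun x hx => ?_, fun a ha => ?_⟩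
    · rw [hstep l u s' hl hu h2 h1, h1, List.foldl_append]
      rfl
    · rw [← h2.1 x hx, Cmd.run_var]
      exact hcv x fun h => hx (h ▸ List.mem_cons_self)
    · rw [← h2.2 a ha, Cmd.run_arr]
      exact hca a

/-- Set variable `t` to the number of neighbors of the node in variable `q` that pass a test. -/
def count (t q : ℕ) (e : Expr) : Cmd :=
  (Cmd.set t (.const 0)).seq
    (forNb q (.ite e (.set t (.op .add (.var t) (.const 1))) .skip))

theorem count_does (hw : Fits n k w adj) (hn : ∀ v, (adj v).Nodup)
    (hD : ∀ v, (adj v).length ≤ D) {q t : ℕ} {e : Expr} (ht8 : t ≠ 8)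
    (ht9 : t ≠ 9) (hq8 : q ≠ 8) (hqt : q ≠ t) {s : Store} (hs : HasGraph adj s) (v : Fin n)
    (hv : s.var q = v) (P : Fin n → Prop) [DecidablePred P]
    (he : ∀ u ∈ adj v, ∀ s', s'.var 9 = (u : ℕ) → Agrees [t, 8, 9] [] s s' → e.Tests w s' (P u)) :
    (count t q e).Does w s (22 + D * (e.cost + 14)) fun s' =>
      s'.var t = (adj v).countP (fun u => P u) ∧ Agrees [t, 8, 9] [] s s' := by
  have h1 : 1 < 2 ^ w := by have := hw.small; omega
  have h0 : Agrees [t, 8, 9] [] s (s.setVar t 0) := by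
    refine ⟨fun x hx => ?_, fun a _ => rfl⟩
    simp only [List.mem_cons, not_or] at hx
    simp [hx.1]
  have key := forNb_fold (c := .ite e (.set t (.op .add (.var t) (.const 1))) .skip) (q := q) (t := t)
    hw hD ⟨trivial, trivial⟩ (fun x hx => ⟨hx, trivial⟩) (fun a => ⟨trivial, trivial⟩) ht8 ht9 hq8
    (hs.agrees h0 (by simp) (by simp)) v (by simp [hqt, hv])
    (fun m u => if P u then m + 1 else m) (by
      intro l u s' hl hu hag hm
      have hmem : u ∈ adj v := hl.subset (by simp)
      have ht := he u hmem s' hu (h0.trans hag)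
      have hfold : ∀ (l : List (Fin n)) m, l.foldl (fun m u => if P u then m + 1 else m) m
          ≤ m + l.length := by
        intro l
        induction l with
        | nil => simp
        | cons a l ih =>
          intro m
          rw [List.foldl_cons, List.length_cons]
          refine (ih _).trans ?_
          split_ifs <;> omega
      have hb : s'.var t + 1 < 2 ^ w := by
        have h2 := hfold l ((s.setVar t 0).var t)
        have h3 := hl.length_le
        have h4 := (hn v).length_le_card
        rw [Fintype.card_fin] at h4
        have := hw.small
        simp only [Store.setVar_var, if_true, List.length_append, List.length_singleton] at *
        omega
      by_cases hP : P u
      · rw [Cmd.run, if_pos (ht.ne_zero.2 hP)]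
        simp [Cmd.run, hP, Expr.eval, BinOp.run, Nat.mod_eq_of_lt h1, Nat.mod_eq_of_lt hb]
      · rw [Cmd.run, if_neg (fun h => hP (ht.ne_zero.1 h))]
        simp [Cmd.run, hP])
  have hset : (Cmd.set t (.const 0)).run w s = s.setVar t 0 := by simp [Cmd.run, Expr.eval]
  refine (Cmd.Does.seq (T := 2) (T' := 20 + D * (e.cost + 14)) (Q := fun s' => s' = s.setVar t 0)
    ⟨hset, le_rfl⟩ (fun _ => ?_)).le ?_
  · rw [hset]
    refine key.mono ?_ fun ⟨h2, h3⟩ => ⟨?_, h0.trans h3⟩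
    · simp only [Cmd.cost, Expr.cost]
      exact Nat.add_le_add_left (Nat.mul_le_mul_left _ (by omega)) _
    · rw [h2]
      have hfold : ∀ (l : List (Fin n)) m, l.foldl (fun m u => if P u then m + 1 else m) m
          = m + l.countP fun u => P u := by
        intro l
        induction l with
        | nil => simp
        | cons a l ih =>
          intro m
          rw [List.foldl_cons, ih, List.countP_cons]
          split_ifs <;> simp_all
          omega
      rw [hfold]
      simp
  · omega

/-- The smallest node of the list with property `P`, or `n` if there is none. -/
def IsLeast (l : List (Fin n)) (P : Fin n → Prop) (m : ℕ) : Prop :=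
  (m = n ∧ ∀ u ∈ l, ¬ P u) ∨ ∃ u ∈ l, P u ∧ m = u ∧ ∀ u' ∈ l, P u' → u ≤ u'

theorem IsLeast.append {l : List (Fin n)} {P : Fin n → Prop} {m : ℕ} (h : IsLeast l P m) (u : Fin n)
    [Decidable (P u)] : IsLeast (l ++ [u]) P (if P u ∧ (u : ℕ) < m then u else m) := by
  have hu := u.2
  rcases h with ⟨rfl, h⟩ | ⟨u', hu', hP, rfl, h⟩
  · by_cases hP : P u
    · refine Or.inr ⟨u, by simp, hP, by simp [hP], fun u'' hu'' hP'' => ?_⟩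
      rcases List.mem_append.1 hu'' with h' | h'
      · exact absurd hP'' (h _ h')
      · simp_all
    · refine Or.inl ⟨by simp [hP], fun u'' hu'' => ?_⟩
      rcases List.mem_append.1 hu'' with h' | h'
      · exact h _ h'
      · simp_all
  · right
    by_cases hc : P u ∧ (u : ℕ) < u'
    · refine ⟨u, by simp, hc.1, by simp [hc], fun u'' hu'' hP'' => ?_⟩
      rcases List.mem_append.1 hu'' with h' | h'
      · exact (Fin.lt_def.2 hc.2).le.trans (h _ h' hP'')
      · simp_all
    · refine ⟨u', by simp [hu'], hP, by rw [if_neg hc], fun u'' hu'' hP'' => ?_⟩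
      rcases List.mem_append.1 hu'' with h' | h'
      · exact h _ h' hP''
      · obtain rfl : u'' = u := by simpa using h'
        exact Fin.le_def.2 (not_lt.1 fun hlt => hc ⟨hP'', hlt⟩)

/-- For the colors `e` of the neighbors of the node in variable `q`, set cell `e` of array `a` to the
smallest neighbor of color `e` that passes a test, or to `n` if there is none. -/
def fill (a q : ℕ) (e : Expr) : Cmd :=
  (forNb q (.put a (.get 0 (.var 9)) (.var 1))).seq
    (forNb q (.ite (.op .mul e (.op .lt (.var 9) (.get a (.get 0 (.var 9)))))
      (.put a (.get 0 (.var 9)) (.var 9)) .skip))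

theorem fill_does (hw : Fits n k w adj) (hD : ∀ v, (adj v).length ≤ D) {a q : ℕ} {e : Expr}
    (ha0 : a ≠ 0) (ha1 : a ≠ 1) (ha2 : a ≠ 2) (hq8 : q ≠ 8) (hq9 : q ≠ 9) {s : Store}
    (hs : HasGraph adj s) (h1 : s.var 1 = n) (v : Fin n)
    (hv : s.var q = v) (P : Fin n → Prop)
    (he : ∀ u ∈ adj v, ∀ s', s'.var 9 = (u : ℕ) → Agrees [8, 9] [a] s s' → e.Tests w s' (P u)) :
    (fill a q e).Does w s (40 + D * (e.cost + 40)) fun s' =>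
      (∀ d, s.arr a d = n ∨ (∃ u ∈ adj v, s.arr 0 u = d) →
        IsLeast (adj v) (fun u => P u ∧ s.arr 0 u = d) (s'.arr a d)) ∧
      Agrees [8, 9] [a] s s' := by
  classical
  have hlt : 1 < 2 ^ w := by have := hw.small; omega
  have hset : ∀ s' b c, Agrees [8, 9] [a] s s' →
      Agrees [8, 9] [a] s ((s'.setVar 9 b).setVar 8 c) := by
    refine fun s' b c h => ⟨fun x hx => ?_, h.2⟩
    rw [← h.1 x hx]
    simp only [List.mem_cons, not_or] at hx
    simp [hx.1, hx.2.1]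
  have hput : ∀ s' b c, Agrees [8, 9] [a] s s' → Agrees [8, 9] [a] s (s'.setArr a b c) := by
    refine fun s' b c h => ⟨h.1, fun y hy => ?_⟩
    rw [← h.2 y hy]
    simp only [List.mem_singleton] at hy
    funext j
    simp [hy]
  have hA := forNb_does (q := q) (c := .put a (.get 0 (.var 9)) (.var 1)) hw trivial ha2.symm trivial
    (fun l s' => Agrees [8, 9] [a] s s' ∧
      ∀ d, s.arr a d = n ∨ (∃ u ∈ l, s.arr 0 u = d) → s'.arr a d = n) hs v hv hq8
    ⟨Agrees.refl s, by simp⟩ (fun l s' b c h => ⟨hset s' b c h.1, h.2⟩) (by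
      rintro l u s' - hu - - ⟨h2, h3⟩
      have h0 : s'.arr 0 = s.arr 0 := h2.2 0 (by simpa using ha0.symm)
      have h1' : s'.var 1 = n := by rw [h2.1 1 (by simp), h1]
      refine ⟨hput _ _ _ h2, fun d hd => ?_⟩
      simp only [Cmd.run, Expr.eval, hu, h0, h1']
      by_cases hdu : d = s.arr 0 u
      · simp [hdu]
      · simp only [Store.setArr_arr, hdu, and_false, if_false]
        refine h3 d (hd.imp_right ?_)
        rintro ⟨u', hu', he'⟩
        rcases List.mem_append.1 hu' with h' | h'
        · exact ⟨u', h', he'⟩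
        · simp_all)
  have hB : ∀ t, Agrees [8, 9] [a] s t → (∀ d, s.arr a d = n ∨ (∃ u ∈ adj v, s.arr 0 u = d) →
      t.arr a d = n) → _ := fun t hst htn =>
    forNb_does (q := q) (c := .ite (.op .mul e (.op .lt (.var 9) (.get a (.get 0 (.var 9)))))
      (.put a (.get 0 (.var 9)) (.var 9)) .skip) hw ⟨trivial, trivial⟩ ⟨ha2.symm, trivial⟩
      ⟨trivial, trivial⟩
      (fun l s' => Agrees [8, 9] [a] s s' ∧
        ∀ d, s.arr a d = n ∨ (∃ u ∈ adj v, s.arr 0 u = d) →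
          IsLeast l (fun u => P u ∧ s.arr 0 u = d) (s'.arr a d))
      (hs.agrees hst (by simpa using ha1.symm) (by simpa using ha2.symm)) v
      (by rw [hst.1 q (by simp [hq8, hq9]), hv]) hq8
      ⟨hst, fun d hd => Or.inl ⟨htn d hd, by simp⟩⟩ (fun l s' b c h => ⟨hset s' b c h.1, h.2⟩) (by
      rintro l u s' hl hu - - ⟨h2, h3⟩
      have h0 : s'.arr 0 = s.arr 0 := h2.2 0 (by simpa using ha0.symm)
      have hT := (he u (hl.subset (by simp)) s' hu h2).and hlt
        (Expr.tests_lt (e := .var 9) (f := .get a (.get 0 (.var 9))) hlt)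
      simp only [Expr.eval, hu, h0] at hT
      have hrun : ∀ d, ((Cmd.ite (.op .mul e (.op .lt (.var 9) (.get a (.get 0 (.var 9)))))
          (.put a (.get 0 (.var 9)) (.var 9)) .skip).run w s').arr a d
          = if (P u ∧ s.arr 0 u = d) ∧ (u : ℕ) < s'.arr a d then (u : ℕ) else s'.arr a d := by
        intro d
        rw [Cmd.run]
        by_cases hc : P u ∧ (u : ℕ) < s'.arr a (s.arr 0 u)
        · rw [if_pos (hT.ne_zero.2 hc)]
          simp only [Cmd.run, Expr.eval, hu, h0]
          by_cases hd : d = s.arr 0 u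
          · subst hd
            simp [hc]
          · simp [hd, Ne.symm hd]
        · rw [if_neg (fun h => hc (hT.ne_zero.1 h)), if_neg]
          · rfl
          · rintro ⟨⟨h4, rfl⟩, h5⟩
            exact hc ⟨h4, h5⟩
      refine ⟨?_, fun d hd => ?_⟩
      · rw [Cmd.run]
        split_ifs
        · exact hput _ _ _ h2
        · exact h2
      · rw [hrun d]
        exact (h3 d hd).append u)
  refine (hA.seq fun h => (hB _ h.1 h.2).mono le_rfl fun h => And.intro h.2 h.1).le ?_
  simp only [Cmd.cost, Expr.cost]
  have h2 := Nat.mul_le_mul_right (e.cost + 40) (hD v)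
  have : (adj v).length * (e.cost + 40) = (adj v).length * e.cost + (adj v).length * 40 := by ring
  ring_nf at *
  omega

end Program

/-! ### The representation of an index in the memory -/

namespace Program

variable {n k w D : ℕ} {adj : Fin n → List (Fin n)} {s : Store} {x : Fin n → Fin k} {i : Idx n k}

/-- The memory holds the state `x` and the index `i`.  Array `0` holds the colors, array `3` tells
which nodes are active, array `4` holds the thresholds, and array `5` the stack, whose height is in
variable `3`. -/
structure Rep (adj : Fin n → List (Fin n)) (s : Store) (x : Fin n → Fin k) (i : Idx n k) : Prop where
  nodes : s.var 1 = n
  colors : s.var 2 = k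
  graph : HasGraph adj s
  col : ∀ v : Fin n, s.arr 0 v = x v
  act : ∀ v : Fin n, s.arr 3 v = if i.pin v = none then 1 else 0
  pin : ∀ v c, i.pin v = some c → x v = c
  th : ∀ v : Fin n, s.arr 4 v = i.th v
  top : s.var 3 = i.stk.length
  stk : ∀ (j : ℕ) (v : Fin n), i.stk.reverse[j]? = some v → s.arr 5 j = v
  flag : s.var 0 ≠ 0 ↔ i.stk = []

/-- Variables from `4` on and arrays from `6` on are scratch memory. -/
theorem Rep.agrees {X Y : List ℕ} {s' : Store} (hs : Rep adj s x i) (h : Agrees X Y s s')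
    (hX : ∀ a ∈ X, 4 ≤ a) (hY : ∀ a ∈ Y, 6 ≤ a) : Rep adj s' x i := by
  have hv : ∀ a < 4, s'.var a = s.var a := fun a ha => h.1 a fun hm => absurd (hX a hm) (by omega)
  have ha : ∀ a < 6, s'.arr a = s.arr a := fun a ha => h.2 a fun hm => absurd (hY a hm) (by omega)
  refine ⟨?_, ?_, hs.graph.agrees h (fun hm => absurd (hY 1 hm) (by omega))
    (fun hm => absurd (hY 2 hm) (by omega)), ?_, ?_, hs.pin, ?_, ?_, ?_, ?_⟩
  · rw [hv 1 (by omega), hs.nodes]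
  · rw [hv 2 (by omega), hs.colors]
  · rw [ha 0 (by omega)]; exact hs.col
  · rw [ha 3 (by omega)]; exact hs.act
  · rw [ha 4 (by omega)]; exact hs.th
  · rw [hv 3 (by omega), hs.top]
  · rw [ha 5 (by omega)]; exact hs.stk
  · rw [hv 0 (by omega)]; exact hs.flag

theorem Rep.state_unique {y : Fin n → Fin k} {j : Idx n k} (h : Rep adj s x i) (h' : Rep adj s y j) :
    x = y := by
  funext v
  exact Fin.ext ((h.col v).symm.trans (h'.col v))

/-- The memory determines the index.  The known color of an inactive node is its color in the
state. -/
theorem Rep.index_unique {y : Fin n → Fin k} {j : Idx n k} (h : Rep adj s x i) (h' : Rep adj s y j) :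
    i = j := by
  obtain rfl := h.state_unique h'
  ext1
  · funext v
    have h1 := (h.act v).symm.trans (h'.act v)
    cases hi : i.pin v with
    | none =>
      cases hj : j.pin v with
      | none => rfl
      | some d => simp [hi, hj] at h1
    | some c =>
      cases hj : j.pin v with
      | none => simp [hi, hj] at h1
      | some d => rw [← h.pin v c hi, ← h'.pin v d hj]
  · funext v
    exact (h.th v).symm.trans (h'.th v)
  · refine List.reverse_injective (List.ext_getElem ?_ fun l h1 h2 => ?_)
    · simpa using h.top.symm.trans h'.top
    · exact Fin.ext ((h.stk l _ (List.getElem?_eq_getElem h1)).symm.trans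
        (h'.stk l _ (List.getElem?_eq_getElem h2)))

/-- Give a color to an active node. -/
theorem Rep.recolor (h : Rep adj s x i) {z : Fin n} (hz : i.pin z = none) (d : Fin k) :
    Rep adj (s.setArr 0 z d) (Function.update x z d) i := by
  refine ⟨h.nodes, h.colors, ⟨h.graph.off, h.graph.nb⟩, fun v => ?_, h.act, fun v c hv => ?_,
    h.th, h.top,
    h.stk, h.flag⟩
  · by_cases hv : v = z
    · simp [hv]
    · simp [hv, Fin.val_inj, h.col]
  · have : v ≠ z := fun e => by simp [e, hz] at hv
    rw [Function.update_of_ne this]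
    exact h.pin v c hv

theorem Rep.setTh (h : Rep adj s x i) (v : Fin n) (m : ℕ) :
    Rep adj (s.setArr 4 v m) x ⟨i.pin, Function.update i.th v m, i.stk⟩ := by
  refine ⟨h.nodes, h.colors, ⟨h.graph.off, h.graph.nb⟩, h.col, h.act, h.pin, fun u => ?_, h.top,
    h.stk, h.flag⟩
  by_cases hv : u = v
  · simp [hv]
  · simp [hv, Fin.val_inj, h.th]

theorem Rep.stk_head (h : Rep adj s x i) {v : Fin n} {l : List (Fin n)} (hl : i.stk = v :: l) :
    s.arr 5 (s.var 3 - 1) = v := by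
  refine h.stk _ v ?_
  rw [h.top, hl]
  simp

/-- Make the node in variable `q` inactive, with the threshold in variable `t`. -/
def freeze (q t : ℕ) : Cmd :=
  (Cmd.put 3 (.var q) (.const 0)).seq ((Cmd.put 4 (.var q) (.var t)).seq
    ((Cmd.put 5 (.var 3) (.var q)).seq (.set 3 (.op .add (.var 3) (.const 1)))))

theorem freeze_does {q t m : ℕ} (h : Rep adj s x i) {u : Fin n}
    (hu : s.var q = u) (hm : s.var t = m) (hl : i.stk.length + 1 < 2 ^ w) (hne : i.stk ≠ []) :
    (freeze q t).Does w s 13 fun s' =>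
      Rep adj s' x ⟨Function.update i.pin u (some (x u)), Function.update i.th u m, u :: i.stk⟩ ∧
        Agrees [3] [3, 4, 5] s s' := by
  refine ⟨?_, le_rfl⟩
  have h1 : 1 < 2 ^ w := by omega
  have hrun : (freeze q t).run w s = ((((s.setArr 3 u 0).setArr 4 u m).setArr 5 i.stk.length u).setVar
      3 (i.stk.length + 1)) := by
    simp [freeze, Cmd.run, Expr.eval, BinOp.run, hu, hm, h.top, Nat.mod_eq_of_lt h1,
      Nat.mod_eq_of_lt hl]
  rw [hrun]
  refine ⟨⟨by simpa using h.nodes, by simpa using h.colors, ⟨?_, ?_⟩, ?_, fun v => ?_, fun v c hv => ?_,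
    fun v => ?_, ?_, fun j v hj => ?_, ?_⟩, fun y hy => ?_, fun a ha => ?_⟩
  · simpa using h.graph.off
  · simpa using h.graph.nb
  · simpa using h.col
  · by_cases hv : v = u
    · simp [hv]
    · simpa [hv, Fin.val_inj] using h.act v
  · by_cases hvu : v = u
    · subst hvu
      simpa using hv
    · exact h.pin v c (by simpa [hvu] using hv)
  · by_cases hv : v = u
    · simp [hv]
    · simpa [hv, Fin.val_inj] using h.th v
  · simp
  · rw [List.reverse_cons] at hj
    by_cases hjl : j = i.stk.length
    · subst hjl
      have : u = v := by simpa using hj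
      simp [this]
    · have hlt : j < i.stk.reverse.length := by
        have := (List.getElem?_eq_some_iff.1 hj).1
        simp only [List.length_append, List.length_reverse, List.length_singleton] at this
        rw [List.length_reverse]
        omega
      rw [List.getElem?_append_left hlt] at hj
      simpa [hjl] using h.stk j v hj
  · have := h.flag.not.2 hne
    simpa using this
  · simp only [List.mem_singleton] at hy
    simp [hy]
  · simp only [List.mem_cons, not_or] at ha
    funext j
    simp [ha.1, ha.2.1, ha.2.2.1]

theorem apply_collapse_self {z a : Fin n} {e : Fin k} : i.apply (.collapse z e a a) =
    ⟨Function.update (Function.update i.pin z (some e)) a (some e),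
      Function.update (Function.update i.th z a) a n,
      a :: ((if i.pin z = none then [z] else []) ++ i.stk)⟩ := by
  ext1
  · funext u
    simp only [Idx.apply, Function.update_apply]
    split_ifs <;> simp_all
  · funext u
    simp only [Idx.apply, Function.update_apply]
    split_ifs <;> simp_all
  · simp [Idx.apply]

theorem apply_collapse_of_ne {z a b : Fin n} {e : Fin k} (hab : a ≠ b) :
    i.apply (.collapse z e a b) =
    ⟨Function.update (Function.update (Function.update i.pin z (some e)) a (some e)) b (some e),
      Function.update (Function.update (Function.update i.th z a) a n) b n,
      b :: a :: ((if i.pin z = none then [z] else []) ++ i.stk)⟩ := by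
  ext1
  · funext u
    simp only [Idx.apply, Function.update_apply]
    split_ifs <;> simp_all
  · funext u
    simp only [Idx.apply, Function.update_apply]
    split_ifs <;> simp_all
  · simp [Idx.apply, hab]

/-- Collapse: variable `10` holds the node `z`, variable `11` the color, and variables `12` and `13`
hold the two neighbors. -/
def collapse : Cmd :=
  (((Cmd.put 0 (.var 10) (.var 11)).seq
    (.ite (.get 3 (.var 10)) (freeze 10 12) (.put 4 (.var 10) (.var 12)))).seq (freeze 12 1)).seq
      (.ite (.op .eq (.var 12) (.var 13)) .skip (freeze 13 1))

theorem collapse_does (h : Rep adj s x i) {z a b : Fin n} {e : Fin k} (hz : s.var 10 = z)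
    (he : s.var 11 = e) (ha : s.var 12 = a) (hb : s.var 13 = b) (haz : a ≠ z) (hbz : b ≠ z)
    (hxa : x a = e) (hxb : x b = e) (hl : i.stk.length + 3 < 2 ^ w) (hne : i.stk ≠ []) :
    collapse.Does w s 60 fun s' =>
      Rep adj s' (Function.update x z e) (i.apply (.collapse z e a b)) := by
  have h1 : 1 < 2 ^ w := by omega
  set y := Function.update x z e with hy
  have hya : y a = e := by rw [hy, Function.update_of_ne haz, hxa]
  have hyb : y b = e := by rw [hy, Function.update_of_ne hbz, hxb]
  -- `z` is made inactive, or its color and threshold are changed if it is inactive already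
  have hfirst : ((Cmd.put 0 (.var 10) (.var 11)).seq
      (Cmd.ite (.get 3 (.var 10)) (freeze 10 12) (.put 4 (.var 10) (.var 12)))).Does w s 20 fun s' =>
      Rep adj s' y ⟨Function.update i.pin z (some e), Function.update i.th z a,
        (if i.pin z = none then [z] else []) ++ i.stk⟩ ∧ Agrees [3] [0, 3, 4, 5] s s' := by
    have hput : (Cmd.put 0 (.var 10) (.var 11)).run w s = s.setArr 0 z e := by
      simp [Cmd.run, Expr.eval, hz, he]
    refine (Cmd.Does.seq (T := 3) (T' := 16) (Q := fun s' => s' = s.setArr 0 z e) ⟨hput, le_rfl⟩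
      fun _ => ?_).le (by omega)
    rw [hput]
    have hag : ∀ s', Agrees [3] [3, 4, 5] (s.setArr 0 z e) s' → Agrees [3] [0, 3, 4, 5] s s' := by
      refine fun s' h' => ⟨fun v hv => h'.1 v hv, fun c hc => ?_⟩
      rw [h'.2 c (fun hm => hc (by simp_all))]
      simp only [List.mem_cons, not_or] at hc
      funext j
      simp [hc.1]
    by_cases hpz : i.pin z = none
    · refine (Cmd.Does.ite_pos ?_ ((freeze_does (h.recolor hpz e) (u := z) (by simpa using hz)
        (m := a) (by simpa using ha) (by omega) hne).mono le_rfl fun h' => ?_)).le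
        (by simp [Expr.cost])
      · simp [Expr.eval, hz, h.act, hpz]
      · refine ⟨?_, hag _ h'.2⟩
        simpa [hpz, hy] using h'.1
    · refine (Cmd.Does.ite_neg ?_ (T := 3) ⟨?_, le_rfl⟩).le (by simp [Expr.cost])
      · simp [Expr.eval, hz, h.act, hpz]
      · have hrun : (Cmd.put 4 (.var 10) (.var 12)).run w (s.setArr 0 z e)
            = (s.setArr 0 z e).setArr 4 z a := by
          simp [Cmd.run, Expr.eval, hz, ha]
        rw [hrun]
        refine ⟨⟨by simpa using h.nodes, by simpa using h.colors, ⟨?_, ?_⟩, fun v => ?_, fun v => ?_,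
          fun v c hv => ?_, fun v => ?_, ?_, ?_, ?_⟩, hag _ ⟨fun _ _ => rfl, fun c hc => ?_⟩⟩
        · simpa using h.graph.off
        · simpa using h.graph.nb
        · by_cases hv : v = z
          · simp [hv, hy]
          · simpa [hv, hy, Fin.val_inj] using h.col v
        · by_cases hv : v = z
          · simpa [hv, hpz] using h.act z
          · simpa [hv] using h.act v
        · by_cases hvz : v = z
          · subst hvz
            simpa [hy] using hv
          · rw [hy, Function.update_of_ne hvz]
            exact h.pin v c (by simpa [hvz] using hv)
        · by_cases hv : v = z
          · simp [hv]
          · simpa [hv, Fin.val_inj] using h.th v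
        · simpa [hpz] using h.top
        · simpa [hpz] using h.stk
        · simpa [hpz] using h.flag
        · simp only [List.mem_cons, not_or] at hc
          funext j
          simp [hc.2.1]
  have hlen : ((if i.pin z = none then [z] else []) ++ i.stk).length ≤ i.stk.length + 1 := by
    split_ifs <;> simp
  have hne' : ∀ l : List (Fin n), l ++ i.stk ≠ [] := fun l => by simp [hne]
  have hsecond := hfirst.seq (Q' := fun s' => Rep adj s' y
      ⟨Function.update (Function.update i.pin z (some e)) a (some (y a)),
        Function.update (Function.update i.th z a) a n,
        a :: ((if i.pin z = none then [z] else []) ++ i.stk)⟩ ∧ Agrees [3] [0, 3, 4, 5] s s')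
    fun h' => (freeze_does (w := w) (q := 12) (t := 1) (u := a) (m := n)
    h'.1 (by rw [h'.2.1 12 (by simp), ha]) (by rw [h'.2.1 1 (by simp), h.nodes])
    (by simp only; omega) (hne' _)).mono le_rfl fun h'' => And.intro h''.1
      ((h'.2.trans (h''.2.mono (by simp) (by simp)) : Agrees [3] [0, 3, 4, 5] s _))
  have hthird := hsecond.seq (d := .ite (.op .eq (.var 12) (.var 13)) .skip (freeze 13 1)) (T' := 17)
    (Q' := fun s' => Rep adj s' y (i.apply (.collapse z e a b))) fun h' => by
      have ht := Expr.tests_eq (w := w) (e := .var 12) (f := .var 13) (s := (Cmd.run w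
        ((((Cmd.put 0 (.var 10) (.var 11)).seq
          (Cmd.ite (.get 3 (.var 10)) (freeze 10 12) (.put 4 (.var 10) (.var 12)))).seq
            (freeze 12 1))) s)) h1
      simp only [Expr.eval, h'.2.1 12 (by simp), h'.2.1 13 (by simp), ha, hb, Fin.val_inj] at ht
      by_cases hab : a = b
      · refine (Cmd.Does.ite_pos (ht.ne_zero.2 hab) (Cmd.does_skip ?_)).le (by simp [Expr.cost])
        subst hab
        convert h'.1 using 1
        rw [hya, apply_collapse_self]
      · refine (Cmd.Does.ite_neg (ht.2 hab) ((freeze_does (q := 13) (t := 1) (u := b) (m := n)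
          h'.1 (by rw [h'.2.1 13 (by simp), hb]) (by rw [h'.2.1 1 (by simp), h.nodes])
          (by simp only [List.length_cons]; omega) (by simp)).mono le_rfl fun h'' => ?_)).le
          (by simp [Expr.cost])
        convert h''.1 using 1
        rw [hya, hyb, apply_collapse_of_ne hab]
  exact hthird.le (by omega)

/-- Make the node on top of the stack, in variable `5`, active with the color in variable `4`. -/
def activate : Cmd :=
  (Cmd.put 0 (.var 5) (.var 4)).seq ((Cmd.put 3 (.var 5) (.const 1)).seq
    ((Cmd.set 3 (.op .sub (.var 3) (.const 1))).seq (.set 0 (.op .eq (.var 3) (.const 0)))))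

theorem activate_does (h1 : 1 < 2 ^ w) (h : Rep adj s x i) {v : Fin n} {l : List (Fin n)} {c : Fin k}
    (hs : i.stk = v :: l) (hv : s.var 5 = v) (hc : s.var 4 = c) (hl : i.stk.length < 2 ^ w) :
    activate.Does w s 20 fun s' => Rep adj s' (Function.update x v c) (i.apply .activate) := by
  refine ⟨?_, by simp [activate, Cmd.dur, Expr.cost]⟩
  have hlen : l.length < 2 ^ w := by
    rw [hs, List.length_cons] at hl
    omega
  have htop : s.var 3 = l.length + 1 := by rw [h.top, hs, List.length_cons]
  have hrun : activate.run w s = (((s.setArr 0 v c).setArr 3 v 1).setVar 3 l.length).setVar 0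
      (if l.length = 0 then 1 else 0) := by
    have : (if l.length = 0 then 1 else 0) % 2 ^ w = if l.length = 0 then 1 else 0 := by
      split_ifs
      · exact Nat.mod_eq_of_lt h1
      · simp
    simp only [activate, Cmd.run, Expr.eval, BinOp.run, hv, hc, htop, Nat.mod_eq_of_lt h1,
      Store.setVar_var, Store.setArr_var, Nat.add_sub_cancel, Nat.zero_mod, if_true,
        Nat.mod_eq_of_lt hlen, this]
  rw [hrun]
  simp only [Idx.apply, hs]
  refine ⟨by simpa using h.nodes, by simpa using h.colors, ⟨?_, ?_⟩, fun u => ?_, fun u => ?_,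
    fun u d hu => ?_, fun u => ?_, ?_, fun j u hj => ?_, ?_⟩
  · simpa using h.graph.off
  · simpa using h.graph.nb
  · by_cases hu : u = v
    · simp [hu]
    · simpa [hu, Fin.val_inj] using h.col u
  · by_cases hu : u = v
    · simp [hu]
    · simpa [hu, Fin.val_inj] using h.act u
  · by_cases huv : u = v
    · subst huv
      simp at hu
    · rw [Function.update_of_ne huv]
      exact h.pin u d (by simpa [huv] using hu)
  · simpa using h.th u
  · simp
  · have : i.stk.reverse[j]? = some u := by
      rw [hs, List.reverse_cons, List.getElem?_append_left (List.getElem?_eq_some_iff.1 hj).1, hj]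
    simpa using h.stk j u this
  · simp [List.length_eq_zero_iff]

/-- Lower the threshold of the node in variable `5` to the node in variable `10`. -/
def release : Cmd := .put 4 (.var 5) (.var 10)

theorem release_does (h : Rep adj s x i) {v z : Fin n} {l : List (Fin n)}
    (hs : i.stk = v :: l) (hv : s.var 5 = v) (hz : s.var 10 = z) :
    release.Does w s 3 fun s' => Rep adj s' x (i.apply (.release z)) := by
  refine ⟨?_, le_rfl⟩
  have : release.run w s = s.setArr 4 v z := by simp [release, Cmd.run, Expr.eval, hv, hz]
  rw [this]
  simpa [Idx.apply, hs] using h.setTh v z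

end Program

/-! ### What the loops over the neighbors compute -/

namespace Program

variable {n k : ℕ} {G : SimpleGraph (Fin n)} {adj : Fin n → List (Fin n)} {x : Fin n → Fin k}
  {i : Idx n k} {z : Fin n}

/-- A running maximum, shifted by one so that `0` stands for no node, finds the target. -/
theorem foldl_target (hadj : IsAdjacencyList G adj) (v : Fin n) :
    (adj v).foldl (fun (m : ℕ) u =>
      if i.pin u = none ∧ (u : ℕ) < i.th v ∧ m < u + 1 then (u : ℕ) + 1 else m) 0
        = (i.target G v).elim 0 fun z => (z : ℕ) + 1 := by
  have key : ∀ (l : List (Fin n)) (m : ℕ), m = l.foldl (fun (m : ℕ) u =>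
      if i.pin u = none ∧ (u : ℕ) < i.th v ∧ m < u + 1 then (u : ℕ) + 1 else m) 0 →
      (m = 0 ∧ ∀ u ∈ l, ¬ (i.pin u = none ∧ (u : ℕ) < i.th v)) ∨
      ∃ u ∈ l, (i.pin u = none ∧ (u : ℕ) < i.th v) ∧ m = u + 1 ∧
        ∀ u' ∈ l, (i.pin u' = none ∧ (u' : ℕ) < i.th v) → u' ≤ u := by
    intro l
    induction l using List.reverseRecOn with
    | nil => simp
    | append_singleton l u ih =>
      rintro m rfl
      rw [List.foldl_append, List.foldl_cons, List.foldl_nil]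
      rcases ih _ rfl with ⟨hm, h⟩ | ⟨u₀, hu₀, hP, hm, h⟩
      · rw [hm]
        by_cases hu : i.pin u = none ∧ (u : ℕ) < i.th v
        · refine Or.inr ⟨u, by simp, hu, by simp [hu], fun u' hu' hP' => ?_⟩
          rcases List.mem_append.1 hu' with h' | h'
          · exact absurd hP' (h u' h')
          · simp_all
        · refine Or.inl ⟨if_neg fun h' => hu ⟨h'.1, h'.2.1⟩, fun u' hu' => ?_⟩
          rcases List.mem_append.1 hu' with h' | h'
          · exact h u' h'
          · simp_all
      · rw [hm]
        by_cases hu : i.pin u = none ∧ (u : ℕ) < i.th v ∧ (u₀ : ℕ) + 1 < u + 1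
        · refine Or.inr ⟨u, by simp, ⟨hu.1, hu.2.1⟩, if_pos hu, fun u' hu' hP' => ?_⟩
          rcases List.mem_append.1 hu' with h' | h'
          · have := Fin.le_def.1 (h u' h' hP')
            rw [Fin.le_def]
            omega
          · simp_all
        · refine Or.inr ⟨u₀, by simp [hu₀], hP, if_neg hu, fun u' hu' hP' => ?_⟩
          rcases List.mem_append.1 hu' with h' | h'
          · exact h u' h' hP'
          · obtain rfl : u' = u := by simpa using h'
            rw [Fin.le_def]
            by_contra hlt
            exact hu ⟨hP'.1, hP'.2, by omega⟩
  rcases key _ _ rfl with ⟨hm, h⟩ | ⟨u, hu, hP, hm, h⟩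
  · have : i.target G v = none := Idx.target_eq_none.2 fun u hu => by
      rw [Idx.mem_actNb] at hu
      exact not_lt.1 fun hlt => h u (((hadj v).2 u).2 hu.1) ⟨hu.2, hlt⟩
    rw [hm, this]
    rfl
  · have : i.target G v = some u := Idx.target_eq_some.2 ⟨Idx.mem_actNb.2 ⟨((hadj v).2 u).1 hu, hP.1⟩,
      hP.2, fun u' hu' hlt => by
        rw [Idx.mem_actNb] at hu'
        exact h u' (((hadj v).2 u').2 hu'.1) ⟨hu'.2, hlt⟩⟩
    rw [hm, this]
    rfl

theorem IsLeast.lt_iff {l : List (Fin n)} {P : Fin n → Prop} {m : ℕ} (h : IsLeast l P m) :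
    m < n ↔ ∃ u ∈ l, P u := by
  rcases h with ⟨rfl, h⟩ | ⟨u, hu, hP, rfl, -⟩
  · simpa using h
  · exact ⟨fun _ => ⟨u, hu, hP⟩, fun _ => u.2⟩

theorem IsLeast.eq_of_lt {l : List (Fin n)} {P : Fin n → Prop} {m : ℕ} (h : IsLeast l P m)
    (hm : m < n) : ∃ u ∈ l, P u ∧ m = u ∧ ∀ u' ∈ l, P u' → u ≤ u' := by
  rcases h with ⟨rfl, -⟩ | h
  · exact absurd hm (lt_irrefl _)
  · exact h

theorem IsLeast.known_iff (hadj : IsAdjacencyList G adj) (hpin : ∀ v c, i.pin v = some c → x v = c)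
    {d : Fin k} {m : ℕ}
    (h : IsLeast (adj z) (fun u => (i.pin u ≠ none ∧ (z : ℕ) < i.th u) ∧ (x u : ℕ) = d) m) :
    m < n ↔ i.Known G z d := by
  rw [h.lt_iff]
  constructor
  · rintro ⟨u, hu, ⟨hp, hlt⟩, hx⟩
    obtain ⟨c, hc⟩ := Option.ne_none_iff_exists'.1 hp
    refine ⟨u, ((hadj z).2 u).1 hu, hlt, ?_⟩
    rw [hc, ← hpin u c hc, Fin.ext hx]
  · rintro ⟨u, hu, hlt, hp⟩
    exact ⟨u, ((hadj z).2 u).2 hu, ⟨by simp [hp], hlt⟩, by rw [hpin u d hp]⟩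

theorem IsLeast.first_eq (hadj : IsAdjacencyList G adj) {d : Fin k} {m : ℕ}
    (h : IsLeast (adj z) (fun u => i.pin u = none ∧ (x u : ℕ) = d) m) :
    m = (i.first G z x d).elim n Fin.val := by
  rcases h with ⟨rfl, h⟩ | ⟨u, hu, hP, rfl, h⟩
  · have : i.first G z x d = none := Idx.first_eq_none.2 fun w hw he => by
      rw [Idx.mem_actNb] at hw
      exact h w (((hadj z).2 w).2 hw.1) ⟨hw.2, by rw [he]⟩
    rw [this]
    rfl
  · have : i.first G z x d = some u := by
      refine Idx.first_eq_some.2 ⟨Idx.mem_actNb.2 ⟨((hadj z).2 u).1 hu, hP.1⟩, Fin.ext hP.2,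
        fun w hw hlt he => ?_⟩
      rw [Idx.mem_actNb] at hw
      exact absurd (h w (((hadj z).2 w).2 hw.1) ⟨hw.2, by rw [he]⟩) (not_le.2 hlt)
    rw [this]
    rfl

open Classical in
theorem countP_eq_card (hadj : IsAdjacencyList G adj) (P : Fin n → Prop)
    [DecidablePred P] : (adj z).countP (fun u => P u) =
      (Finset.univ.filter fun u => G.Adj z u ∧ P u).card := by
  rw [List.countP_eq_length_filter, ← List.toFinset_card_of_nodup ((hadj z).1.filter _)]
  congr 1
  ext u
  simp [(hadj z).2 u]

/-- For every color `d` of a neighbor of `z`, `M₁ d` is the smallest inactive neighbor of color `d`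
that forbids it to `z`, and `M₂ d` is the smallest active one. -/
structure Tables (adj : Fin n → List (Fin n)) (x : Fin n → Fin k) (i : Idx n k) (z : Fin n)
    (M₁ M₂ : ℕ → ℕ) : Prop where
  inactive : ∀ v ∈ adj z, IsLeast (adj z)
    (fun u => (i.pin u ≠ none ∧ (z : ℕ) < i.th u) ∧ (x u : ℕ) = x v) (M₁ (x v))
  active : ∀ v ∈ adj z, IsLeast (adj z) (fun u => i.pin u = none ∧ (x u : ℕ) = x v) (M₂ (x v))

/-- The neighbor `u` of `z` stands for the known color `x u`. -/
def KnownRep (x : Fin n → Fin k) (i : Idx n k) (z : Fin n) (M₁ : ℕ → ℕ) (u : Fin n) : Prop :=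
  (i.pin u ≠ none ∧ (z : ℕ) < i.th u) ∧ M₁ (x u) = u

/-- The neighbor `u` of `z` stands for the forbidden color `x u`. -/
def ForbRep (x : Fin n → Fin k) (i : Idx n k) (z : Fin n) (M₁ M₂ : ℕ → ℕ) (u : Fin n) : Prop :=
  KnownRep x i z M₁ u ∨ (i.pin u = none ∧ M₁ (x u) = n ∧ M₂ (x u) = u)

variable {M₁ M₂ : ℕ → ℕ}

theorem Tables.coincides_iff (hadj : IsAdjacencyList G adj)
    (hpin : ∀ v c, i.pin v = some c → x v = c) (h : Tables adj x i z M₁ M₂) {w : Fin n}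
    (hw : w ∈ adj z) :
    i.Coincides G z x w ↔ i.pin w = none ∧ (M₁ (x w) < n ∨ M₂ (x w) < w) := by
  rw [Idx.Coincides, Idx.mem_known, ← (h.inactive w hw).known_iff hadj hpin, Idx.mem_actNb,
    ← (hadj z).2 w]
  simp only [hw, true_and]
  refine and_congr_right fun hp => or_congr_right ?_
  constructor
  · rintro ⟨w', hw', hlt, he⟩
    rw [Idx.mem_actNb, ← (hadj z).2 w'] at hw'
    rcases h.active w hw with ⟨-, h'⟩ | ⟨u, -, -, hu, h'⟩
    · exact absurd ⟨hp, rfl⟩ (h' w hw)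
    · have := h' w' hw'.1 ⟨hw'.2, by rw [he]⟩
      rw [hu]
      exact Fin.lt_def.1 (this.trans_lt hlt)
  · intro hlt
    obtain ⟨u, hu, hP, he, -⟩ := (h.active w hw).eq_of_lt (hlt.trans w.2)
    exact ⟨u, Idx.mem_actNb.2 ⟨((hadj z).2 u).1 hu, hP.1⟩, Fin.lt_def.2 (he ▸ hlt), Fin.ext hP.2⟩

open Classical in
theorem Tables.known_eq (hadj : IsAdjacencyList G adj)
    (hpin : ∀ v c, i.pin v = some c → x v = c) (h : Tables adj x i z M₁ M₂) :
    i.known G z = (Finset.univ.filter fun u => G.Adj z u ∧ KnownRep x i z M₁ u).image x := by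
  ext c
  rw [Idx.mem_known, Finset.mem_image]
  constructor
  · rintro ⟨f, hf, hlt, hc⟩
    have hx := hpin f c hc
    have hf' := ((hadj z).2 f).2 hf
    obtain ⟨u, hu, hP, he, -⟩ := (h.inactive f hf').eq_of_lt
      ((h.inactive f hf').lt_iff.2 ⟨f, hf', ⟨by simp [hc], hlt⟩, rfl⟩)
    refine ⟨u, Finset.mem_filter.2 ⟨Finset.mem_univ _, ((hadj z).2 u).1 hu, hP.1, ?_⟩, ?_⟩
    · rw [hP.2, he]
    · rw [← hx, Fin.ext hP.2]
  · rintro ⟨u, hu, rfl⟩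
    obtain ⟨-, hu, ⟨hp, hlt⟩, -⟩ := Finset.mem_filter.1 hu
    obtain ⟨c, hc⟩ := Option.ne_none_iff_exists'.1 hp
    exact ⟨u, hu, hlt, by rw [hc, hpin u c hc]⟩

open Classical in
theorem Tables.forb_eq (hadj : IsAdjacencyList G adj)
    (hpin : ∀ v c, i.pin v = some c → x v = c) (h : Tables adj x i z M₁ M₂) :
    i.forb G z x = (Finset.univ.filter fun u => G.Adj z u ∧ ForbRep x i z M₁ M₂ u).image x := by
  ext c
  rw [Idx.forb, Finset.mem_union, h.known_eq hadj hpin]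
  simp only [Finset.mem_image, Finset.mem_filter, Finset.mem_univ, true_and, Idx.mem_actNb]
  constructor
  · rintro (⟨u, ⟨hu, hr⟩, rfl⟩ | ⟨u, ⟨hu, hp⟩, rfl⟩)
    · exact ⟨u, ⟨hu, Or.inl hr⟩, rfl⟩
    · have hu' := ((hadj z).2 u).2 hu
      rcases h.inactive u hu' with ⟨hm, -⟩ | ⟨f, hf, hP, he, -⟩
      · obtain ⟨a, ha, hP, he, -⟩ := (h.active u hu').eq_of_lt
          ((h.active u hu').lt_iff.2 ⟨u, hu', hp, rfl⟩)
        refine ⟨a, ⟨((hadj z).2 a).1 ha, Or.inr ⟨hP.1, ?_, ?_⟩⟩, Fin.ext hP.2⟩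
        · rw [hP.2, hm]
        · rw [hP.2, he]
      · exact ⟨f, ⟨((hadj z).2 f).1 hf, Or.inl ⟨hP.1, by rw [hP.2, he]⟩⟩, Fin.ext hP.2⟩
  · rintro ⟨u, ⟨hu, hr | ⟨hp, -⟩⟩, rfl⟩
    · exact Or.inl ⟨u, ⟨hu, hr⟩, rfl⟩
    · exact Or.inr ⟨u, ⟨hu, hp⟩, rfl⟩

theorem ForbRep.eq_of_eq {u u' : Fin n} (h : ForbRep x i z M₁ M₂ u) (h' : ForbRep x i z M₁ M₂ u')
    (hx : x u = x u') : u = u' := by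
  have hu := u.2
  have hu' := u'.2
  refine Fin.ext ?_
  rcases h with ⟨-, h1⟩ | ⟨-, h1, h2⟩ <;> rcases h' with ⟨-, h1'⟩ | ⟨-, h1', h2'⟩ <;>
    rw [hx] at h1 <;> try rw [hx] at h2
  all_goals omega

open Classical in
/-- The load is the number of active neighbors and of representatives of known colors. -/
theorem Tables.load_eq (hadj : IsAdjacencyList G adj)
    (hpin : ∀ v c, i.pin v = some c → x v = c) (h : Tables adj x i z M₁ M₂) :
    (adj z).countP (fun u => i.pin u = none ∨ KnownRep x i z M₁ u) = i.load G z := by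
  rw [countP_eq_card hadj fun u => _ ∨ _, Idx.load, h.known_eq hadj hpin,
    Finset.card_image_of_injOn, add_comm,
    ← Finset.card_union_of_disjoint]
  · congr 1
    ext u
    simp only [Finset.mem_filter, Finset.mem_univ, true_and, Finset.mem_union, Idx.mem_actNb]
    tauto
  · refine Finset.disjoint_left.2 fun u hu hu' => ?_
    exact (Finset.mem_filter.1 hu').2.2.1.1 (Idx.mem_actNb.1 hu).2
  · intro u hu u' hu' hx
    exact ForbRep.eq_of_eq (M₂ := M₂) (Or.inl (Finset.mem_filter.1 hu).2.2)
      (Or.inl (Finset.mem_filter.1 hu').2.2) hx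

open Classical in
/-- The rank is found by counting smaller forbidden colors, not available ones, so that the time does
not depend on the number of colors. -/
theorem Tables.rank_eq (hadj : IsAdjacencyList G adj)
    (hpin : ∀ v c, i.pin v = some c → x v = c) (h : Tables adj x i z M₁ M₂) (d : Fin k) :
    (d : ℕ) - (adj z).countP (fun u => ForbRep x i z M₁ M₂ u ∧ x u < d) = i.rank G z x d := by
  have h1 : ((i.forb G z x).filter (· < d)).card
      = (adj z).countP (fun u => ForbRep x i z M₁ M₂ u ∧ x u < d) := by
    rw [countP_eq_card hadj fun u => _ ∧ _, h.forb_eq hadj hpin, Finset.filter_image,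
      Finset.card_image_of_injOn]
    · congr 1
      ext u
      simp only [Finset.mem_filter, Finset.mem_univ, true_and, and_assoc]
    · intro u hu u' hu' hx
      exact ForbRep.eq_of_eq (Finset.mem_filter.1 (Finset.mem_filter.1 hu).1).2.2
        (Finset.mem_filter.1 (Finset.mem_filter.1 hu').1).2.2 hx
  have h2 : ((i.forb G z x).filter (· < d)).card + ((i.forb G z x)ᶜ.filter (· < d)).card = d := by
    rw [← Finset.card_union_of_disjoint, ← Finset.filter_union, Finset.union_compl]
    · exact (congrArg Finset.card (by ext; simp)).trans (Fin.card_Iio d)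
    · exact Finset.disjoint_filter_filter disjoint_compl_right
  rw [Idx.rank, ← h1]
  omega

/-- Once a node has been found, that is, the counter is below `n`, the search leaves it as it is. -/
theorem foldl_search_of_lt (p : Fin n → Prop) [DecidablePred p] (l : List (Fin n)) {m : ℕ}
    (hm : m < n) : l.foldl (fun m u => if p u ∧ n ≤ m then if m = n then (u : ℕ) else m - 1 else m) m
      = m := by
  induction l with
  | nil => rfl
  | cons a l ih => rw [List.foldl_cons, if_neg (by omega), ih]

theorem foldl_search_le (p : Fin n → Prop) [DecidablePred p] (l : List (Fin n)) (m : ℕ) :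
    l.foldl (fun m u => if p u ∧ n ≤ m then if m = n then (u : ℕ) else m - 1 else m) m ≤ m := by
  induction l generalizing m with
  | nil => exact le_rfl
  | cons a l ih =>
    rw [List.foldl_cons]
    refine (ih _).trans ?_
    have := a.2
    split_ifs <;> omega

/-- Counting down from `n + s` finds the node in position `s` of the filtered list. -/
theorem foldl_search (p : Fin n → Prop) [DecidablePred p] (l : List (Fin n)) (s : ℕ) :
    l.foldl (fun m u => if p u ∧ n ≤ m then if m = n then (u : ℕ) else m - 1 else m) (n + s)
      = ((l.filter fun u => p u)[s]?).elim (n + s - (l.filter fun u => p u).length) Fin.val := by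
  induction l generalizing s with
  | nil => simp
  | cons a l ih =>
    rw [List.foldl_cons]
    by_cases ha : p a
    · rw [List.filter_cons_of_pos (by simpa using ha)]
      cases s with
      | zero =>
        rw [if_pos ⟨ha, by omega⟩, if_pos (Nat.add_zero n), foldl_search_of_lt _ _ a.2]
        simp
      | succ s =>
        rw [if_pos ⟨ha, by omega⟩, if_neg (by omega), show n + (s + 1) - 1 = n + s by omega, ih]
        rw [List.getElem?_cons_succ, List.length_cons]
        congr 1
        omega
    · rw [if_neg (fun h => ha h.1), ih, List.filter_cons_of_neg (by simpa using ha)]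

end Program

/-! ### Activation in the program -/

namespace Cmd

variable {w : ℕ}

theorem Does.bind {c d : Cmd} {s : Store} {T T' : ℕ} {Q Q' : Store → Prop}
    (h : c.Does w s T Q) (h' : ∀ s', Q s' → d.Does w s' T' Q') : (c.seq d).Does w s (T + T') Q' :=
  h.seq (h' _)

theorem does_set {v : ℕ} {e : Expr} {s : Store} {m : ℕ} (h : e.eval w s = m) :
    (set v e).Does w s (e.cost + 1) fun s' => s' = s.setVar v m :=
  ⟨by rw [run, h], le_rfl⟩

theorem does_put {a : ℕ} {e f : Expr} {s : Store} {j m : ℕ} (he : e.eval w s = j)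
    (hf : f.eval w s = m) :
    (put a e f).Does w s (e.cost + f.cost + 1) fun s' => s' = s.setArr a j m :=
  ⟨by rw [run, he, hf], le_rfl⟩

theorem Does.ite {c d : Cmd} {e : Expr} {s : Store} {T : ℕ} {P : Prop} {Q : Store → Prop}
    (he : e.Tests w s P) (hc : P → c.Does w s T Q) (hd : ¬ P → d.Does w s T Q) :
    (Cmd.ite e c d).Does w s (e.cost + 1 + T) Q := by
  by_cases hP : P
  · exact ite_pos (he.ne_zero.2 hP) (hc hP)
  · exact ite_neg (he.2 hP) (hd hP)

end Cmd

namespace Program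

open Cmd (does_set does_put does_skip)

variable {n k w D : ℕ} {G : SimpleGraph (Fin n)} {adj : Fin n → List (Fin n)} {s : Store}
  {x : Fin n → Fin k} {i : Idx n k}

theorem agrees_setVar {X Y : List ℕ} {v : ℕ} (hv : v ∈ X) (s : Store) (m : ℕ) :
    Agrees X Y s (s.setVar v m) :=
  ⟨fun x hx => by rw [Store.setVar_var, if_neg (by rintro rfl; exact hx hv)], fun _ _ => rfl⟩

theorem agrees_setArr {X Y : List ℕ} {a : ℕ} (ha : a ∈ Y) (s : Store) (j m : ℕ) :
    Agrees X Y s (s.setArr a j m) :=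
  ⟨fun _ _ => rfl, fun b hb => by
    funext l
    rw [Store.setArr_arr, if_neg (by rintro ⟨rfl, -⟩; exact hb ha)]⟩

/-- The node in variable `9` is active. -/
def active : Expr := .get 3 (.var 9)

/-- The node in variable `9` is inactive, and forbids its color to the node in variable `q` if that
is active. -/
def live (q : ℕ) : Expr := .op .mul (.op .sub (.const 1) active) (.op .lt (.var q) (.get 4 (.var 9)))

theorem tests_active (h : Rep adj s x i) {u : Fin n} (hu : s.var 9 = u) :
    active.Tests w s (i.pin u = none) := by
  constructor <;> intro h' <;> simp [active, Expr.eval, hu, h.act, h']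

theorem tests_live (h1 : 1 < 2 ^ w) (h : Rep adj s x i) {q : ℕ} {u z : Fin n} (hu : s.var 9 = u)
    (hz : s.var q = z) : (live q).Tests w s (i.pin u ≠ none ∧ (z : ℕ) < i.th u) := by
  have ht := ((tests_active (w := w) h hu).not h1).and h1
    (Expr.tests_lt (e := .var q) (f := .get 4 (.var 9)) h1)
  simp only [Expr.eval, hz, hu, h.th] at ht
  exact ht

/-- Set variable `5` to the top of the stack, and variable `7` to `z + 1` if `z` is the largest active
neighbor to which it forbids its color, and to `0` if there is none. -/
def findTarget : Cmd :=
  (Cmd.set 5 (.get 5 (.op .sub (.var 3) (.const 1)))).seq ((Cmd.set 7 (.const 0)).seq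
    (forNb 5 (.ite (.op .mul active (.op .mul (.op .lt (.var 9) (.get 4 (.var 5)))
      (.op .lt (.var 7) (.op .add (.var 9) (.const 1))))) (.set 7 (.op .add (.var 9) (.const 1)))
      .skip)))

theorem findTarget_does (hadj : IsAdjacencyList G adj) (hw : Fits n k w adj)
    (hD : ∀ v, (adj v).length ≤ D) (h : Rep adj s x i) {v : Fin n} {l : List (Fin n)}
    (hs : i.stk = v :: l) (hl : i.stk.length ≤ n) :
    findTarget.Does w s (50 + D * 50) fun s' => s'.var 5 = v ∧
      s'.var 7 = (i.target G v).elim 0 (fun z => (z : ℕ) + 1) ∧ Agrees [5, 7, 8, 9] [] s s' := by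
  have hsm := hw.small
  have h1 : 1 < 2 ^ w := by omega
  have htop : s.arr 5 ((s.var 3 - 1) % 2 ^ w) = v := by
    rw [Nat.mod_eq_of_lt (by rw [h.top]; omega), h.stk_head hs]
  refine ((does_set (m := v) ?_).bind (T' := 2 + (20 + D * 33)) ?_).le ?_
  · simpa [Expr.eval, BinOp.run, Nat.mod_eq_of_lt h1] using htop
  · rintro _ rfl
    refine (does_set (m := 0) (by simp [Expr.eval])).bind ?_
    rintro _ rfl
    have hag : Agrees [5, 7, 8, 9] [] s ((s.setVar 5 v).setVar 7 0) :=
      (agrees_setVar (by simp) _ _).trans (agrees_setVar (by simp) _ _)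
    have h' := h.agrees hag (by simp) (by simp)
    refine (forNb_fold (c := .ite (.op .mul active (.op .mul (.op .lt (.var 9) (.get 4 (.var 5)))
      (.op .lt (.var 7) (.op .add (.var 9) (.const 1))))) (.set 7 (.op .add (.var 9) (.const 1)))
      .skip) hw hD (t := 7) ⟨trivial, trivial⟩ (fun x hx => ⟨hx, trivial⟩)
      (fun a => ⟨trivial, trivial⟩) (by omega) (by omega) (by omega) h'.graph v (by simp)
      (fun (m : ℕ) u => if i.pin u = none ∧ (u : ℕ) < i.th v ∧ m < u + 1 then (u : ℕ) + 1 else m)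
      ?_).mono ?_ ?_
    · intro l' u s' _ hu hs' _
      have h'' := h'.agrees hs' (by simp) (by simp)
      have h5 : s'.var 5 = v := by rw [hs'.1 5 (by simp)]; simp
      have hu1 : ((u : ℕ) + 1) % 2 ^ w = u + 1 := Nat.mod_eq_of_lt (by have := u.2; omega)
      have ht := (tests_active (w := w) h'' hu).and h1 ((Expr.tests_lt (e := .var 9)
        (f := .get 4 (.var 5)) h1).and h1 (Expr.tests_lt (e := .var 7)
        (f := .op .add (.var 9) (.const 1)) h1))
      simp only [Expr.eval, BinOp.run, hu, h5, h''.th, Nat.mod_eq_of_lt h1, hu1] at ht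
      rw [Cmd.run]
      by_cases hP : i.pin u = none ∧ (u : ℕ) < i.th v ∧ s'.var 7 < u + 1
      · rw [if_pos (ht.ne_zero.2 hP), if_pos hP]
        simp [Cmd.run, Expr.eval, BinOp.run, hu, Nat.mod_eq_of_lt h1, hu1]
      · rw [if_neg (fun h => hP (ht.ne_zero.1 h)), if_neg hP]
        rfl
    · simp only [Cmd.cost, Expr.cost, active]
      omega
    · rintro ⟨h7, hag'⟩
      refine ⟨by rw [hag'.1 5 (by simp)]; simp, ?_, hag.trans (hag'.mono (by simp) (by simp))⟩
      rw [h7, ← foldl_target hadj]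
      simp
  · simp only [Expr.cost]
    omega

/-- Set up the tables of the node in variable `q` in the arrays `6` and `7`. -/
def tables (q : ℕ) : Cmd := (fill 6 q (live q)).seq (fill 7 q active)

theorem tables_does (hw : Fits n k w adj) (hD : ∀ v, (adj v).length ≤ D) (h : Rep adj s x i) {q : ℕ}
    (hq8 : q ≠ 8) (hq9 : q ≠ 9) {z : Fin n} (hz : s.var q = z) :
    (tables q).Does w s (80 + D * 100) fun s' => (∀ d,
      (s.arr 6 d = n ∧ s.arr 7 d = n) ∨ (∃ u ∈ adj z, (x u : ℕ) = d) →
        IsLeast (adj z) (fun u => (i.pin u ≠ none ∧ (z : ℕ) < i.th u) ∧ (x u : ℕ) = d) (s'.arr 6 d) ∧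
        IsLeast (adj z) (fun u => i.pin u = none ∧ (x u : ℕ) = d) (s'.arr 7 d)) ∧
      Agrees [8, 9] [6, 7] s s' := by
  have h1 : 1 < 2 ^ w := by have := hw.small; omega
  refine ((fill_does (P := fun u => i.pin u ≠ none ∧ (z : ℕ) < i.th u) hw hD (by omega) (by omega)
    (by omega) hq8 hq9 h.graph h.nodes z hz ?_).bind (T' := 40 + D * 42) ?_).le ?_
  · intro u _ s' hu hs'
    exact tests_live h1 (h.agrees hs' (by simp) (by simp)) hu (by rw [hs'.1 q (by simp [hq8, hq9]), hz])
  · rintro s₁ ⟨h6, hag⟩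
    have h' := h.agrees hag (by simp) (by simp)
    refine (fill_does (P := fun u => i.pin u = none) hw hD (by omega) (by omega)
      (by omega) hq8 hq9 h'.graph h'.nodes z (by rw [hag.1 q (by simp [hq8, hq9]), hz]) ?_).mono ?_ ?_
    · intro u _ s' hu hs'
      exact tests_active (h'.agrees hs' (by simp) (by simp)) hu
    · simp [active, Expr.cost]
    · rintro ⟨h7, hag'⟩
      refine ⟨fun d hd => ⟨?_, ?_⟩, (hag.mono (by simp) (by simp)).trans (hag'.mono (by simp) (by simp))⟩
      · rw [hag'.2 6 (by simp)]
        simpa only [h.col] using h6 d (by simpa only [h.col] using hd.imp_left And.left)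
      · simpa only [h'.col] using h7 d (by
          rw [hag.2 7 (by simp)]
          simpa only [h'.col] using hd.imp_left And.right)
  · simp only [live, active, Expr.cost]
    omega

/-- Try to activate the node in variable `5` with the color in variable `4`. -/
def add : Cmd :=
  (Cmd.put 6 (.var 4) (.var 1)).seq ((Cmd.put 7 (.var 4) (.var 1)).seq ((tables 5).seq
    (.ite (.op .lt (.var 4) (.var 2))
      (.ite (.op .lt (.get 6 (.var 4)) (.var 1)) .skip
        (.ite (.op .lt (.get 7 (.var 4)) (.var 1))
          ((Cmd.set 10 (.var 5)).seq ((Cmd.set 11 (.var 4)).seq ((Cmd.set 12 (.get 7 (.var 4))).seq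
            ((Cmd.set 13 (.var 12)).seq collapse))))
          activate))
      .skip)))

theorem add_does (hadj : IsAdjacencyList G adj) (hw : Fits n k w adj)
    (hD : ∀ v, (adj v).length ≤ D) (h : Rep adj s x i) {v : Fin n} {l : List (Fin n)}
    (hs : i.stk = v :: l) (hl : i.stk.length ≤ n) (hv : s.var 5 = v) {r : ℕ} (hr : s.var 4 = r) :
    add.Does w s (200 + D * 100) fun s' =>
      Rep adj s' (i.add G v x r).2 (i.apply (i.add G v x r).1) := by
  classical
  have hsm := hw.small
  have h1 : 1 < 2 ^ w := by omega
  refine ((does_put (j := r) (m := n) (by simpa [Expr.eval] using hr)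
    (by simpa [Expr.eval] using h.nodes)).bind (T' := 190 + D * 100) ?_).le
    (by simp only [Expr.cost]; omega)
  rintro _ rfl
  refine ((does_put (j := r) (m := n) (by simpa [Expr.eval] using hr)
    (by simpa [Expr.eval] using h.nodes)).bind (T' := 187 + D * 100) ?_).le
    (by simp only [Expr.cost]; omega)
  rintro _ rfl
  have hag : Agrees [] [6, 7] s ((s.setArr 6 r n).setArr 7 r n) :=
    (agrees_setArr (by simp) _ _ _).trans (agrees_setArr (by simp) _ _ _)
  refine ((tables_does hw hD (h.agrees hag (by simp) (by simp)) (q := 5) (by omega) (by omega)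
    hv).bind (T' := 107) ?_).le (by omega)
  rintro s' ⟨hT, hag'⟩
  replace hT := hT r (Or.inl ⟨by simp, by simp⟩)
  replace hag := (hag.mono (by simp) (by simp)).trans hag'
  have h' := h.agrees hag (by simp) (by simp)
  have h4 : s'.var 4 = r := by rw [hag.1 4 (by simp), hr]
  have h5 : s'.var 5 = v := by rw [hag.1 5 (by simp), hv]
  have ht := Expr.tests_lt (w := w) (e := .var 4) (f := .var 2) (s := s') h1
  simp only [Expr.eval, h4, h'.colors] at ht
  refine (Cmd.Does.ite (T := 100) ht (fun hrk => ?_) fun hrk => ?_).le (by simp [Expr.cost])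
  swap
  · refine (does_skip ?_).le (by omega)
    simpa [Idx.add, hrk, Idx.apply] using h'
  have hK := hT.1.known_iff (d := ⟨r, hrk⟩) hadj h.pin
  have hF := hT.2.first_eq (d := ⟨r, hrk⟩) hadj
  replace ht := Expr.tests_lt (w := w) (e := .get 6 (.var 4)) (f := .var 1) (s := s') h1
  simp only [Expr.eval, h4, h'.nodes, hK] at ht
  refine (Cmd.Does.ite (T := 94) ht (fun hk => ?_) fun hk => ?_).le (by simp [Expr.cost])
  · refine (does_skip ?_).le (by omega)
    simpa [Idx.add, hrk, hk, Idx.apply] using h'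
  replace ht := Expr.tests_lt (w := w) (e := .get 7 (.var 4)) (f := .var 1) (s := s') h1
  simp only [Expr.eval, h4, h'.nodes, hF] at ht
  cases hf : i.first G v x ⟨r, hrk⟩ with
  | none =>
    have hadd : i.add G v x r = (.activate, Function.update x v ⟨r, hrk⟩) := by
      simp [Idx.add, hrk, hk, hf]
    rw [hadd]
    exact (Cmd.Does.ite_neg (ht.2 (by simp [hf]))
      (activate_does h1 h' hs h5 (c := ⟨r, hrk⟩) h4 (by omega))).le (by simp [Expr.cost])
  | some u =>
    have hadd : i.add G v x r = (.collapse v ⟨r, hrk⟩ u u, Function.update x v ⟨r, hrk⟩) := by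
      simp [Idx.add, hrk, hk, hf]
    rw [hadd]
    obtain ⟨hu, hxu, -⟩ := Idx.first_eq_some.1 hf
    have huv := Idx.ne_of_mem_actNb hu
    rw [hf] at hF
    refine (Cmd.Does.ite_pos (T := 80) (ht.ne_zero.2 (by simp [hf])) ?_).le (by simp [Expr.cost])
    refine ((does_set (m := v) (by simpa [Expr.eval] using h5)).bind (T' := 78) ?_).le
      (by simp [Expr.cost])
    rintro _ rfl
    refine ((does_set (m := r) (by simpa [Expr.eval] using h4)).bind (T' := 76) ?_).le
      (by simp [Expr.cost])
    rintro _ rfl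
    refine ((does_set (m := u) (by simpa [Expr.eval, h4] using hF)).bind (T' := 70) ?_).le
      (by simp [Expr.cost])
    rintro _ rfl
    refine ((does_set (m := u) (by simp [Expr.eval])).bind (T' := 60) ?_).le
      (by simp [Expr.cost])
    rintro _ rfl
    refine collapse_does (h'.agrees (X := [10, 11, 12, 13]) (Y := []) ((((agrees_setVar (by simp) _ _).trans
      (agrees_setVar (by simp) _ _)).trans (agrees_setVar (by simp) _ _)).trans
      (agrees_setVar (by simp) _ _)) (by simp) (by simp)) (by simp) (by simp) (by simp) (by simp)
      huv huv hxu hxu (by omega) (by simp [hs])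

end Program

/-! ### Loads, ranks and coinciding neighbors in the program -/

namespace Program

open Cmd (does_set does_put does_skip)

variable {n k w D : ℕ} {G : SimpleGraph (Fin n)} {adj : Fin n → List (Fin n)} {s : Store}
  {x : Fin n → Fin k} {i : Idx n k} {z : Fin n}

/-- `KnownRep` for the node in variable `9`, with the tables of the node in variable `q`. -/
def knownRep (q : ℕ) : Expr := .op .mul (live q) (.op .eq (.get 6 (.get 0 (.var 9))) (.var 9))

/-- `ForbRep` for the node in variable `9`, with the tables of the node in variable `q`. -/
def forbRep (q : ℕ) : Expr :=
  .or (knownRep q) (.op .mul active (.op .mul (.op .eq (.get 6 (.get 0 (.var 9))) (.var 1))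
    (.op .eq (.get 7 (.get 0 (.var 9))) (.var 9))))

/-- The node in variable `9` coincides with another neighbor of the node whose tables have been set
up. -/
def coincides : Expr :=
  .op .mul active (.or (.op .lt (.get 6 (.get 0 (.var 9))) (.var 1))
    (.op .lt (.get 7 (.get 0 (.var 9))) (.var 9)))

theorem tests_knownRep (h1 : 1 < 2 ^ w) (h : Rep adj s x i) {q : ℕ} {u : Fin n} (hu : s.var 9 = u)
    (hz : s.var q = z) : (knownRep q).Tests w s (KnownRep x i z (s.arr 6) u) := by
  have ht := (tests_live (w := w) h1 h hu hz).and h1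
    (Expr.tests_eq (e := .get 6 (.get 0 (.var 9))) (f := .var 9) h1)
  simp only [Expr.eval, hu, h.col] at ht
  exact ht

theorem tests_forbRep (h1 : 1 < 2 ^ w) (h : Rep adj s x i) {q : ℕ} {u : Fin n} (hu : s.var 9 = u)
    (hz : s.var q = z) : (forbRep q).Tests w s (ForbRep x i z (s.arr 6) (s.arr 7) u) := by
  have ht := (tests_knownRep h1 h hu hz).or h1 ((tests_active (w := w) h hu).and h1
    ((Expr.tests_eq (e := .get 6 (.get 0 (.var 9))) (f := .var 1) h1).and h1
    (Expr.tests_eq (e := .get 7 (.get 0 (.var 9))) (f := .var 9) h1)))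
  simp only [Expr.eval, hu, h.col, h.nodes] at ht
  exact ht

theorem tests_coincides (hadj : IsAdjacencyList G adj) (h1 : 1 < 2 ^ w) (h : Rep adj s x i)
    (hT : Tables adj x i z (s.arr 6) (s.arr 7)) {u : Fin n} (huz : u ∈ adj z) (hu : s.var 9 = u) :
    coincides.Tests w s (i.Coincides G z x u) := by
  have ht := (tests_active (w := w) h hu).and h1
    ((Expr.tests_lt (e := .get 6 (.get 0 (.var 9))) (f := .var 1) h1).or h1
    (Expr.tests_lt (e := .get 7 (.get 0 (.var 9))) (f := .var 9) h1))
  simp only [Expr.eval, hu, h.col, h.nodes] at ht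
  exact ht.congr (hT.coincides_iff hadj h.pin huz).symm

/-- For the node `z` with `z + 1` in variable `7`, set up the tables and collect the load in variable
`14`, the number of other inactive neighbors that forbid the color of the top of the stack in
variable `15`, and the sum of the rank of the color and the load in variable `16`. -/
def gather : Cmd :=
  (Cmd.set 10 (.op .sub (.var 7) (.const 1))).seq ((tables 10).seq
    ((count 14 10 (.or active (knownRep 10))).seq
    ((count 15 10 (.op .mul (live 10) (.op .mul (.op .eq (.get 0 (.var 9)) (.get 0 (.var 5)))
      (.op .sub (.const 1) (.op .eq (.var 9) (.var 5)))))).seq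
    ((count 16 10 (.op .mul (forbRep 10) (.op .lt (.get 0 (.var 9)) (.get 0 (.var 10))))).seq
    (.set 16 (.op .add (.op .sub (.get 0 (.var 10)) (.var 16)) (.var 14)))))))

theorem gather_does (hadj : IsAdjacencyList G adj) (hw : Fits n k w adj)
    (hD : ∀ v, (adj v).length ≤ D) (h : Rep adj s x i) {v : Fin n} {c : Fin k}
    (hv : s.var 5 = v) (hc : i.pin v = some c) (hz : s.var 7 = z + 1) :
    gather.Does w s (300 + D * 300) fun s' => s'.var 10 = z ∧ s'.var 14 = i.load G z ∧
      (s'.var 15 ≠ 0 ↔ i.Blocked G v c z) ∧ s'.var 16 = i.rank G z x (x z) + i.load G z ∧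
      i.load G z ≤ n ∧
      Tables adj x i z (s'.arr 6) (s'.arr 7) ∧ Agrees [8, 9, 10, 14, 15, 16] [6, 7] s s' := by
  classical
  have hsm := hw.small
  have h1 : 1 < 2 ^ w := by omega
  have hlen : (adj z).length ≤ n := by
    have := (hadj z).1.length_le_card
    rwa [Fintype.card_fin] at this
  have hz' : (z : ℕ) % 2 ^ w = z := Nat.mod_eq_of_lt (by have := z.2; omega)
  refine ((does_set (m := z) (by simpa [Expr.eval, BinOp.run, Nat.mod_eq_of_lt h1, hz] using hz')).bind
    (T' := 200 + D * 300) ?_).le (by simp only [Expr.cost]; omega)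
  rintro _ rfl
  have hag : Agrees [8, 9, 10, 14, 15, 16] [6, 7] s (s.setVar 10 z) := agrees_setVar (by simp) _ _
  refine ((tables_does hw hD (h.agrees hag (by simp) (by simp)) (q := 10) (z := z) (by omega) (by omega)
    (by simp)).bind (T' := 100 + D * 200) ?_).le (by omega)
  rintro s₁ ⟨hT, hag₁⟩
  replace hag := hag.trans (hag₁.mono (by simp) (by simp))
  have h' := h.agrees hag (by simp) (by simp)
  have hT : Tables adj x i z (s₁.arr 6) (s₁.arr 7) :=
    ⟨fun v hv => (hT _ (Or.inr ⟨v, hv, rfl⟩)).1, fun v hv => (hT _ (Or.inr ⟨v, hv, rfl⟩)).2⟩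
  have h10 : s₁.var 10 = z := by rw [hag₁.1 10 (by simp)]; simp
  have h5 : s₁.var 5 = v := by rw [hag.1 5 (by simp), hv]
  clear hag₁
  have hload := hT.load_eq hadj h.pin
  have hle : i.load G z ≤ n := by
    rw [← hload]
    exact List.countP_le_length.trans hlen
  refine ((count_does hw (fun v => (hadj v).1) hD (by omega) (by omega) (by omega) (by omega) h'.graph
    z h10 (fun u => i.pin u = none ∨ KnownRep x i z (s₁.arr 6) u) fun u _ s' hu hs' => ?_).bind
    (T' := 70 + D * 160) ?_).le (by simp only [Expr.cost, Expr.or, knownRep, live, active]; omega)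
  · have h'' := h'.agrees hs' (by simp) (by simp)
    have ht := (tests_active h'' hu).or h1 (tests_knownRep (q := 10) (z := z) h1 h'' hu
      (by rw [hs'.1 10 (by simp), h10]))
    rwa [hs'.2 6 (by simp)] at ht
  rintro s₂ ⟨h14, hag₂⟩
  rw [hload] at h14
  have h'₂ := h'.agrees hag₂ (by simp) (by simp)
  have h10₂ : s₂.var 10 = z := by rw [hag₂.1 10 (by simp), h10]
  have h5₂ : s₂.var 5 = v := by rw [hag₂.1 5 (by simp), h5]
  rw [← hag₂.2 6 (by simp), ← hag₂.2 7 (by simp)] at hT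
  replace hag := hag.trans (hag₂.mono (by simp) (by simp))
  clear hag₂
  refine ((count_does hw (fun v => (hadj v).1) hD (by omega) (by omega) (by omega) (by omega) h'₂.graph
    z h10₂ (fun u => (i.pin u ≠ none ∧ (z : ℕ) < i.th u) ∧ x u = x v ∧ u ≠ v)
    fun u _ s' hu hs' => ?_).bind
    (T' := 40 + D * 100) ?_).le (by simp only [Expr.cost, live, active]; omega)
  · have h'' := h'₂.agrees hs' (by simp) (by simp)
    have ht := (tests_live (z := z) (q := 10) h1 h'' hu (by rw [hs'.1 10 (by simp), h10₂])).and h1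
      ((Expr.tests_eq (e := .get 0 (.var 9)) (f := .get 0 (.var 5)) h1).and h1
        ((Expr.tests_eq (e := .var 9) (f := .var 5) h1).not h1))
    simp only [Expr.eval, hu, h''.col, hs'.1 5 (by simp), h5₂, Fin.val_inj] at ht
    exact ht
  rintro s₃ ⟨h15, hag₃⟩
  have h'₃ := h'₂.agrees hag₃ (by simp) (by simp)
  have h10₃ : s₃.var 10 = z := by rw [hag₃.1 10 (by simp), h10₂]
  rw [← hag₃.2 6 (by simp), ← hag₃.2 7 (by simp)] at hT
  rw [← hag₃.1 14 (by simp)] at h14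
  replace hag := hag.trans (hag₃.mono (by simp) (by simp))
  clear hag₃
  refine ((count_does hw (fun v => (hadj v).1) hD (by omega) (by omega) (by omega) (by omega) h'₃.graph
    z h10₃ (fun u => ForbRep x i z (s₃.arr 6) (s₃.arr 7) u ∧ x u < x z)
    fun u _ s' hu hs' => ?_).bind
    (T' := 10) ?_).le (by simp only [Expr.cost, Expr.or, forbRep, knownRep, live, active]; omega)
  · have h'' := h'₃.agrees hs' (by simp) (by simp)
    have h10 : s'.var 10 = z := by rw [hs'.1 10 (by simp), h10₃]
    have ht := (tests_forbRep (z := z) (q := 10) h1 h'' hu h10).and h1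
      (Expr.tests_lt (e := .get 0 (.var 9)) (f := .get 0 (.var 10)) h1)
    simp only [Expr.eval, hu, h10, h''.col] at ht
    rwa [hs'.2 6 (by simp), hs'.2 7 (by simp)] at ht
  rintro s₄ ⟨h16, hag₄⟩
  have h'₄ := h'₃.agrees hag₄ (by simp) (by simp)
  have h10₄ : s₄.var 10 = z := by rw [hag₄.1 10 (by simp), h10₃]
  have hrank := hT.rank_eq hadj h.pin (x z)
  rw [← hag₄.2 6 (by simp), ← hag₄.2 7 (by simp)] at hT
  rw [← hag₄.1 14 (by simp)] at h14
  rw [← hag₄.1 15 (by simp)] at h15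
  replace hag := hag.trans (hag₄.mono (by simp) (by simp))
  clear hag₄
  refine ((does_set (m := i.rank G z x (x z) + i.load G z) ?_).mono (by simp [Expr.cost]) ?_)
  · have hx := (x z).2
    simp only [Expr.eval, BinOp.run, h10₄, h'₄.col, h16, h14]
    rw [hrank, Nat.mod_eq_of_lt (show i.rank G z x (x z) < 2 ^ w by omega),
      Nat.mod_eq_of_lt (by omega)]
  · intro hs
    rw [hs]
    refine ⟨by simpa using h10₄, by simpa using h14, ?_, by simp, hle, by simpa using hT,
      hag.trans (agrees_setVar (by simp) _ _)⟩
    rw [Store.setVar_var, if_neg (by omega), h15, ← Nat.pos_iff_ne_zero, List.countP_pos_iff]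
    simp only [decide_eq_true_eq, Idx.Blocked]
    refine exists_congr fun f => ?_
    rw [(hadj z).2]
    have hxv := h.pin v c hc
    constructor
    · rintro ⟨hf, ⟨hp, hlt⟩, hx, hne⟩
      obtain ⟨d, hd⟩ := Option.ne_none_iff_exists'.1 hp
      exact ⟨hne, hf, hlt, by rw [hd, ← h.pin f d hd, hx, hxv]⟩
    · rintro ⟨hne, hf, hlt, hp⟩
      exact ⟨hf, ⟨by simp [hp], hlt⟩, by rw [h.pin f c hp, hxv], hne⟩

/-- Set variable `13` to the coinciding neighbor in the position that is the difference of variable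
`16` and the number of colors. -/
def search : Cmd :=
  (Cmd.set 13 (.op .add (.var 1) (.op .sub (.var 16) (.var 2)))).seq
    (forNb 10 (.ite (.op .mul coincides (.op .sub (.const 1) (.op .lt (.var 13) (.var 1))))
      (.ite (.op .eq (.var 13) (.var 1)) (.set 13 (.var 9)) (.set 13 (.op .sub (.var 13) (.const 1))))
      .skip))

open Classical in
theorem search_does (hadj : IsAdjacencyList G adj) (hw : Fits n k w adj)
    (hD : ∀ v, (adj v).length ≤ D) (h : Rep adj s x i)
    (hz : s.var 10 = z) {t : ℕ} (ht : s.var 16 = t) (htb : t < n + k)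
    (hT : Tables adj x i z (s.arr 6) (s.arr 7)) :
    search.Does w s (50 + D * 100) fun s' =>
      ((∃ b, ((adj z).filter fun w => i.Coincides G z x w)[t - k]? = some b ∧ s'.var 13 = b) ∨
        ((adj z).filter fun w => i.Coincides G z x w)[t - k]? = none ∧ n ≤ s'.var 13) ∧
      Agrees [13, 8, 9] [] s s' := by
  have hsm := hw.small
  have h1 : 1 < 2 ^ w := by omega
  refine ((does_set (m := n + (t - k)) ?_).bind (T' := 40 + D * 100) ?_).le
    (by simp only [Expr.cost]; omega)
  · simp only [Expr.eval, BinOp.run, ht, h.nodes, h.colors]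
    rw [Nat.mod_eq_of_lt (show t - k < 2 ^ w by omega), Nat.mod_eq_of_lt (by omega)]
  rintro _ rfl
  have hag : Agrees [13, 8, 9] [] s (s.setVar 13 (n + (t - k))) := agrees_setVar (by simp) _ _
  have h' := h.agrees hag (by simp) (by simp)
  refine (forNb_fold (c := .ite (.op .mul coincides (.op .sub (.const 1) (.op .lt (.var 13) (.var 1))))
      (.ite (.op .eq (.var 13) (.var 1)) (.set 13 (.var 9)) (.set 13 (.op .sub (.var 13) (.const 1))))
      .skip) hw hD (t := 13) ⟨⟨trivial, trivial⟩, trivial⟩ (fun x hx => ⟨⟨hx, hx⟩, trivial⟩)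
      (fun a => ⟨⟨trivial, trivial⟩, trivial⟩) (by omega) (by omega) (by omega) h'.graph z (by simpa)
      (fun (m : ℕ) u => if i.Coincides G z x u ∧ n ≤ m then if m = n then (u : ℕ) else m - 1 else m)
      ?_).mono ?_ ?_
  · intro l' u s' hl hu hs' hm
    have h'' := h'.agrees hs' (by simp) (by simp)
    have hle : s'.var 13 ≤ n + (t - k) := by
      rw [hm]
      refine (foldl_search_le _ _ _).trans ?_
      simp
    have htest := (tests_coincides (w := w) (u := u) hadj h1 h''
      (by rw [hs'.2 6 (by simp), hs'.2 7 (by simp)]; simpa using hT)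
      (hl.subset (by simp)) hu).and h1
      ((Expr.tests_lt (e := .var 13) (f := .var 1) h1).not h1)
    simp only [Expr.eval, h''.nodes, not_lt] at htest
    rw [Cmd.run]
    by_cases hP : i.Coincides G z x u ∧ n ≤ s'.var 13
    · rw [if_pos (htest.ne_zero.2 hP), if_pos hP, Cmd.run]
      have he := Expr.tests_eq (w := w) (e := .var 13) (f := .var 1) (s := s') h1
      simp only [Expr.eval, h''.nodes] at he
      by_cases hn : s'.var 13 = n
      · rw [if_pos (he.ne_zero.2 hn), if_pos hn]
        simp [Cmd.run, Expr.eval, hu]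
      · rw [if_neg (fun h => hn (he.ne_zero.1 h)), if_neg hn]
        simp only [Cmd.run, Expr.eval, BinOp.run, Nat.mod_eq_of_lt h1, Store.setVar_var, if_true]
        exact Nat.mod_eq_of_lt (by omega)
    · rw [if_neg (fun h => hP (htest.ne_zero.1 h)), if_neg hP]
      rfl
  · simp only [Cmd.cost, Expr.cost, active, coincides, Expr.or]
    omega
  · rintro ⟨h13, hag'⟩
    refine ⟨?_, hag.trans hag'⟩
    rw [Store.setVar_var, if_pos rfl, foldl_search] at h13
    cases hf : ((adj z).filter fun w => i.Coincides G z x w)[t - k]? with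
    | some b =>
      rw [hf] at h13
      exact Or.inl ⟨b, rfl, h13⟩
    | none =>
      rw [hf] at h13
      have := List.getElem?_eq_none_iff.1 hf
      simp only [Option.elim_none] at h13
      exact Or.inr ⟨rfl, by omega⟩

end Program

/-! ### Moves of the program -/

namespace Program

open Cmd (does_set does_put does_skip)

variable {n k w D : ℕ} {G : SimpleGraph (Fin n)} {adj : Fin n → List (Fin n)} {s : Store}
  {x : Fin n → Fin k} {i : Idx n k} {z : Fin n}

/-- Make an attempt to make the color of the top of the stack available to the node `z` with `z + 1`
in variable `7`, with the random number in variable `4`. -/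
def resolve : Cmd :=
  gather.seq (.ite (.op .lt (.var 2) (.op .add (.var 4) (.var 14))) .skip
    (.ite (.or (.op .lt (.const 0) (.var 4)) (.op .lt (.const 0) (.var 15))) release
      (.ite (.op .lt (.var 16) (.var 2))
        ((Cmd.set 11 (.get 0 (.var 5))).seq ((Cmd.set 12 (.get 7 (.var 11))).seq
          (.ite (.op .lt (.var 12) (.var 1)) ((Cmd.set 13 (.var 12)).seq collapse)
            ((Cmd.put 0 (.var 10) (.var 11)).seq release))))
        (search.seq (.ite (.op .lt (.var 13) (.var 1))
          ((Cmd.set 11 (.get 0 (.var 13))).seq ((Cmd.set 12 (.get 7 (.var 11))).seq collapse))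
          .skip)))))

theorem resolve_does (hadj : IsAdjacencyList G adj) (hw : Fits n k w adj)
    (hD : ∀ v, (adj v).length ≤ D) (h : Rep adj s x i) {v : Fin n} {l : List (Fin n)} {c : Fin k}
    (hs : i.stk = v :: l) (hl : i.stk.length ≤ n) (hv : s.var 5 = v) (hc : i.pin v = some c)
    (ht : i.target G v = some z) (hz : s.var 7 = z + 1) {r : ℕ} (hr : s.var 4 = r)
    (hrk : r ≤ 2 * k) :
    resolve.Does w s (600 + D * 400) fun s' =>
      Rep adj s' (i.resolve G adj v c z x r).2 (i.apply (i.resolve G adj v c z x r).1) := by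
  classical
  have hsm := hw.small
  have h1 : 1 < 2 ^ w := by omega
  obtain ⟨hzv, -, -⟩ := Idx.target_eq_some.1 ht
  rw [Idx.mem_actNb] at hzv
  have hvz : v ∈ adj z := ((hadj z).2 v).2 hzv.1.symm
  have hxv := h.pin v c hc
  refine ((gather_does hadj hw hD h hv hc hz).bind (T' := 300 + D * 100) ?_).le (by omega)
  rintro s' ⟨h10, h14, h15, h16, hload, hT, hag⟩
  replace h := h.agrees hag (by simp) (by simp)
  have h5 : s'.var 5 = v := by rw [hag.1 5 (by simp), hv]
  have h4 : s'.var 4 = r := by rw [hag.1 4 (by simp), hr]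
  have hrank : i.rank G z x (x z) ≤ x z := by
    rw [← hT.rank_eq hadj h.pin]
    exact Nat.sub_le _ _
  clear hv hz hr hag
  have htest := Expr.tests_lt (w := w) (e := .var 2) (f := .op .add (.var 4) (.var 14)) (s := s') h1
  simp only [Expr.eval, BinOp.run, h4, h14, h.colors] at htest
  rw [Nat.mod_eq_of_lt (by omega)] at htest
  refine (Cmd.Does.ite (T := 290 + D * 100) htest (fun hm => ?_) fun hm => ?_).le
    (by simp only [Expr.cost]; omega)
  · refine (does_skip ?_).le (by omega)
    have : i.resolve G adj v c z x r = (.stay, x) := by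
      rw [Idx.resolve, if_pos (Nat.succ_le_of_lt hm)]
    rw [this]
    exact h
  replace hm : ¬ k + 1 ≤ r + i.load G z := hm
  replace htest := (Expr.tests_lt (w := w) (e := .const 0) (f := .var 4) (s := s') h1).or h1
    (Expr.tests_lt (w := w) (e := .const 0) (f := .var 15) (s := s') h1)
  simp only [Expr.eval, Nat.zero_mod, Nat.pos_iff_ne_zero, h4, h15] at htest
  refine (Cmd.Does.ite (T := 270 + D * 100) htest (fun hb => ?_) fun hb => ?_).le
    (by simp only [Expr.cost, Expr.or]; omega)
  · have : i.resolve G adj v c z x r = (.release z, x) := by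
      rw [Idx.resolve, if_neg hm, if_pos hb]
    rw [this]
    exact (release_does h hs h5 h10).le (by omega)
  replace htest := Expr.tests_lt (w := w) (e := .var 16) (f := .var 2) (s := s') h1
  simp only [Expr.eval, h16, h.colors] at htest
  refine (Cmd.Does.ite (T := 260 + D * 100) htest (fun hlt => ?_) fun hlt => ?_).le
    (by simp only [Expr.cost]; omega)
  · refine ((does_set (m := c) (by simpa [Expr.eval, h5, h.col, Fin.val_inj] using hxv)).bind
      (T' := 250) ?_).le (by simp only [Expr.cost]; omega)
    rintro _ rfl
    have hF := (hT.active v hvz).first_eq (d := x v) hadj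
    rw [hxv] at hF
    refine ((does_set (m := (i.first G z x c).elim n Fin.val) (by simpa [Expr.eval] using hF)).bind
      (T' := 240) ?_).le (by simp only [Expr.cost]; omega)
    rintro _ rfl
    set s₁ := (s'.setVar 11 c).setVar 12 ((i.first G z x c).elim n Fin.val) with hs₁
    have hag : Agrees [11, 12] [] s' s₁ :=
      (agrees_setVar (by simp) _ _).trans (agrees_setVar (by simp) _ _)
    have h' := h.agrees hag (by simp) (by simp)
    replace htest := Expr.tests_lt (w := w) (e := .var 12) (f := .var 1) (s := s₁) h1
    simp only [Expr.eval, h'.nodes, show s₁.var 12 = (i.first G z x c).elim n Fin.val by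
      simp [hs₁]] at htest
    cases hf : i.first G z x c with
    | some a =>
      have : i.resolve G adj v c z x r = (.collapse z c a a, Function.update x z c) := by
        rw [Idx.resolve, if_neg hm, if_neg hb, if_pos hlt, hf]
      rw [this]
      obtain ⟨ha, hxa, -⟩ := Idx.first_eq_some.1 hf
      have haz := Idx.ne_of_mem_actNb ha
      refine (Cmd.Does.ite_pos (T := 200) (htest.ne_zero.2 (by simp [hf])) ?_).le (by simp [Expr.cost])
      refine ((does_set (m := a) (by simp [Expr.eval, hs₁, hf])).bind (T' := 100) ?_).le
        (by simp [Expr.cost])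
      rintro _ rfl
      refine (collapse_does (h'.agrees (agrees_setVar (X := [13]) (Y := []) (by simp) _ _) (by simp)
        (by simp)) (z := z) (e := c) (a := a) (b := a) (by simp [hs₁, h10]) (by simp [hs₁])
        (by simp [hs₁, hf]) (by simp)
        haz haz hxa hxa (by omega) (by simp [hs])).le (by omega)
    | none =>
      have : i.resolve G adj v c z x r = (.release z, Function.update x z c) := by
        rw [Idx.resolve, if_neg hm, if_neg hb, if_pos hlt, hf]
      rw [this]
      refine (Cmd.Does.ite_neg (T := 200) (htest.2 (by simp [hf])) ?_).le (by simp [Expr.cost])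
      refine ((does_put (j := z) (m := c) (by simp [Expr.eval, hs₁, h10])
        (by simp [Expr.eval, hs₁])).bind (T' := 3) ?_).le (by simp [Expr.cost])
      rintro _ rfl
      exact release_does (h'.recolor hzv.2 c) hs (by simp [hs₁, h5]) (by simp [hs₁, h10])
  · have hxz := (x z).2
    refine ((search_does hadj hw hD h h10 h16 (by omega) hT).bind (T' := 200) ?_).le (by omega)
    rintro s₁ ⟨hb', hag⟩
    have h' := h.agrees hag (by simp) (by simp)
    replace htest := Expr.tests_lt (w := w) (e := .var 13) (f := .var 1) (s := s₁) h1
    simp only [Expr.eval, h'.nodes] at htest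
    rcases hb' with ⟨b, hb', h13⟩ | ⟨hb', h13⟩
    · rw [h13] at htest
      have hmem := List.mem_of_getElem? hb'
      simp only [List.mem_filter, decide_eq_true_eq] at hmem
      have hbact := hmem.2.1
      cases hf : i.first G z x (x b) with
      | none => exact absurd rfl (Idx.first_eq_none.1 hf b hbact)
      | some a =>
        have : i.resolve G adj v c z x r = (.collapse z (x b) a b, Function.update x z (x b)) := by
          rw [Idx.resolve, if_neg hm, if_neg hb, if_neg hlt, hb']
          simp only [hf]
        rw [this]
        obtain ⟨ha, hxa, -⟩ := Idx.first_eq_some.1 hf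
        have hF := (hT.active b hmem.1).first_eq (d := x b) hadj
        rw [hf, ← hag.2 7 (by simp)] at hF
        refine (Cmd.Does.ite_pos (T := 150) (htest.ne_zero.2 b.2) ?_).le (by simp [Expr.cost])
        refine ((does_set (m := x b) (by simp [Expr.eval, h13, h'.col])).bind (T' := 140) ?_).le
          (by simp [Expr.cost])
        rintro _ rfl
        refine ((does_set (m := a) (by simpa [Expr.eval] using hF)).bind (T' := 130) ?_).le
          (by simp [Expr.cost])
        rintro _ rfl
        refine (collapse_does (h'.agrees (X := [11, 12]) (Y := []) ((agrees_setVar (by simp) _ _).trans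
          (agrees_setVar (by simp) _ _)) (by simp) (by simp)) (z := z) (e := x b) (a := a) (b := b)
          ?_ (by simp) (by simp) (by simp [h13]) (Idx.ne_of_mem_actNb ha) (Idx.ne_of_mem_actNb hbact)
          hxa rfl (by omega) (by simp [hs])).le (by omega)
        simp [hag.1 10 (by simp), h10]
    · have : i.resolve G adj v c z x r = (.stay, x) := by
        rw [Idx.resolve, if_neg hm, if_neg hb, if_neg hlt, hb']
      rw [this]
      refine (Cmd.Does.ite_neg (T := 0) (htest.2 (not_lt.2 h13)) (does_skip ?_)).le (by simp [Expr.cost])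
      exact h'

/-- Make a move, with the random number in variable `4`. -/
def move : Cmd := findTarget.seq (.ite (.var 7) resolve add)

theorem move_does (hadj : IsAdjacencyList G adj) (hw : Fits n k w adj)
    (hD : ∀ v, (adj v).length ≤ D) (h : Rep adj s x i) (hi : i.Valid) (hne : i.stk ≠ []) {r : ℕ}
    (hr : s.var 4 = r) (hrk : r ≤ 2 * k) :
    move.Does w s (1000 + D * 1000) fun s' =>
      Rep adj s' (Idx.next G adj (x, i) r).1 (Idx.next G adj (x, i) r).2 := by
  have hl : i.stk.length ≤ n := by
    have := hi.1.length_le_card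
    rwa [Fintype.card_fin] at this
  obtain ⟨v, l, hs⟩ := List.exists_cons_of_ne_nil hne
  obtain ⟨c, hc⟩ := Option.ne_none_iff_exists'.1 ((hi.2 v).1 (by simp [hs]))
  refine ((findTarget_does hadj hw hD h hs hl).bind (T' := 700 + D * 700) ?_).le (by omega)
  rintro s' ⟨h5, h7, hag⟩
  have h' := h.agrees hag (by simp) (by simp)
  have h4 : s'.var 4 = r := by rw [hag.1 4 (by simp), hr]
  cases ht : i.target G v with
  | none =>
    rw [ht] at h7
    have : i.move G adj x r = i.add G v x r := by simp [Idx.move, hs, hc, ht]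
    simp only [Idx.next, this]
    exact (Cmd.Does.ite_neg (by simpa [Expr.eval] using h7) (add_does hadj hw hD h' hs hl h5 h4)).le
      (by simp only [Expr.cost]; omega)
  | some z =>
    rw [ht] at h7
    have : i.move G adj x r = i.resolve G adj v c z x r := by simp [Idx.move, hs, hc, ht]
    simp only [Idx.next, this]
    exact (Cmd.Does.ite_pos (by simp [Expr.eval, h7])
      (resolve_does hadj hw hD h' hs hl h5 hc ht h7 h4 hrk)).le (by simp only [Expr.cost]; omega)

end Program

/-! ### The sampling program -/

namespace Program

variable {n k w D : ℕ} {G : SimpleGraph (Fin n)} {adj : Fin n → List (Fin n)} {s : Store}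
  {x : Fin n → Fin k} {i : Idx n k}

/-- Put all nodes on the stack. -/
def init : Cmd :=
  (Cmd.loop (.var 1) ((Cmd.put 5 (.var 4) (.var 4)).seq
    (.set 4 (.op .add (.var 4) (.const 1))))).seq
    ((Cmd.set 3 (.var 1)).seq (.set 0 (.op .eq (.var 1) (.const 0))))

/-- Draw a random number and make a move. -/
def step : Cmd := (Cmd.rand 4 (.msb (.op .sub (.op .add (.var 2) (.var 2)) (.const 1)))).seq move

theorem det_init : init.Det := ⟨⟨trivial, trivial⟩, trivial, trivial⟩

theorem det_move : move.Det := by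
  simp [move, findTarget, resolve, add, gather, search, tables, fill, count, forNb, collapse, freeze,
    activate, release, Cmd.Det]

theorem rep_init (hw : Fits n k w adj) (hk : 0 < k) :
    init.Does w (inputStore n k adj) (20 * (n + 1)) fun s =>
      Rep adj s (fun _ => ⟨0, hk⟩) (Idx.initial n hk) := by
  have hsm := hw.small
  have h1 : 1 < 2 ^ w := by omega
  set body := (Cmd.put 5 (.var 4) (.var 4)).seq (.set 4 (.op .add (.var 4) (.const 1))) with hbody
  have hloop : ∀ j ≤ n, ∃ f : ℕ → ℕ, (body.run w)^[j] (inputStore n k adj)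
      = ⟨Function.update (inputStore n k adj).var 4 j,
        Function.update (inputStore n k adj).arr 5 f⟩ ∧ ∀ l < j, f l = l := by
    intro j
    induction j with
    | zero =>
      refine fun _ => ⟨(inputStore n k adj).arr 5, ?_, by simp⟩
      rw [Function.update_eq_self, show (0 : ℕ) = (inputStore n k adj).var 4 from rfl,
        Function.update_eq_self]
      rfl
    | succ j ih =>
      intro hj
      obtain ⟨f, hf, hfl⟩ := ih (by omega)
      refine ⟨Function.update f j j, ?_, fun l hl => ?_⟩
      · rw [Function.iterate_succ_apply', hf]
        simp only [hbody, Cmd.run, Expr.eval, BinOp.run, Store.setVar, Store.setArr,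
          Function.update_self, Nat.mod_eq_of_lt h1, Function.update_idem]
        rw [Nat.mod_eq_of_lt (by omega)]
      · by_cases h : l = j
        · simp [h]
        · rw [Function.update_of_ne h]
          exact hfl l (by omega)
  obtain ⟨f, hf, hfl⟩ := hloop n le_rfl
  refine ⟨?_, ?_⟩
  · have hrun : init.run w (inputStore n k adj) = ⟨Function.update (Function.update (Function.update
        (inputStore n k adj).var 4 n) 3 n) 0 (if n = 0 then 1 else 0),
        Function.update (inputStore n k adj).arr 5 f⟩ := by
      have hmod : (if n = 0 then 1 else 0) % 2 ^ w = if n = 0 then 1 else 0 := by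
        split_ifs
        · exact Nat.mod_eq_of_lt h1
        · simp
      change ((Cmd.set 3 (.var 1)).seq (.set 0 (.op .eq (.var 1) (.const 0)))).run w
        ((body.run w)^[n] (inputStore n k adj)) = _
      rw [hf]
      simp [Cmd.run, Expr.eval, BinOp.run, Store.setVar, inputStore, hmod]
    rw [hrun]
    refine ⟨rfl, rfl, ⟨fun j => rfl, fun v j hj => ?_⟩, fun v => rfl, fun v => rfl, fun v c hc => ?_,
      fun v => rfl, ?_, fun j v hj => ?_, ?_⟩
    · exact getD_flatten adj v j hj
    · simpa [Idx.initial] using hc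
    · simp [Idx.initial]
    · simp only [Idx.initial, List.reverse_reverse] at hj
      obtain ⟨hlt, rfl⟩ := List.getElem?_eq_some_iff.1 hj
      simp only [List.length_finRange] at hlt
      simp [hfl j hlt]
    · have : (List.finRange n = []) ↔ n = 0 := by
        rw [← List.length_eq_zero_iff, List.length_finRange]
      simp [Idx.initial, this]
  · have hflat : body.Flat := ⟨trivial, trivial⟩
    have hsum : ∑ j ∈ Finset.range n, (1 + body.dur w ((body.run w)^[j] (inputStore n k adj)))
        ≤ n * 8 := by
      calc _ ≤ ∑ _j ∈ Finset.range n, 8 := Finset.sum_le_sum fun j _ => by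
            have := hflat.dur_le (w := w) ((body.run w)^[j] (inputStore n k adj))
            simp only [hbody, Cmd.cost, Expr.cost] at this ⊢
            omega
        _ = _ := by simp
    have hdur : init.dur w (inputStore n k adj)
        = 2 + ∑ j ∈ Finset.range n, (1 + body.dur w ((body.run w)^[j] (inputStore n k adj))) + 6 := rfl
    omega

theorem exec_rand {v : ℕ} {e : Expr} {z : Config} {m : ℕ} (h : e.eval w z.store = m) :
    (Cmd.rand v e).exec w z = (PMF.uniformOfFintype (Fin (2 ^ m))).map fun r =>
      ((z.tick (e.cost + 1)).useBits m).setVar v (r.val % 2 ^ w) := by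
  subst h
  rfl

/-- A step draws a random number and then makes a move. -/
theorem start_step (hw : Fits n k w adj) (h : Rep adj s x i) :
    step.start w s = (PMF.uniformOfFintype (Fin (2 ^ Idx.bits k))).map fun r =>
      ⟨move.run w (s.setVar 4 r), 7 + move.dur w (s.setVar 4 r), Idx.bits k⟩ := by
  have hsm := hw.small
  have h1 : 1 < 2 ^ w := by omega
  have heval : (Expr.msb (.op .sub (.op .add (.var 2) (.var 2)) (.const 1))).eval w s
      = Idx.bits k := by
    simp only [Expr.eval, BinOp.run, h.colors, Nat.mod_eq_of_lt h1]
    rw [Nat.mod_eq_of_lt (show k + k < 2 ^ w by omega),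
      Nat.mod_eq_of_lt (show k + k - 1 < 2 ^ w by omega), Nat.mod_eq_of_lt]
    · rfl
    · exact (Nat.log_le_self 2 _).trans_lt (by omega)
  have hbits : 2 ^ Idx.bits k ≤ 2 ^ w := by
    rcases Nat.eq_zero_or_pos k with rfl | hk
    · simp [Idx.bits, Nat.one_le_two_pow]
    · exact (Idx.two_pow_bits_le hk).trans (by omega)
  rw [Cmd.start, step, Cmd.exec, exec_rand heval, PMF.bind_map, ← PMF.bind_pure_comp]
  refine congrArg _ (funext fun r => ?_)
  simp only [Function.comp, Cmd.exec_eq _ _ det_move, Nat.mod_eq_of_lt (r.2.trans_le hbits)]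
  simp [Config.setVar, Config.useBits, Config.tick, Store.setVar, Expr.cost]

/-- The length of words makes room for small multiples of `n + k`, and for positions in the list of
neighbors, which are at most `n * n`. -/
theorem fits_of_le (hadj : IsAdjacencyList G adj) (hk : 1 ≤ k)
    (hw : 4 * (Nat.log 2 (n + k) + 1) ≤ w) : Fits n k w adj := by
  set N := 2 ^ (Nat.log 2 (n + k) + 1) with hN
  have h1 : n + k < N := Nat.lt_pow_succ_log_self (by norm_num) _
  have h2 : N ^ 4 ≤ 2 ^ w := by
    rw [hN, ← pow_mul, mul_comm]
    exact Nat.pow_le_pow_right (by norm_num) hw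
  have h3 : 2 ≤ N := by omega
  have h4 : N * 8 ≤ N ^ 4 := by
    rw [pow_succ' N 3]
    exact Nat.mul_le_mul_left _ (by simpa using Nat.pow_le_pow_left h3 3)
  have h5 : N * N ≤ N ^ 4 := by
    rw [← pow_two]
    exact Nat.pow_le_pow_right (by omega) (by norm_num)
  refine ⟨by omega, fun j => ?_⟩
  have hD : ∀ v, (adj v).length ≤ n := fun v => by
    have := (hadj v).1.length_le_card
    rwa [Fintype.card_fin] at this
  have h6 := offset_le adj hD j
  have h7 : n * n + n < N * N := by nlinarith
  rcases Nat.eq_zero_or_pos n with rfl | hn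
  · simp at h6
    omega
  · omega

theorem length_le_maxDegree [DecidableRel G.Adj] (hadj : IsAdjacencyList G adj) (v : Fin n) :
    (adj v).length ≤ G.maxDegree := by
  rw [← List.toFinset_card_of_nodup (hadj v).1]
  refine le_trans (le_of_eq ?_) (G.degree_le_maxDegree v)
  rw [← SimpleGraph.card_neighborFinset_eq_degree]
  congr 1
  ext u
  simp [(hadj v).2 u]

/-- In the case `k = 1` no random bits are needed, in accordance with `log 1 = 0`. -/
theorem bits_le (hk : 1 ≤ k) : (Idx.bits k : ℝ) ≤ 3 * Real.log k := by
  rcases Nat.lt_or_ge 1 k with hk1 | hk1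
  · have h2 := Real.log_two_gt_d9
    have hk0 : (0 : ℝ) < k := by exact_mod_cast hk
    have h3 : Real.log 2 ≤ Real.log k := Real.log_le_log (by norm_num) (by exact_mod_cast hk1)
    have h4 : Idx.bits k * Real.log 2 ≤ Real.log 2 + Real.log k := by
      rw [← Real.log_pow, ← Real.log_mul (by norm_num) hk0.ne']
      refine Real.log_le_log (by positivity) ?_
      exact_mod_cast Idx.two_pow_bits_le hk
    nlinarith
  · obtain rfl : k = 1 := by omega
    simp [Idx.bits]

/-- The sampling program. -/
def sampler : Sampler := ⟨init, step⟩

theorem law_init : init.law w s = PMF.pure (init.run w s) := by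
  rw [Cmd.law, Cmd.start, Cmd.exec_eq _ _ det_init, PMF.pure_map]

theorem rep_step (hadj : IsAdjacencyList G adj) (hw : Fits n k w adj) (hk : 1 ≤ k)
    (hD : ∀ v, (adj v).length ≤ D) (h : Rep adj s x i) (hi : i.Valid) (hne : i.stk ≠ [])
    (r : Fin (2 ^ Idx.bits k)) :
    move.Does w (s.setVar 4 r) (1000 + D * 1000) fun s' =>
      Rep adj s' (Idx.next G adj (x, i) r).1 (Idx.next G adj (x, i) r).2 :=
  move_does hadj hw hD (h.agrees (agrees_setVar (X := [4]) (Y := []) (by simp) _ _) (by simp) (by simp))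
    hi hne (by simp) (r.2.le.trans (Idx.two_pow_bits_le hk))

theorem Rep.halted_iff (h : Rep adj s x i) (hi : i.Valid) : s.Halted ↔ i.Done := by
  rw [hi.done_iff]
  exact h.flag

/-- Every store that occurs represents a state and an index. -/
theorem rep_of_reachable (hadj : IsAdjacencyList G adj) (hw : Fits n k w adj) (hk : 1 ≤ k)
    (hs : sampler.Reachable w (inputStore n k adj) s) :
    ∃ (x : Fin n → Fin k) (i : Idx n k), Rep adj s x i ∧ i.Valid := by
  have hD : ∀ v, (adj v).length ≤ n := fun v => by
    have := (hadj v).1.length_le_card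
    rwa [Fintype.card_fin] at this
  obtain ⟨t, ht⟩ := hs
  induction t generalizing s with
  | zero =>
    rw [Sampler.runFor, show sampler.init = init from rfl, law_init, PMF.mem_support_pure_iff] at ht
    exact ⟨_, _, ht ▸ (rep_init hw hk).1, Idx.valid_initial hk⟩
  | succ t ih =>
    obtain ⟨s₀, h₀, hs⟩ := (PMF.mem_support_bind_iff _ _ _).1 ht
    obtain ⟨x, i, h, hi⟩ := ih h₀
    split_ifs at hs with hh
    · obtain rfl := (PMF.mem_support_pure_iff _ _).1 hs
      exact ⟨x, i, h, hi⟩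
    · rw [show sampler.step = step from rfl, Cmd.law, start_step hw h, PMF.map_comp,
        PMF.mem_support_map_iff] at hs
      obtain ⟨r, -, rfl⟩ := hs
      exact ⟨_, _, (rep_step hadj hw hk hD h hi
        (hi.ne_nil fun hd => hh ((h.halted_iff hi).2 hd)) r).1, hi.apply (Idx.possible_move _ _)⟩

/-- The memory determines state and index, so that these are functions of the store. -/
theorem implements (hadj : IsAdjacencyList G adj) (hw : Fits n k w adj) (hk : 1 ≤ k) :
    sampler.Implements w (inputStore n k adj) (Idx.recycler G adj hadj hk) := by
  classical
  have hD : ∀ v, (adj v).length ≤ n := fun v => by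
    have := (hadj v).1.length_le_card
    rwa [Fintype.card_fin] at this
  let R : Store → (Fin n → Fin k) × Idx n k := fun s =>
    if h : ∃ p : (Fin n → Fin k) × Idx n k, Rep adj s p.1 p.2 then h.choose
    else (fun _ => ⟨0, hk⟩, Idx.initial n hk)
  have hR : ∀ {s x i}, Rep adj s x i → R s = (x, i) := by
    intro s x i h
    have hex : ∃ p : (Fin n → Fin k) × Idx n k, Rep adj s p.1 p.2 := ⟨(x, i), h⟩
    have : R s = hex.choose := dif_pos hex
    rw [this]
    exact Prod.ext (hex.choose_spec.state_unique h) (hex.choose_spec.index_unique h)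
  refine ⟨fun s => (R s).1, fun s => (R s).2, fun s hs => ?_, ?_, fun s hs hh => ?_⟩
  · obtain ⟨x, i, h, hi⟩ := rep_of_reachable hadj hw hk hs
    change s.Holds (R s).1 ∧ (s.Halted ↔ (R s).2.Done)
    rw [hR h]
    exact ⟨h.col, h.halted_iff hi⟩
  · rw [show sampler.init = init from rfl, law_init, PMF.pure_map]
    change PMF.pure (R (init.run w (inputStore n k adj))) = _
    rw [hR (rep_init hw hk).1]
    exact (PMF.pure_map (fun x : Fin n → Fin k => (x, Idx.initial n hk)) fun _ => ⟨0, hk⟩).symm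
  · obtain ⟨x, i, h, hi⟩ := rep_of_reachable hadj hw hk hs
    rw [show sampler.step = step from rfl, Cmd.law, start_step hw h, PMF.map_comp, PMF.map_comp]
    change _ = Idx.stepLaw G adj (R s)
    rw [hR h]
    refine congrArg (fun f => PMF.map f _) (funext fun r => ?_)
    have := rep_step hadj hw hk hD h hi (hi.ne_nil fun hd => hh ((h.halted_iff hi).2 hd)) r
    exact hR this.1

end Program

open Program in
theorem theorem1 :
    ∃ (A : Sampler) (C c : ℕ),
      (∀ (n k : ℕ) (G : SimpleGraph (Fin n)) [DecidableRel G.Adj] (adj : Fin n → List (Fin n))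
          (w : ℕ), 1 ≤ k → IsAdjacencyList G adj → c * (Nat.log 2 (n + k) + 1) ≤ w →
        (∃ R : RandomnessRecycler (Fin n → Fin k) (properWeight G),
          A.Implements w (inputStore n k adj) R) ∧
        (∃ p : ℝ≥0∞, ∀ x : Fin n → Fin k,
          A.outputProb w (inputStore n k adj) x = p * properWeight G x) ∧
        (∀ z ∈ (A.init.start w (inputStore n k adj)).support,
          z.time ≤ C * (n + 1) * (G.maxDegree + 1) ∧ (z.bits : ℝ) ≤ C * n * Real.log k) ∧
        (∀ s, A.Reachable w (inputStore n k adj) s → ¬ s.Halted →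
          ∀ z ∈ (A.step.start w s).support,
            z.time ≤ C * (G.maxDegree + 1) ∧
            (z.bits : ℝ) ≤ C * (G.maxDegree + 1) * Real.log k)) ∧
      (∀ Δ k : ℕ, (k : ℝ) > 3.637 * Δ + 1 →
        ∃ a b : ℝ≥0, 0 < a ∧
          ∀ (n : ℕ) (G : SimpleGraph (Fin n)) [DecidableRel G.Adj] (adj : Fin n → List (Fin n))
            (w : ℕ), G.maxDegree = Δ → IsAdjacencyList G adj →
            c * (Nat.log 2 (n + k) + 1) ≤ w →
            a * n ≤ A.expectedSteps w (inputStore n k adj) ∧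
            A.expectedSteps w (inputStore n k adj) ≤ b * n ∧
            ∀ x : Fin n → Fin k, A.outputProb w (inputStore n k adj) x =
              properWeight G x / Nat.card {y : Fin n → Fin k // IsProper G y}) := by
  refine ⟨sampler, 2000, 4, ?_, ?_⟩
  · intro n k G _ adj w hk hadj hw
    replace hw := fits_of_le hadj hk hw
    have himp := implements hadj hw hk
    have hlog : 0 ≤ Real.log k := Real.log_natCast_nonneg k
    refine ⟨⟨_, himp⟩, himp.exists_outputProb, fun z hz => ?_, fun s hs hh z hz => ?_⟩
    · rw [show sampler.init = init from rfl, Cmd.start, Cmd.exec_eq _ _ det_init,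
        PMF.mem_support_pure_iff] at hz
      subst hz
      have := (rep_init hw hk).2
      refine ⟨?_, ?_⟩
      · calc _ ≤ 2000 * (n + 1) * 1 := by simp only [zero_add]; omega
          _ ≤ _ := Nat.mul_le_mul_left _ (by omega)
      · simp only [Nat.cast_zero]
        positivity
    · obtain ⟨x, i, h, hi⟩ := rep_of_reachable hadj hw hk hs
      rw [show sampler.step = step from rfl, start_step hw h, PMF.mem_support_map_iff] at hz
      obtain ⟨r, -, rfl⟩ := hz
      have := (rep_step hadj hw hk (length_le_maxDegree hadj) h hi
        (hi.ne_nil fun hd => hh ((h.halted_iff hi).2 hd)) r).2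
      refine ⟨by simp only; omega, (bits_le hk).trans ?_⟩
      refine mul_le_mul_of_nonneg_right ?_ hlog
      have : (0 : ℝ) ≤ G.maxDegree := Nat.cast_nonneg _
      push_cast
      linarith
  · intro Δ k hk
    have hk1 : 1 ≤ k := by
      have : (0 : ℝ) < k := lt_of_le_of_lt (by positivity) hk
      exact_mod_cast this
    obtain ⟨b, hb⟩ := Idx.exists_tsum_runningProb_le hk
    refine ⟨1, b, one_pos, fun n G _ adj w hΔ hadj hw => ?_⟩
    replace hw := fits_of_le hadj hk1 hw
    have himp := implements hadj hw hk1
    have hsteps := himp.expectedSteps_eq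
    have hdeg : Idx.DegLE G Δ := by
      intro v t ht
      rw [← hΔ]
      refine le_trans (Finset.card_le_card fun u hu => ?_) (G.degree_le_maxDegree v)
      exact (G.mem_neighborFinset v u).2 (ht u hu)
    have hle : sampler.expectedSteps w (inputStore n k adj) ≤ b * n :=
      hsteps.trans_le (hb n G adj hadj hk1 hdeg)
    refine ⟨?_, hle, fun x => ?_⟩
    · rw [hsteps, ENNReal.coe_one, one_mul]
      exact Idx.le_tsum_runningProb hadj hk1
    · obtain ⟨p, hp⟩ := himp.exists_outputProb
      have hsum := himp.sum_outputProb
        (hle.trans_lt (ENNReal.mul_lt_top ENNReal.coe_lt_top (ENNReal.natCast_lt_top n))).ne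
      simp only [hp, ← Finset.mul_sum] at hsum
      have hcard : ∑ y : Fin n → Fin k, (properWeight G y : ℝ≥0∞)
          = Nat.card {y : Fin n → Fin k // IsProper G y} := by
        classical
        rw [Nat.card_eq_fintype_card, Fintype.card_subtype]
        simp only [properWeight, apply_ite ENNReal.ofNNReal, ENNReal.coe_one, ENNReal.coe_zero,
          Finset.sum_boole]
      rw [hcard] at hsum
      rw [hp, ENNReal.eq_inv_of_mul_eq_one_left hsum, ENNReal.div_eq_inv_mul]
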